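/- **Theorem (covariance of the source operator).** Let $n\ge 0$, $0\le k,\ell\le n$, and let $\mathcal E^{k,\ell}(\mathbb R^n\times\mathbb R^n)$ be the space of smooth functions on $\mathbb R^n\times\mathbb R^n$ with values in $\Lambda^k\otimes\Lambda^\ell$, where $\Lambda^k$ is the space of complex-valued alternating $k$-forms on $\mathbb R^n$. *The group.* Let $G=\mathrm{SO}_0(1,n+1)$ be the identity component of the isometry group of $x_0^2-(x_1^2+\dots+x_{n+1}^2)$, with Lie algebra $\mathfrak g$. $G$ acts on the sphere $S^n$ by $(1,g(x'))=c(g,x')\,g(1,x')$, $c(g,x')=(g(1,x'))_0^{-1}$, and hence, by stereographic projection from $-e_{n+1}$, rationally and conformally on $\mathbb R^n$; let $\Omega(g,x)$ denote the conformal factor of $g$ at $x\in\mathbb R^n$. For $\lambda\in\mathbb C$ put $$\pi^k_\lambda(g)\omega(x)=\Omega(g^{-1},x)^{\lambda}\,\omega(g^{-1}(x))\circ Dg^{-1}(x)$$ (a noncompact model of $\mathrm{Ind}_P^G(\sigma_k\otimes\chi_{\lambda+k}\otimes 1)$, where $\sigma_k$ is the representation of $\mathrm{SO}(n)$ on $\Lambda^k$),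 let $d\pi^k_\lambda(X)=\frac{d}{dt}\big|_{t=0}\pi^k_\lambda(\exp tX)$, and $d(\pi^k_\lambda\otimes\pi^\ell_\mu)(X)=d\pi^k_\lambda(X)\otimes\mathrm{id}+\mathrm{id}\otimes d\pi^\ell_\mu(X)$. On forms of bidegree $(k,\ell)$, $(\pi^k_\lambda\otimes\pi^\ell_\mu)(g)$ acts diagonally; for compactly supported $\omega$, the form $(\pi^k_\lambda\otimes\pi^\ell_\mu)(g)\omega$ is extended by $0$ to the points $(x,y)$ such that $g^{-1}$ is not defined at $x$ or not defined at $y$. *The operator.* Let $\varepsilon_j,\iota_j$ be exterior multiplication by $e_j^*$ and interior multiplication by $e_j$, $d=\sum_m\varepsilon_m\partial_m$, $\delta=-\sum_m\iota_m\partial_m$. On $k$-forms, for $s\in\mathbb C$, put $\alpha_{k,s}=(s+n-2k)(s-n+2k-2)$, $\beta_{k,s}=(s-n+2k)(s+n-2k-2)$, $\Box_{k,s}=\alpha_{k,s}\,\delta d+\beta_{k,s}\,d\delta$ and $$\nabla_{k,s,j}=(2-s)\big[\alpha_{k,s}\,\partial_j+2(s-n+2k)\,\varepsilon_j\delta+2(s+n-2k)\,d\iota_j\big].$$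 Acting in $x$ through the first tensor factor and in $y$ through the second, let $$\begin{aligned}E^{k,\ell}_{s,t}={}&-\|x-y\|^2\,\Box_{k,s}\otimes\Box_{\ell,t}+2\sum_{j=1}^n(x_j-y_j)\{\nabla_{k,s,j}\otimes\Box_{\ell,t}-\Box_{k,s}\otimes\nabla_{\ell,t,j}\}+2\sum_{j=1}^n\nabla_{k,s,j}\otimes\nabla_{\ell,t,j}\\&+(t-2)(t-n-2)(t-n+2\ell)(t+n-2\ell)\,\Box_{k,s}\otimes\mathrm{Id}+(s-2)(s-n-2)(s-n+2k)(s+n-2k)\,\mathrm{Id}\otimes\Box_{\ell,t},\end{aligned}$$ and let $F^{k,\ell}_{\lambda,\mu}=-E^{k,\ell}_{n-2\lambda,\,n-2\mu}$ be the source operator. *Claim.* For all $\lambda,\mu\in\mathbb C$: 1. for every $X\in\mathfrak g$, on $\mathcal E^{k,\ell}(\mathbb R^n\times\mathbb R^n)$, $$F^{k,\ell}_{\lambda+k,\,\mu+\ell}\circ d(\pi^k_\lambda\otimes\pi^\ell_\mu)(X)=d(\pi^k_{\lambda+1}\otimes\pi^\ell_{\mu+1})(X)\circ F^{k,\ell}_{\lambda+k,\,\mu+\ell};$$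 2. for every $g\in G$ and every compactly supported $\omega\in\mathcal E^{k,\ell}(\mathbb R^n\times\mathbb R^n)$ (in particular whenever $g^{-1}$ is defined on a neighbourhood of the support of $\omega$), the form $(\pi^k_\lambda\otimes\pi^\ell_\mu)(g)\omega$ is smooth and $$F^{k,\ell}_{\lambda+k,\,\mu+\ell}\big((\pi^k_\lambda\otimes\pi^\ell_\mu)(g)\,\omega\big)=(\pi^k_{\lambda+1}\otimes\pi^\ell_{\mu+1})(g)\big(F^{k,\ell}_{\lambda+k,\,\mu+\ell}\,\omega\big).$$ (The parameter of the source operator is thus the parameter $\lambda+k$ of the inducing character of $\pi^k_\lambda$; equivalently, $F^{k,\ell}_{\lambda,\mu}$ intertwines $\pi^k_{\lambda-k}\otimes\pi^\ell_{\mu-\ell}$ with $\pi^k_{\lambda-k+1}\otimes\pi^\ell_{\mu-\ell+1}$. For $k=\ell=0$ there is no shift.) -/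

import Mathlib

open scoped Matrix

noncomputable section

namespace ConformalForms

/-! ### Forms with values in `Λ^k ⊗ Λ^ℓ` -/

/-- Euclidean space `ℝⁿ`. -/
abbrev Euc (n : ℕ) : Type := EuclideanSpace ℝ (Fin n)

/-- Alternating `k`-forms on `ℝⁿ` with values in `F`; for `F = ℂ` this is `Λ^k`. -/
abbrev Alt (n k : ℕ) (F : Type) [NormedAddCommGroup F] [NormedSpace ℝ F] : Type :=
  Euc n [⋀^Fin k]→L[ℝ] F

/-- The space `Λ^k ⊗ Λ^ℓ`, realized as the alternating `k`-forms with values in `Λ^ℓ`: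
the tensor `α ⊗ β` is the map `u ↦ (v ↦ α u * β v)`. -/
abbrev BiAlt (n k l : ℕ) : Type := Alt n k (Alt n l ℂ)

/-- Differential forms of bidegree `(k, ℓ)` on `ℝⁿ × ℝⁿ` (smoothness is a separate hypothesis). -/
abbrev BiForm (n k l : ℕ) : Type := Euc n × Euc n → BiAlt n k l

section Algebra

variable {n k l : ℕ} {F : Type} [NormedAddCommGroup F] [NormedSpace ℝ F]

/-- The `j`-th standard basis vector of `ℝⁿ`. -/
def e (j : Fin n) : Euc n := EuclideanSpace.single j 1

/-- Exterior multiplication `ε_v η = v^* ∧ η`, where `v^* = ⟨v, ·⟩`. -/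
def extMul (v : Euc n) : Alt n k F →L[ℝ] Alt n (k + 1) F :=
  (ContinuousAlternatingMap.alternatizeUncurryFinCLM ℝ (Euc n) F).comp
    (ContinuousLinearMap.smulRightL ℝ (Euc n) (Alt n k F) (innerSL ℝ v))

/-- Interior multiplication `(ι_v η)(u₁, …, u_k) = η(v, u₁, …, u_k)`. -/
def intMul (v : Euc n) : Alt n (k + 1) F →L[ℝ] Alt n k F :=
  (ContinuousLinearMap.apply ℝ (Alt n k F) v).comp
    (ContinuousAlternatingMap.curryLeftLI (𝕜 := ℝ) (E := Euc n) (F := F) (n := k)).toContinuousLinearMap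

/-- `Id ⊗ T`: a linear map `T : Λ^ℓ → Λ^ℓ'` applied to the second tensor factor. -/
def onSnd {l' : ℕ} (T : Alt n l ℂ →L[ℝ] Alt n l' ℂ) : BiAlt n k l →L[ℝ] BiAlt n k l' :=
  ContinuousLinearMap.compContinuousAlternatingMapCLM ℝ (Euc n) (Alt n l ℂ) (Alt n l' ℂ) (Fin k) T

theorem extMul_apply (v : Euc n) (η : Alt n k F) (u : Fin (k + 1) → Euc n) :
    extMul v η u = ∑ i : Fin (k + 1), (-1) ^ i.val • inner ℝ v (u i) • η (i.removeNth u) := by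
  simp [extMul, ContinuousAlternatingMap.alternatizeUncurryFin_apply]

theorem intMul_apply (v : Euc n) (η : Alt n (k + 1) F) (u : Fin k → Euc n) :
    intMul v η u = η (Matrix.vecCons v u) := rfl

theorem onSnd_apply {l' : ℕ} (T : Alt n l ℂ →L[ℝ] Alt n l' ℂ) (η : BiAlt n k l)
    (u : Fin k → Euc n) : onSnd T η u = T (η u) := rfl

end Algebra

/-! ### Differential operators in the two variables

The suffix `X` (resp. `Y`) marks operators acting in the first variable and first tensor factor
(resp. the second variable and second tensor factor), so that `A ⊗ B` is `A_X ∘ B_Y`. -/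

section Operators

variable {n k l : ℕ}

/-- The partial derivative `∂/∂x_j`. -/
def partialX (j : Fin n) (ω : BiForm n k l) : BiForm n k l := fun p => fderiv ℝ ω p (e j, 0)

/-- The partial derivative `∂/∂y_j`. -/
def partialY (j : Fin n) (ω : BiForm n k l) : BiForm n k l := fun p => fderiv ℝ ω p (0, e j)

/-- The exterior differential `d = ∑ₘ εₘ ∂ₘ` in the first variable. -/
def dX (ω : BiForm n k l) : BiForm n (k + 1) l := fun p => ∑ m : Fin n, extMul (e m) (partialX m ω p)

/-- The exterior differential in the second variable. -/
def dY (ω : BiForm n k l) : BiForm n k (l + 1) :=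
  fun p => ∑ m : Fin n, onSnd (extMul (e m)) (partialY m ω p)

/-- The codifferential `δ = - ∑ₘ ιₘ ∂ₘ` in the first variable, in positive degree. -/
def deltaX (ω : BiForm n (k + 1) l) : BiForm n k l :=
  fun p => -∑ m : Fin n, intMul (e m) (partialX m ω p)

/-- The codifferential in the second variable, in positive degree. -/
def deltaY (ω : BiForm n k (l + 1)) : BiForm n k l :=
  fun p => -∑ m : Fin n, onSnd (intMul (e m)) (partialY m ω p)

/-- `d δ` in the first variable; `δ = 0` on forms of degree `0`. -/
def dDeltaX : {k : ℕ} → BiForm n k l → BiForm n k l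
  | 0, _ => 0
  | _ + 1, ω => dX (deltaX ω)

/-- `d δ` in the second variable. -/
def dDeltaY : {l : ℕ} → BiForm n k l → BiForm n k l
  | 0, _ => 0
  | _ + 1, ω => dY (deltaY ω)

/-- `ε_j δ` in the first variable. -/
def extDeltaX (j : Fin n) : {k : ℕ} → BiForm n k l → BiForm n k l
  | 0, _ => 0
  | _ + 1, ω => fun p => extMul (e j) (deltaX ω p)

/-- `ε_j δ` in the second variable. -/
def extDeltaY (j : Fin n) : {l : ℕ} → BiForm n k l → BiForm n k l
  | 0, _ => 0
  | _ + 1, ω => fun p => onSnd (extMul (e j)) (deltaY ω p)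

/-- `d ι_j` in the first variable; `ι_j = 0` on forms of degree `0`. -/
def dIntX (j : Fin n) : {k : ℕ} → BiForm n k l → BiForm n k l
  | 0, _ => 0
  | _ + 1, ω => dX (fun p => intMul (e j) (ω p))

/-- `d ι_j` in the second variable. -/
def dIntY (j : Fin n) : {l : ℕ} → BiForm n k l → BiForm n k l
  | 0, _ => 0
  | _ + 1, ω => dY (fun p => onSnd (intMul (e j)) (ω p))

/-- The coefficient `α_{k,s} = (s + n - 2k)(s - n + 2k - 2)`. -/
def alpha (n k : ℕ) (s : ℂ) : ℂ := (s + n - 2 * k) * (s - n + 2 * k - 2)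

/-- The coefficient `β_{k,s} = (s - n + 2k)(s + n - 2k - 2)`. -/
def beta (n k : ℕ) (s : ℂ) : ℂ := (s - n + 2 * k) * (s + n - 2 * k - 2)

/-- `□_{k,s} = α_{k,s} δ d + β_{k,s} d δ` in the first variable. -/
def boxX (s : ℂ) (ω : BiForm n k l) : BiForm n k l :=
  alpha n k s • deltaX (dX ω) + beta n k s • dDeltaX ω

/-- `□_{ℓ,t}` in the second variable. -/
def boxY (t : ℂ) (ω : BiForm n k l) : BiForm n k l :=
  alpha n l t • deltaY (dY ω) + beta n l t • dDeltaY ω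

/-- `∇_{k,s,j} = (2 - s) (α_{k,s} ∂_j + 2 (s - n + 2k) ε_j δ + 2 (s + n - 2k) d ι_j)`
in the first variable. -/
def nablaX (s : ℂ) (j : Fin n) (ω : BiForm n k l) : BiForm n k l :=
  (2 - s) • (alpha n k s • partialX j ω + (2 * (s - n + 2 * k)) • extDeltaX j ω
    + (2 * (s + n - 2 * k)) • dIntX j ω)

/-- `∇_{ℓ,t,j}` in the second variable. -/
def nablaY (t : ℂ) (j : Fin n) (ω : BiForm n k l) : BiForm n k l :=
  (2 - t) • (alpha n l t • partialY j ω + (2 * (t - n + 2 * l)) • extDeltaY j ω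
    + (2 * (t + n - 2 * l)) • dIntY j ω)

/-- The differential operator `E_{s,t}^{k,ℓ}` in normal form. -/
def opE (s t : ℂ) (ω : BiForm n k l) : BiForm n k l := fun p =>
  -(‖p.1 - p.2‖ ^ 2 • boxX s (boxY t ω) p)
    + (2 : ℂ) • ∑ j : Fin n,
        (p.1 j - p.2 j) • (nablaX s j (boxY t ω) p - boxX s (nablaY t j ω) p)
    + (2 : ℂ) • ∑ j : Fin n, nablaX s j (nablaY t j ω) p
    + ((t - 2) * (t - n - 2) * (t - n + 2 * l) * (t + n - 2 * l)) • boxX s ω p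
    + ((s - 2) * (s - n - 2) * (s - n + 2 * k) * (s + n - 2 * k)) • boxY t ω p

/-- The source operator `F_{λ,μ}^{k,ℓ} = - E_{n-2λ,n-2μ}^{k,ℓ}`. -/
def sourceOp (lam mu : ℂ) (ω : BiForm n k l) : BiForm n k l :=
  -opE (n - 2 * lam) (n - 2 * mu) ω

end Operators

/-! ### The conformal group and its rational action on `ℝⁿ` -/

section Group

/-- Index set of the coordinates `(x₁, …, x_{n+1})` of `ℝ^{n+1}`, the last one split off. -/
abbrev SphIdx (n : ℕ) : Type := Fin n ⊕ Unit

/-- Real matrices acting on `ℝ^{1,n+1}`, with coordinates `x₀; x₁, …, x_n; x_{n+1}`. -/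
abbrev LMat (n : ℕ) : Type := Matrix (Unit ⊕ SphIdx n) (Unit ⊕ SphIdx n) ℝ

/-- Gram matrix of the form `x₀² - (x₁² + ⋯ + x_{n+1}²)`. -/
abbrev lorentz (n : ℕ) : LMat n := LieAlgebra.Orthogonal.indefiniteDiagonal Unit (SphIdx n) ℝ

/-- The group `O(1,n+1)` of isometries of the Lorentzian form. -/
def isometries (n : ℕ) : Set (LMat n) := {g | gᵀ * lorentz n * g = lorentz n}

/-- `G = SO₀(1,n+1)`: the connected component of the identity in the group of isometries. -/
def conformalGroup (n : ℕ) : Set (LMat n) := connectedComponentIn (isometries n) 1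

/-- The Lie algebra `𝔤 = so(1,n+1)` of `G`. -/
def conformalAlgebra (n : ℕ) : Set (LMat n) := {X | Xᵀ * lorentz n + lorentz n * X = 0}

variable {n : ℕ}

/-- The vector `(1, x')` of `ℝ^{1,n+1}` attached to `x' ∈ ℝ^{n+1}`. -/
def lift (x' : SphIdx n → ℝ) : Unit ⊕ SphIdx n → ℝ := Sum.elim (fun _ => 1) x'

/-- The conformal factor `c(g,x') = (g(1,x'))₀⁻¹` of `g` at the point `x'` of the sphere. -/
def sphereFactor (g : LMat n) (x' : SphIdx n → ℝ) : ℝ := ((g *ᵥ lift x') (Sum.inl ()))⁻¹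

/-- The action on the sphere: `(1, g(x')) = (g(1,x'))₀⁻¹ g(1,x')`. -/
def sphereAct (g : LMat n) (x' : SphIdx n → ℝ) : SphIdx n → ℝ :=
  fun i => sphereFactor g x' * (g *ᵥ lift x') (Sum.inr i)

/-- The inverse `κ` of the stereographic projection from `-e_{n+1}`. -/
def kappa (x : Euc n) : SphIdx n → ℝ :=
  Sum.elim (fun i => 2 * x i / (1 + ‖x‖ ^ 2)) (fun _ => (1 - ‖x‖ ^ 2) / (1 + ‖x‖ ^ 2))

/-- The stereographic projection from `-e_{n+1}`. -/
def stereo (x' : SphIdx n → ℝ) : Euc n :=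
  WithLp.toLp 2 fun i => x' (Sum.inl i) / (1 + x' (Sum.inr ()))

theorem stereo_kappa (x : Euc n) : stereo (kappa x) = x := by
  have h : (0 : ℝ) < 1 + ‖x‖ ^ 2 := by positivity
  ext i
  simp only [stereo, kappa, Sum.elim_inl, Sum.elim_inr]
  field_simp
  ring

/-- `g` is defined at `x ∈ ℝⁿ`: it does not send `κ(x)` to the point `-e_{n+1}` at infinity. -/
def DefinedAt (g : LMat n) (x : Euc n) : Prop := sphereAct g (kappa x) (Sum.inr ()) ≠ -1

/-- The rational action of `g` on `ℝⁿ`, transferred from the sphere by `κ`. -/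
def act (g : LMat n) (x : Euc n) : Euc n := stereo (sphereAct g (kappa x))

/-- The conformal factor `Ω(g,x)` of the rational action on `ℝⁿ`, obtained by the chain rule
from the factor `c(g,κ(x))` on the sphere and the conformal factor `2 / (1 + ‖x‖²)` of `κ`. -/
def confFactor (g : LMat n) (x : Euc n) : ℝ :=
  2 / (1 + ‖x‖ ^ 2) * sphereFactor g (kappa x) * (2 / (1 + ‖act g x‖ ^ 2))⁻¹

end Group

/-! ### The representations -/

section Representations

variable {n k l : ℕ}

/-- Pull-back of an element of `Λ^k ⊗ Λ^ℓ` by `A` in the first and `B` in the second factor. -/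
def pullback (A B : Euc n →L[ℝ] Euc n) (η : BiAlt n k l) : BiAlt n k l :=
  onSnd (ContinuousAlternatingMap.compContinuousLinearMapCLM B) (η.compContinuousLinearMap A)

open Classical in
/-- The exterior tensor product `π_λ^k(g) ⊗ π_μ^ℓ(h)` on forms of bidegree `(k,ℓ)`, where
`π_λ^k(g) ω(x) = Ω(g⁻¹,x)^λ (L_{g⁻¹}^* ω)(x) = Ω(g⁻¹,x)^λ ω(g⁻¹(x)) ∘ Dg⁻¹(x)`.
The result is extended by zero to the points at which `g⁻¹` or `h⁻¹` is not defined. -/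
def rep₂ (lam mu : ℂ) (g h : LMat n) (ω : BiForm n k l) : BiForm n k l := fun p =>
  if DefinedAt g⁻¹ p.1 ∧ DefinedAt h⁻¹ p.2 then
    ((confFactor g⁻¹ p.1 : ℂ) ^ lam * (confFactor h⁻¹ p.2 : ℂ) ^ mu) •
      pullback (fderiv ℝ (act g⁻¹) p.1) (fderiv ℝ (act h⁻¹) p.2) (ω (act g⁻¹ p.1, act h⁻¹ p.2))
  else 0

/-- The tensor product representation `(π_λ^k ⊗ π_μ^ℓ)(g)` of `G` (diagonal action). -/
def rep (lam mu : ℂ) (g : LMat n) (ω : BiForm n k l) : BiForm n k l := rep₂ lam mu g g ω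

/-- The infinitesimal representation
`d(π_λ^k ⊗ π_μ^ℓ)(X) = dπ_λ^k(X) ⊗ id + id ⊗ dπ_μ^ℓ(X)`,
where `dπ_λ^k(X) = d/dt π_λ^k(exp(tX))` at `t = 0`. For fixed `p` and small `t` the action of
`exp(tX)` is defined near `p`, so the derivatives exist for every smooth `ω`. -/
def infRep (lam mu : ℂ) (X : LMat n) (ω : BiForm n k l) : BiForm n k l := fun p =>
  deriv (fun t : ℝ => rep₂ lam mu (NormedSpace.exp (t • X)) 1 ω p) 0
    + deriv (fun t : ℝ => rep₂ lam mu 1 (NormedSpace.exp (t • X)) ω p) 0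

end Representations

end ConformalForms

end

open scoped Matrix

noncomputable section

namespace ConformalForms

/-! ### Exterior and interior multiplication, and the contraction identities for ε_v ι_w. -/

section ExteriorAlgebra

variable {n k l : ℕ} {F : Type} [NormedAddCommGroup F] [NormedSpace ℝ F]

/-! An element of the group acts on ℝⁿ by a Möbius map Φ. If Ω is its conformal factor and θ = ∇ log
Ω, then D²Φ(b,a) = ⟨θ,b⟩DΦa + ⟨θ,a⟩DΦb − ⟨a,b⟩DΦθ and Dθ(b) = ⟨θ,b⟩θ − ½|θ|²b (`IsMobius`). So the
derivative of the weighted pull-back Φ^*f, with weight factor Ω^λ, is the pulled-back derivative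
plus a zeroth-order term `FormModule.conn` of weight Λ = λ + k: λ comes from Ω^λ and k from pulling
back a k-form. This is the origin of the shift of the parameter.

For s = n − 2Λ the coefficients of ∇ and □ are exactly those for which the tensorial parts of the
zeroth-order terms cancel. In one variable, ∇_v(Φ^*f) = Φ^*(∇_{DΦv} f) + (c/2)⟨θ,v⟩Φ^*f, □(Φ^*f) =
Ω²Φ^*(□f) − Φ^*(∇_{DΦθ} f) − (c/4)|θ|²Φ^*f, with c = (s−2)(s−n−2)(s−n+2k)(s+n−2k)
(`FormModule.nabla_pullForm`, `FormModule.box_pullForm`). The proof uses only a few relations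
between ε_v ι_w and pull-back. These are axiomatized in `FormModule`, and each of the two tensor
factors is an instance.

Using these laws first in y and then in x expands E applied to a pulled-back form. The defects
cancel against each other because of exact relations between the values of Φ, DΦ, Ω, θ at the two
points (`TwoPoint`), for instance |Φx−Φy|² = Ω(x)Ω(y)|x−y|². What remains is Ω(x)Ω(y) times the
pull-back of E (`source_identity`, `FormModule.twoE_twoPull`), and this factor raises both weights
by one.

The one-point and two-point relations are read off on the light cone (`ConeMap`): x ↦ (1, x, |x|²)
is quadratic, so its Taylor expansion is exact, and the group acts on it through linear isometries,
with Φ a quotient of linear functions and Ω the inverse of the denominator.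

An isometry never gives a vector of the punctured light cone a vanishing time component, so the
connected group G preserves the future cone. Hence denominators are nonnegative and vanish only at
points sent to infinity. Near such a point the images leave every bounded set, so for compact
support the extension by zero is smooth, and it satisfies the covariance trivially there. This gives
the statement for G. The infinitesimal statement is local: after a cut-off, it is the derivative at
t = 0 of the group statement along exp(tX). -/

@[simp] theorem inner_e_e (i j : Fin n) : inner ℝ (e i) (e j) = if i = j then (1 : ℝ) else 0 := by
  simp [e, EuclideanSpace.inner_single_left]

@[simp] theorem inner_e_right (v : Euc n) (i : Fin n) : inner ℝ v (e i) = v i := by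
  simp [e, EuclideanSpace.inner_single_right]

@[simp] theorem inner_e_left (v : Euc n) (i : Fin n) : inner ℝ (e i) v = v i := by
  simp [e, EuclideanSpace.inner_single_left]

@[simp] theorem e_apply (i j : Fin n) : e i j = if j = i then (1 : ℝ) else 0 := by
  simp [e]

theorem sum_smul_e (v : Euc n) : ∑ i, v i • e i = v := by
  ext j
  simp

theorem inner_eq_sum (u v : Euc n) : inner ℝ u v = ∑ i, u i * v i := by
  simp [PiLp.inner_apply, mul_comm]

/-- A linear map is determined by its values on the standard basis. -/
theorem map_eq_sum {W : Type*} [AddCommGroup W] [Module ℝ W] (T : Euc n →ₗ[ℝ] W) (v : Euc n) :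
    ∑ i, v i • T (e i) = T v := by
  conv_rhs => rw [← sum_smul_e v]
  simp

/-- Makes induction on the degree possible: an identity in degree k + 1 is tested after contraction
with an arbitrary vector. -/
theorem ext_intMul {η ζ : Alt n (k + 1) F} (h : ∀ v, intMul v η = intMul v ζ) : η = ζ := by
  ext u
  have := congrArg (fun ξ : Alt n k F => ξ (Matrix.vecTail u)) (h (Matrix.vecHead u))
  simpa [intMul_apply] using this

theorem extMul_add (v w : Euc n) (η : Alt n k F) : extMul (v + w) η = extMul v η + extMul w η := by
  ext u
  simp [extMul_apply, inner_add_left, add_smul, Finset.sum_add_distrib]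

theorem extMul_smul (c : ℝ) (v : Euc n) (η : Alt n k F) : extMul (c • v) η = c • extMul v η := by
  ext u
  simp only [extMul_apply, inner_smul_left, ContinuousAlternatingMap.smul_apply, Finset.smul_sum]
  refine Finset.sum_congr rfl fun i _ => ?_
  simp [mul_smul, smul_comm c]

theorem intMul_add (v w : Euc n) (η : Alt n (k + 1) F) :
    intMul (v + w) η = intMul v η + intMul w η := by
  simp [intMul]

theorem intMul_smul (c : ℝ) (v : Euc n) (η : Alt n (k + 1) F) :
    intMul (c • v) η = c • intMul v η := by
  simp [intMul]

theorem intMul_self (v : Euc n) (η : Alt n (k + 2) F) : intMul v (intMul v η) = 0 := by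
  ext u
  exact η.map_eq_zero_of_eq (i := 0) (j := 1) _ (by simp) (by simp)

theorem intMul_intMul (v w : Euc n) (η : Alt n (k + 2) F) :
    intMul v (intMul w η) = -intMul w (intMul v η) := by
  have h := intMul_self (v + w) η
  rw [intMul_add, intMul_add, map_add, map_add, intMul_self, intMul_self, zero_add, add_zero] at h
  rw [eq_neg_iff_add_eq_zero, add_comm, ← h]
  abel

/-- `ε_v ι_w` as an operator on forms of any degree, zero in degree `0`. -/
def extInt (v w : Euc n) : {k : ℕ} → Alt n k F →L[ℝ] Alt n k F
  | 0 => 0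
  | _ + 1 => (extMul v).comp (intMul w)

@[simp] theorem extInt_zero (v w : Euc n) (η : Alt n 0 F) : extInt v w η = 0 := rfl

theorem extInt_succ (v w : Euc n) (η : Alt n (k + 1) F) : extInt v w η = extMul v (intMul w η) := rfl

/-- In the alternating sum for ε_v η, the term that removes the inserted vector u gives the inner
product; the others reproduce ε_v ι_u with the opposite sign. Writing the last term with `extInt`
makes the relation valid in degree 0 too. -/
theorem intMul_extMul (u v : Euc n) (η : Alt n k F) :
    intMul u (extMul v η) = inner ℝ u v • η - extInt v u η := by
  ext w
  rw [intMul_apply, extMul_apply, Fin.sum_univ_succ]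
  cases k with
  | zero =>
    simp [real_inner_comm u v, Subsingleton.elim (Fin.removeNth 0 (Matrix.vecCons u w)) w]
  | succ k =>
    rw [extInt_succ, ContinuousAlternatingMap.sub_apply, ContinuousAlternatingMap.smul_apply,
      extMul_apply, sub_eq_add_neg, ← Finset.sum_neg_distrib]
    congr 1
    · simp [real_inner_comm u v]
    · refine Finset.sum_congr rfl fun i _ => ?_
      have : Fin.removeNth i.succ (Matrix.vecCons u w) = Matrix.vecCons u (i.removeNth w) := by
        ext j : 1
        cases j using Fin.cases <;> simp [Fin.removeNth]
      simp [pow_succ, intMul_apply, this]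

theorem extMul_extMul (u v : Euc n) (η : Alt n k F) :
    extMul u (extMul v η) = -extMul v (extMul u η) := by
  induction k with
  | zero =>
    refine ext_intMul fun w => ?_
    simp only [map_neg, intMul_extMul, extInt_succ, extInt_zero, map_smul, sub_zero]
    abel
  | succ k ih =>
    refine ext_intMul fun w => ?_
    simp only [map_neg, intMul_extMul, extInt_succ, map_sub, map_smul]
    rw [ih (intMul w η)]
    abel

theorem extInt_add_left (u v w : Euc n) (η : Alt n k F) :
    extInt (u + v) w η = extInt u w η + extInt v w η := by
  cases k <;> simp [extInt_succ, extMul_add]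

theorem extInt_smul_left (c : ℝ) (v w : Euc n) (η : Alt n k F) :
    extInt (c • v) w η = c • extInt v w η := by
  cases k <;> simp [extInt_succ, extMul_smul]

theorem extInt_add_right (u v w : Euc n) (η : Alt n k F) :
    extInt u (v + w) η = extInt u v η + extInt u w η := by
  cases k <;> simp [extInt_succ, intMul_add]

theorem extInt_smul_right (c : ℝ) (v w : Euc n) (η : Alt n k F) :
    extInt v (c • w) η = c • extInt v w η := by
  cases k <;> simp [extInt_succ, intMul_smul]

theorem sum_inner_smul_intMul (v : Euc n) (η : Alt n (k + 1) F) :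
    ∑ m : Fin n, v m • intMul (e m) η = intMul v η :=
  map_eq_sum ⟨⟨fun u => intMul u η, fun u v => intMul_add u v η⟩, fun c v => intMul_smul c v η⟩ v

theorem sum_inner_smul_extMul (v : Euc n) (η : Alt n k F) :
    ∑ m : Fin n, v m • extMul (e m) η = extMul v η :=
  map_eq_sum ⟨⟨fun u => extMul u η, fun u v => extMul_add u v η⟩, fun c v => extMul_smul c v η⟩ v

theorem sum_smul_extInt_right (u v : Euc n) (η : Alt n k F) :
    ∑ m : Fin n, v m • extInt u (e m) η = extInt u v η :=
  map_eq_sum ⟨⟨fun w => extInt u w η, fun w z => extInt_add_right u w z η⟩,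
    fun c w => extInt_smul_right c u w η⟩ v

theorem sum_smul_extInt_left (u v : Euc n) (η : Alt n k F) :
    ∑ m : Fin n, v m • extInt (e m) u η = extInt v u η :=
  map_eq_sum ⟨⟨fun w => extInt w u η, fun w z => extInt_add_left w z u η⟩,
    fun c w => extInt_smul_left c w u η⟩ v

/-- The number operator. Contracting with w produces ι_w η once from the anticommutator and k times
from the induction hypothesis for ι_w η. -/
theorem sum_extInt (η : Alt n k F) : ∑ m : Fin n, extInt (e m) (e m) η = (k : ℝ) • η := by
  induction k with
  | zero => simp
  | succ k ih =>
    refine ext_intMul fun w => ?_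
    simp only [map_sum, extInt_succ, intMul_extMul, inner_e_right, Finset.sum_sub_distrib, map_smul]
    rw [sum_inner_smul_intMul]
    cases k with
    | zero => simp
    | succ k =>
      have h : ∀ m : Fin n, extInt (e m) w (intMul (e m) η) = -extInt (e m) (e m) (intMul w η) :=
        fun m => by rw [extInt_succ, intMul_intMul, map_neg, extInt_succ]
      simp only [h, Finset.sum_neg_distrib, ih]
      push_cast
      module

theorem sum_intMul_extMul (η : Alt n k F) :
    ∑ m : Fin n, intMul (e m) (extMul (e m) η) = ((n : ℝ) - k) • η := by
  simp only [intMul_extMul, inner_e_e, if_true, Finset.sum_sub_distrib, sum_extInt, sub_smul]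
  simp [← Nat.cast_smul_eq_nsmul ℝ]

/-- The inner sum Σ ι_m ε_m acts in degree k − 1, hence the constant n − (k − 1). -/
theorem sum_extInt_extInt_mm (u v : Euc n) (η : Alt n k F) :
    ∑ m : Fin n, extInt u (e m) (extInt (e m) v η) = ((n : ℝ) - k + 1) • extInt u v η := by
  cases k with
  | zero => simp
  | succ k =>
    simp only [extInt_succ, ← map_sum, sum_intMul_extMul, map_smul]
    push_cast
    congr 1
    ring

theorem extInt_extInt (u v u' v' : Euc n) (η : Alt n (k + 2) F) :
    extInt u v (extInt u' v' η) =
      inner ℝ v u' • extInt u v' η - extMul u (extMul u' (intMul v (intMul v' η))) := by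
  simp [extInt_succ, intMul_extMul]

theorem sum_extInt_extInt_right (u v : Euc n) (η : Alt n k F) :
    ∑ m : Fin n, extInt u (e m) (extInt v (e m) η) = extInt u v η := by
  match k, η with
  | 0, η => simp
  | 1, η =>
    rw [← sum_smul_extInt_right]
    simp only [extInt_succ, intMul_extMul, extInt_zero, sub_zero, map_smul, inner_e_left]
  | k + 2, η =>
    simp only [extInt_extInt, intMul_self, map_zero, sub_zero, inner_e_left, sum_smul_extInt_right]

/-- Anticommuting ι_u past ε_v leaves ⟨u,v⟩ times the number operator in degree k; the remainder is
ε_v (Σ ε_m ι_m) ι_u, where the number operator sees degree k − 1. Degrees 0 and 1 are separate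
because the remainder contracts twice. -/
theorem sum_extInt_extInt_outer (u v : Euc n) (η : Alt n k F) :
    ∑ m : Fin n, extInt (e m) u (extInt v (e m) η) =
      (k * inner ℝ u v) • η - ((k : ℝ) - 1) • extInt v u η := by
  match k, η with
  | 0, η => simp
  | 1, η =>
    have h := sum_extInt η
    simp only [extInt_succ] at h
    simp only [extInt_succ, intMul_extMul, extInt_zero, sub_zero, map_smul, ← Finset.smul_sum, h]
    simp
  | k + 2, η =>
    have h : ∀ m : Fin n, extMul (e m) (extMul v (intMul u (intMul (e m) η))) =
        extMul v (extInt (e m) (e m) (intMul u η)) := fun m => by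
      rw [intMul_intMul, map_neg, map_neg, extMul_extMul, neg_neg, extInt_succ]
    simp only [extInt_extInt, Finset.sum_sub_distrib, ← Finset.smul_sum, sum_extInt, h, ← map_sum,
      map_smul, extInt_succ v u]
    push_cast
    module

theorem sum_extInt_extInt_left (u v : Euc n) (η : Alt n k F) :
    ∑ m : Fin n, extInt (e m) u (extInt (e m) v η) = extInt u v η := by
  match k, η with
  | 0, η => simp
  | 1, η =>
    simp only [extInt_succ, intMul_extMul, extInt_zero, sub_zero, map_smul, inner_e_right]
    rw [sum_inner_smul_extMul]
  | k + 2, η =>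
    have h : ∀ m : Fin n, ∀ ζ : Alt n k F, extMul (e m) (extMul (e m) ζ) = 0 := fun m ζ => by
      have := extMul_extMul (e m) (e m) ζ
      rw [eq_neg_iff_add_eq_zero, ← two_smul ℝ] at this
      exact (smul_eq_zero.1 this).resolve_left two_ne_zero
    simp only [extInt_extInt, h, sub_zero, inner_e_right, sum_smul_extInt_left]

end ExteriorAlgebra

/-! ### Pull-back of alternating forms: conformal maps, smoothness and derivative in the linear map.
-/

section PullBack

variable {n k l : ℕ} {F : Type} [NormedAddCommGroup F] [NormedSpace ℝ F]

/-- Pull-back of alternating forms by a linear map. -/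
def pullAlt (L : Euc n →L[ℝ] Euc n) : Alt n k F →L[ℝ] Alt n k F :=
  ContinuousAlternatingMap.compContinuousLinearMapCLM L

theorem pullAlt_apply (L : Euc n →L[ℝ] Euc n) (η : Alt n k F) (u : Fin k → Euc n) :
    pullAlt L η u = η (fun i => L (u i)) := rfl

theorem intMul_pullAlt (L : Euc n →L[ℝ] Euc n) (v : Euc n) (η : Alt n (k + 1) F) :
    intMul v (pullAlt L η) = pullAlt L (intMul (L v) η) := by
  ext u
  simp only [intMul_apply, pullAlt_apply]
  congr 1
  ext i : 1
  cases i using Fin.cases <;> simp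

theorem pullAlt_extMul {L : Euc n →L[ℝ] Euc n} {c : ℝ} {v w : Euc n}
    (h : ∀ u, inner ℝ w (L u) = c * inner ℝ v u) (η : Alt n k F) :
    pullAlt L (extMul w η) = c • extMul v (pullAlt L η) := by
  ext u
  simp only [pullAlt_apply, extMul_apply, ContinuousAlternatingMap.smul_apply, h, Finset.smul_sum]
  refine Finset.sum_congr rfl fun i _ => ?_
  simp only [mul_smul, smul_comm c]
  rfl

/-- Conformality says that the adjoint of L sends L u to c u, so the covector (L u)^* pulls back to
c u^*; interior multiplication is natural without a factor. -/
theorem pullAlt_extInt {L : Euc n →L[ℝ] Euc n} {c : ℝ}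
    (h : ∀ u v, inner ℝ (L u) (L v) = c * inner ℝ u v) (u v : Euc n) (η : Alt n k F) :
    pullAlt L (extInt (L u) (L v) η) = c • extInt u v (pullAlt L η) := by
  cases k with
  | zero => simp
  | succ k => rw [extInt_succ, pullAlt_extMul (h u), extInt_succ, intMul_pullAlt]

/-- The number operator applied to L^*η, with ι_m moved inside the pull-back. This recursion in the
degree shows that L ↦ L^* is polynomial in the matrix entries, hence smooth. -/
theorem pullAlt_eq_sum (L : Euc n →L[ℝ] Euc n) (η : Alt n (k + 1) F) :
    pullAlt L η = ((k : ℝ) + 1)⁻¹ •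
      ∑ m : Fin n, ∑ i : Fin n, L (e m) i • extMul (e m) (pullAlt L (intMul (e i) η)) := by
  have h : ∀ m : Fin n, ∑ i : Fin n, L (e m) i • extMul (e m) (pullAlt L (intMul (e i) η)) =
      extInt (e m) (e m) (pullAlt L η) := fun m => by
    rw [extInt_succ, intMul_pullAlt, ← sum_inner_smul_intMul]
    simp only [map_sum, map_smul]
  simp only [h, sum_extInt, smul_smul]
  have : (k : ℝ) + 1 ≠ 0 := by positivity
  simp [this]

theorem pullAlt_zero (L : Euc n →L[ℝ] Euc n) (η : Alt n 0 F) : pullAlt L η = η := by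
  ext u
  rw [pullAlt_apply]
  congr 1
  exact Subsingleton.elim _ _

theorem contDiff_clm_step {V W : Type*} [NormedAddCommGroup V] [NormedSpace ℝ V]
    [NormedAddCommGroup W] [NormedSpace ℝ W] (c : ℝ) (T : Fin n → V →L[ℝ] W) (S : Fin n → W →L[ℝ] V)
    {P : (Euc n →L[ℝ] Euc n) → V →L[ℝ] V} (hP : ContDiff ℝ ((⊤ : ℕ∞) : WithTop ℕ∞) P) :
    ContDiff ℝ ((⊤ : ℕ∞) : WithTop ℕ∞) (fun L : Euc n →L[ℝ] Euc n =>
      c • ∑ m : Fin n, ∑ i : Fin n, L (e m) i • (T m).comp ((P L).comp (S i))) := by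
  have hc : ∀ m i : Fin n, ContDiff (F := ℝ) ℝ ((⊤ : ℕ∞) : WithTop ℕ∞)
      (fun L : Euc n →L[ℝ] Euc n => (L (e m) i : ℝ)) := fun m i =>
    ((EuclideanSpace.proj (𝕜 := ℝ) i).comp
      (ContinuousLinearMap.apply ℝ (Euc n) (e m))).contDiff
  exact ContDiff.const_smul _ (ContDiff.sum fun m _ => ContDiff.sum fun i _ =>
    (hc m i).smul (contDiff_const.clm_comp (hP.clm_comp contDiff_const)))

theorem contDiff_pullAlt_clm :
    ContDiff ℝ ((⊤ : ℕ∞) : WithTop ℕ∞)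
      (fun L : Euc n →L[ℝ] Euc n => (pullAlt L : Alt n k F →L[ℝ] Alt n k F)) := by
  induction k with
  | zero =>
    have h : ∀ L : Euc n →L[ℝ] Euc n,
        (pullAlt L : Alt n 0 F →L[ℝ] Alt n 0 F) = ContinuousLinearMap.id ℝ _ := fun L =>
      ContinuousLinearMap.ext fun η => pullAlt_zero L η
    simp only [h]
    exact contDiff_const
  | succ k ih =>
    have h : ∀ L : Euc n →L[ℝ] Euc n, (pullAlt L : Alt n (k + 1) F →L[ℝ] Alt n (k + 1) F) =
        ((k : ℝ) + 1)⁻¹ • ∑ m : Fin n, ∑ i : Fin n,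
          L (e m) i • (extMul (e m)).comp ((pullAlt L).comp (intMul (e i))) := fun L =>
      ContinuousLinearMap.ext fun η => by
        rw [pullAlt_eq_sum]
        simp [sum_apply]
    simp only [h]
    exact contDiff_clm_step _ _ _ ih

theorem contDiff_pullAlt :
    ContDiff ℝ ((⊤ : ℕ∞) : WithTop ℕ∞)
      (fun q : (Euc n →L[ℝ] Euc n) × Alt n k F => pullAlt q.1 q.2) := by
  have h := (contDiff_pullAlt_clm (n := n) (k := k) (F := F)).comp
    (contDiff_fst (E := Euc n →L[ℝ] Euc n) (F := Alt n k F))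
  exact h.clm_apply contDiff_snd

/-- The rank-one endomorphism v^* ⊗ w, extended to forms as a derivation, is ε_v ι_w. -/
theorem sum_update_rankOne (v w : Euc n) (η : Alt n k F) (u : Fin k → Euc n) :
    ∑ i, η (Function.update u i (inner ℝ v (u i) • w)) = extInt v w η u := by
  cases k with
  | zero => simp
  | succ k =>
    rw [extInt_succ, extMul_apply]
    refine Finset.sum_congr rfl fun i _ => ?_
    have h := η.map_insertNth i w (i.removeNth u)
    rw [Fin.insertNth_removeNth] at h
    rw [intMul_apply, ContinuousAlternatingMap.map_update_smul, h, smul_comm]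

/-- Since (L(1 + tA))^* = (1 + tA)^* L^*, the derivative in the direction LA is the derivation
induced by A on L^*η. Here A is of rank one. -/
theorem fderiv_pullAlt (L : Euc n →L[ℝ] Euc n) (v w : Euc n) (η : Alt n k F) :
    fderiv ℝ (fun L => pullAlt L η) L (L.comp ((innerSL ℝ v).smulRight w)) =
      extInt v w (pullAlt L η) := by
  have h := (hasFDerivAt_const η L).continuousAlternatingMapCompContinuousLinearMap (hasFDerivAt_id L)
  have h' : HasFDerivAt (fun L => pullAlt L η) _ L := h
  rw [h'.fderiv]
  ext u
  rw [← sum_update_rankOne]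
  simp only [add_apply, ContinuousLinearMap.comp_apply, map_zero,
    zero_apply, zero_add, ContinuousLinearMap.id_apply,
    ContinuousAlternatingMap.fderivCompContinuousLinearMap_apply, pullAlt_apply]
  refine Finset.sum_congr rfl fun i _ => congrArg η (funext fun j => ?_)
  rcases eq_or_ne j i with rfl | hj
  · simp
  · simp [hj]

end PullBack

/-- A space of values of differential forms on `ℝⁿ` of degree `k`: the operators `N v w = ε_v ι_w`
and the pull-back by linear maps, with the relations between them. -/
structure FormModule (n k : ℕ) (V : Type) [NormedAddCommGroup V] [NormedSpace ℝ V]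
    [NormedSpace ℂ V] where
  N : Euc n → Euc n → V →L[ℝ] V
  pull : (Euc n →L[ℝ] Euc n) → V →L[ℝ] V
  N_add_left : ∀ u v w η, N (u + v) w η = N u w η + N v w η
  N_smul_left : ∀ (c : ℝ) v w η, N (c • v) w η = c • N v w η
  N_add_right : ∀ u v w η, N u (v + w) η = N u v η + N u w η
  N_smul_right : ∀ (c : ℝ) v w η, N v (c • w) η = c • N v w η
  N_csmul : ∀ v w (c : ℂ) η, N v w (c • η) = c • N v w η
  pull_csmul : ∀ L (c : ℂ) η, pull L (c • η) = c • pull L η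
  sum_N : ∀ η, ∑ m : Fin n, N (e m) (e m) η = (k : ℝ) • η
  sum_N_N_middle : ∀ u v η,
    ∑ m : Fin n, N u (e m) (N (e m) v η) = ((n : ℝ) - k + 1) • N u v η
  sum_N_N_right : ∀ u v η, ∑ m : Fin n, N u (e m) (N v (e m) η) = N u v η
  sum_N_N_outer : ∀ u v η, ∑ m : Fin n, N (e m) u (N v (e m) η) =
    (k * inner ℝ u v) • η - ((k : ℝ) - 1) • N v u η
  sum_N_N_left : ∀ u v η, ∑ m : Fin n, N (e m) u (N (e m) v η) = N u v η
  pull_N : ∀ (L : Euc n →L[ℝ] Euc n) (c : ℝ), (∀ u v, inner ℝ (L u) (L v) = c * inner ℝ u v) →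
    ∀ u v η, pull L (N (L u) (L v) η) = c • N u v (pull L η)
  contDiff_pull : ContDiff ℝ ((⊤ : ℕ∞) : WithTop ℕ∞)
    (fun q : (Euc n →L[ℝ] Euc n) × V => pull q.1 q.2)
  fderiv_pull : ∀ (L : Euc n →L[ℝ] Euc n) v w η,
    fderiv ℝ (fun L => pull L η) L (L.comp ((innerSL ℝ v).smulRight w)) = N v w (pull L η)

/-! ### The two factors of Λ^k ⊗ Λ^ℓ as form modules. -/

section Instances

variable {n k l : ℕ} {F : Type} [NormedAddCommGroup F] [NormedSpace ℝ F] [NormedSpace ℂ F]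
  [IsScalarTower ℝ ℂ F]

theorem extMul_csmul (v : Euc n) (c : ℂ) (η : Alt n k F) : extMul v (c • η) = c • extMul v η := by
  ext u
  simp only [extMul_apply, ContinuousAlternatingMap.smul_apply, Finset.smul_sum]
  refine Finset.sum_congr rfl fun i _ => ?_
  rw [smul_comm c, smul_comm c]

theorem intMul_csmul (v : Euc n) (c : ℂ) (η : Alt n (k + 1) F) :
    intMul v (c • η) = c • intMul v η := rfl

theorem extInt_csmul (v w : Euc n) (c : ℂ) (η : Alt n k F) :
    extInt v w (c • η) = c • extInt v w η := by
  cases k <;> simp [extInt_succ, extMul_csmul, intMul_csmul]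

/-- The space `Λ^k ⊗ F` as a space of values of forms of degree `k`. -/
def altModule (n k : ℕ) (F : Type) [NormedAddCommGroup F] [NormedSpace ℝ F] [NormedSpace ℂ F]
    [IsScalarTower ℝ ℂ F] : FormModule n k (Alt n k F) where
  N v w := extInt v w
  pull L := pullAlt L
  N_add_left := extInt_add_left
  N_smul_left := extInt_smul_left
  N_add_right := extInt_add_right
  N_smul_right := extInt_smul_right
  N_csmul := extInt_csmul
  pull_csmul _ _ _ := rfl
  sum_N := sum_extInt
  sum_N_N_middle := sum_extInt_extInt_mm
  sum_N_N_right := sum_extInt_extInt_right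
  sum_N_N_outer := sum_extInt_extInt_outer
  sum_N_N_left := sum_extInt_extInt_left
  pull_N _ _ h := pullAlt_extInt h
  contDiff_pull := contDiff_pullAlt
  fderiv_pull := fderiv_pullAlt

theorem sum_biAlt_apply {ι : Type*} (s : Finset ι) (f : ι → BiAlt n k l) (u : Fin k → Euc n) :
    (∑ i ∈ s, f i) u = ∑ i ∈ s, f i u := by
  simp

theorem map_fderiv_of_contDiff {E V W : Type*} [NormedAddCommGroup E] [NormedSpace ℝ E]
    [NormedAddCommGroup V] [NormedSpace ℝ V] [NormedAddCommGroup W] [NormedSpace ℝ W]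
    (T : V →L[ℝ] W) {f : E → V} (hf : ContDiff ℝ ((⊤ : ℕ∞) : WithTop ℕ∞) f) (x a : E) :
    T (fderiv ℝ f x a) = fderiv ℝ (fun x => T (f x)) x a := by
  have h := T.hasFDerivAt.comp x (hf.differentiable (by simp)).differentiableAt.hasFDerivAt
  exact (congrArg (fun S => S a) h.fderiv).symm

section PostComposition

variable {W W' : Type} [NormedAddCommGroup W] [NormedSpace ℝ W] [NormedAddCommGroup W']
  [NormedSpace ℝ W']

/-- Post-composition of vector-valued alternating forms with a linear map. -/
def postComp (T : W →L[ℝ] W') : Alt n k W →L[ℝ] Alt n k W' :=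
  ContinuousLinearMap.compContinuousAlternatingMapCLM ℝ (Euc n) W W' (Fin k) T

theorem isBoundedBilinearMap_postComp : IsBoundedBilinearMap ℝ
    (fun q : (W →L[ℝ] W') × Alt n k W => (postComp q.1 q.2 : Alt n k W')) where
  add_left _ _ _ := rfl
  smul_left _ _ _ := rfl
  add_right T _ _ := map_add (postComp T) _ _
  smul_right c T _ := map_smul (postComp T) c _
  bound := ⟨1, one_pos, fun T η => by
    rw [one_mul]
    exact T.norm_compContinuousAlternatingMap_le η⟩

theorem contDiff_postComp {E : Type*} [NormedAddCommGroup E] [NormedSpace ℝ E] {P : E → W →L[ℝ] W'}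
    (hP : ContDiff ℝ ((⊤ : ℕ∞) : WithTop ℕ∞) P) :
    ContDiff ℝ ((⊤ : ℕ∞) : WithTop ℕ∞)
      (fun q : E × Alt n k W => (postComp (P q.1) q.2 : Alt n k W')) :=
  isBoundedBilinearMap_postComp.contDiff.comp
    ((hP.comp contDiff_fst).prodMk contDiff_snd)

/-- Evaluation at a fixed tuple is linear and continuous, so derivatives in the second tensor factor
can be computed on Λ^ℓ itself. -/
theorem fderiv_postComp {E : Type*} [NormedAddCommGroup E] [NormedSpace ℝ E] {P : E → W →L[ℝ] W'}
    (hP : ContDiff ℝ ((⊤ : ℕ∞) : WithTop ℕ∞) P) (x a : E) (η : Alt n k W) (u : Fin k → Euc n) :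
    fderiv ℝ (fun x => postComp (P x) η) x a u = fderiv ℝ (fun x => P x (η u)) x a :=
  map_fderiv_of_contDiff (ContinuousAlternatingMap.apply ℝ (Euc n) W' u)
    (f := fun x => postComp (P x) η)
    ((contDiff_postComp hP).comp (contDiff_id.prodMk contDiff_const)) x a

end PostComposition

/-- The space `Λ^k ⊗ Λ^ℓ` as a space of values of forms of degree `ℓ` in the second factor. -/
def sndModule (n k l : ℕ) : FormModule n l (BiAlt n k l) where
  N v w := onSnd (extInt v w)
  pull L := onSnd (pullAlt L)
  N_add_left u v w η := ContinuousAlternatingMap.ext fun z => extInt_add_left u v w (η z)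
  N_smul_left c v w η := ContinuousAlternatingMap.ext fun z => extInt_smul_left c v w (η z)
  N_add_right u v w η := ContinuousAlternatingMap.ext fun z => extInt_add_right u v w (η z)
  N_smul_right c v w η := ContinuousAlternatingMap.ext fun z => extInt_smul_right c v w (η z)
  N_csmul v w c η := ContinuousAlternatingMap.ext fun z => extInt_csmul v w c (η z)
  pull_csmul _ _ _ := rfl
  sum_N η := ContinuousAlternatingMap.ext fun z => by
    rw [sum_biAlt_apply]; exact sum_extInt (η z)
  sum_N_N_middle u v η := ContinuousAlternatingMap.ext fun z => by
    rw [sum_biAlt_apply]; exact sum_extInt_extInt_mm u v (η z)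
  sum_N_N_right u v η := ContinuousAlternatingMap.ext fun z => by
    rw [sum_biAlt_apply]; exact sum_extInt_extInt_right u v (η z)
  sum_N_N_outer u v η := ContinuousAlternatingMap.ext fun z => by
    rw [sum_biAlt_apply]; exact sum_extInt_extInt_outer u v (η z)
  sum_N_N_left u v η := ContinuousAlternatingMap.ext fun z => by
    rw [sum_biAlt_apply]; exact sum_extInt_extInt_left u v (η z)
  pull_N _ _ h u v η := ContinuousAlternatingMap.ext fun z => pullAlt_extInt h u v (η z)
  contDiff_pull := contDiff_postComp contDiff_pullAlt_clm
  fderiv_pull L v w η := ContinuousAlternatingMap.ext fun z =>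
    (fderiv_postComp contDiff_pullAlt_clm L _ η z).trans (fderiv_pullAlt L v w (η z))

/-- The space `Λ^k ⊗ Λ^ℓ` as a space of values of forms of degree `k` in the first factor. -/
def fstModule (n k l : ℕ) : FormModule n k (BiAlt n k l) := altModule n k (Alt n l ℂ)

theorem onSnd_extMul {l' : ℕ} (T : Alt n l ℂ →L[ℝ] Alt n l' ℂ) (v : Euc n) (η : BiAlt n k l) :
    onSnd T (extMul v η) = extMul v (onSnd T η) := by
  refine ContinuousAlternatingMap.ext fun u => ?_
  rw [onSnd_apply, extMul_apply, extMul_apply, map_sum]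
  refine Finset.sum_congr rfl fun i _ => ?_
  rw [← Int.cast_smul_eq_zsmul ℝ, ← Int.cast_smul_eq_zsmul ℝ, map_smul, map_smul, onSnd_apply]

theorem fstModule_N_onSnd {l' : ℕ} (T : Alt n l ℂ →L[ℝ] Alt n l' ℂ) (v w : Euc n)
    (η : BiAlt n k l) :
    (fstModule n k l').N v w (onSnd T η) = onSnd T ((fstModule n k l).N v w η) := by
  change extInt v w (onSnd T η) = onSnd T (extInt v w η)
  cases k with
  | zero =>
    change 0 = onSnd T 0
    rw [map_zero]
  | succ k =>
    rw [extInt_succ, extInt_succ, onSnd_extMul]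
    rfl

end Instances

/-! ### Pointwise algebra: the symbols of ∇ and □ on connection terms. -/

namespace FormModule

variable {n k : ℕ} {V : Type} [NormedAddCommGroup V] [NormedSpace ℝ V] [NormedSpace ℂ V]
  [IsScalarTower ℝ ℂ V] (M : FormModule n k V)

theorem real_smul_eq (r : ℝ) (x : V) : r • x = (r : ℂ) • x :=
  (algebraMap_smul ℂ r x).symm

theorem sum_smul_N_right (u v : Euc n) (ζ : V) : ∑ m : Fin n, v m • M.N u (e m) ζ = M.N u v ζ :=
  map_eq_sum ⟨⟨fun w => M.N u w ζ, fun w z => M.N_add_right u w z ζ⟩,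
    fun c w => M.N_smul_right c u w ζ⟩ v

theorem sum_smul_N_left (u v : Euc n) (ζ : V) : ∑ m : Fin n, v m • M.N (e m) u ζ = M.N v u ζ :=
  map_eq_sum ⟨⟨fun w => M.N w u ζ, fun w z => M.N_add_left w z u ζ⟩,
    fun c w => M.N_smul_left c w u ζ⟩ v

/-- The zeroth-order part of the derivative of a form pulled back by a conformal map with
`θ = d log Ω`. -/
def conn (Λ : ℂ) (θ a : Euc n) (ζ : V) : V :=
  (Λ * (inner ℝ θ a : ℝ)) • ζ + M.N θ a ζ - M.N a θ ζ

variable (Λ : ℂ) (θ : Euc n)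

/-- The contraction that enters through εδ: the constants 1 and −(n − k + 1) of the two quadratic
identities combine with Λ. -/
theorem sum_N_conn_right (u : Euc n) (ζ : V) :
    ∑ m : Fin n, M.N u (e m) (M.conn Λ θ (e m) ζ) = (Λ - n + k) • M.N u θ ζ := by
  simp only [conn, map_add, map_sub, map_smul, M.N_csmul, Finset.sum_add_distrib, Finset.sum_sub_distrib,
    M.sum_N_N_right, M.sum_N_N_middle, inner_e_right, mul_smul, ← Finset.smul_sum,
    ← real_smul_eq, sum_smul_N_right]
  simp only [real_smul_eq]
  push_cast
  module

/-- The contraction that enters through dι; it is the one that produces a multiple of the identity.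
-/
theorem sum_N_conn_left (u : Euc n) (ζ : V) :
    ∑ m : Fin n, M.N (e m) u (M.conn Λ θ (e m) ζ) =
      (Λ - k + 1) • M.N θ u ζ + (k * (inner ℝ θ u : ℝ) : ℂ) • ζ - M.N u θ ζ := by
  simp only [conn, map_add, map_sub, map_smul, M.N_csmul, Finset.sum_add_distrib, Finset.sum_sub_distrib,
    M.sum_N_N_outer, M.sum_N_N_left, inner_e_right, mul_smul, ← Finset.smul_sum,
    ← real_smul_eq, sum_smul_N_left]
  simp only [real_smul_eq, real_inner_comm u θ]
  push_cast
  module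

theorem sum_smul_conn (u : Euc n) (ζ : V) :
    ∑ m : Fin n, u m • M.conn Λ θ (e m) ζ = M.conn Λ θ u ζ := by
  have h : ∑ m : Fin n, (u m * θ m) • ζ = (inner ℝ θ u : ℝ) • ζ := by
    rw [← Finset.sum_smul, real_inner_comm, inner_eq_sum]
  simp only [mul_smul] at h
  simp only [conn, smul_add, smul_sub, Finset.sum_add_distrib, Finset.sum_sub_distrib,
    sum_smul_N_left, sum_smul_N_right, inner_e_right, mul_smul, smul_comm _ Λ, ← Finset.smul_sum,
    ← real_smul_eq, h]

theorem conn_self (ζ : V) : M.conn Λ θ θ ζ = (Λ * (‖θ‖ ^ 2 : ℝ)) • ζ := by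
  simp [conn]

theorem sum_conn_conn (ζ : V) :
    ∑ m : Fin n, M.conn Λ θ (e m) (M.conn Λ θ (e m) ζ) =
      ((Λ ^ 2 - k) * (‖θ‖ ^ 2 : ℝ)) • ζ - ((n : ℂ) - 2 * k) • M.N θ θ ζ := by
  have h : ∀ m : Fin n, M.conn Λ θ (e m) (M.conn Λ θ (e m) ζ) =
      Λ • (θ m • M.conn Λ θ (e m) ζ) + M.N θ (e m) (M.conn Λ θ (e m) ζ)
        - M.N (e m) θ (M.conn Λ θ (e m) ζ) := fun m => by
    conv_lhs => rw [conn]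
    rw [inner_e_right, mul_smul, ← real_smul_eq]
  simp only [h, Finset.sum_add_distrib, Finset.sum_sub_distrib, ← Finset.smul_sum,
    sum_smul_conn, sum_N_conn_left, sum_N_conn_right, conn_self, real_inner_self_eq_norm_sq]
  push_cast
  module

/-- The first-order operator `∇_{k,s,v}` in terms of the first derivative `D`. -/
def nablaSymbol (s : ℂ) (v : Euc n) (D : Euc n →ₗ[ℝ] V) : V :=
  (2 - s) • (alpha n k s • D v - (2 * (s - n + 2 * k)) • ∑ m : Fin n, M.N v (e m) (D (e m))
    + (2 * (s + n - 2 * k)) • ∑ m : Fin n, M.N (e m) v (D (e m)))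

/-- The second-order operator `□_{k,s}` in terms of the second derivative `H`. -/
def boxSymbol (s : ℂ) (H : Euc n → Euc n → V) : V :=
  -(alpha n k s • ∑ i : Fin n, H (e i) (e i))
    - (4 * ((n : ℂ) - 2 * k)) • ∑ i : Fin n, ∑ j : Fin n, M.N (e i) (e j) (H (e i) (e j))

/-- The constant `(s - 2)(s - n - 2)(s - n + 2k)(s + n - 2k)`. -/
def potential (n k : ℕ) (s : ℂ) : ℂ := (s - 2) * (s - n - 2) * (s - n + 2 * k) * (s + n - 2 * k)

/-- For s = n − 2Λ the three summands of ∇ are weighted so that the coefficients of N θ v and N v θ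
vanish. The surviving scalar factors as half the potential. -/
theorem nablaSymbol_conn (η : V) (D D' : Euc n →ₗ[ℝ] V)
    (hD : ∀ a, D' a = M.conn Λ θ a η + D a) (v : Euc n) :
    M.nablaSymbol (n - 2 * Λ) v D' = M.nablaSymbol (n - 2 * Λ) v D
      + (potential n k (n - 2 * Λ) / 2 * (inner ℝ θ v : ℝ)) • η := by
  simp only [nablaSymbol, hD, map_add, Finset.sum_add_distrib, sum_N_conn_left, sum_N_conn_right]
  simp only [conn, alpha, potential]
  module

/-- The second derivative of a form pulled back by a Möbius map with `θ = d log Ω`, in terms of the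
pull-backs `D` and `H` of the first and second derivatives of the form. -/
def hessConn (η : V) (D : Euc n →ₗ[ℝ] V) (H : Euc n → Euc n → V) (b a : Euc n) : V :=
  (inner ℝ θ b : ℝ) • M.conn Λ θ a η
    - (‖θ‖ ^ 2 / 2) • ((Λ * (inner ℝ b a : ℝ)) • η + M.N b a η - M.N a b η)
    + M.conn Λ θ a (M.conn Λ θ b η + D b) + M.conn Λ θ b (D a)
    + (inner ℝ θ b : ℝ) • D a + (inner ℝ θ a : ℝ) • D b - (inner ℝ a b : ℝ) • D θ + H b a

theorem conn_add (a : Euc n) (ζ ξ : V) :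
    M.conn Λ θ a (ζ + ξ) = M.conn Λ θ a ζ + M.conn Λ θ a ξ := by
  simp only [conn, map_add, smul_add]
  abel

theorem sum_hessConn (η : V) (D : Euc n →ₗ[ℝ] V) (H : Euc n → Euc n → V) :
    ∑ i : Fin n, M.hessConn Λ θ η D H (e i) (e i) =
      ((‖θ‖ ^ 2 : ℝ) * (Λ + Λ ^ 2 - k - Λ * n / 2)) • η - ((n : ℂ) - 2 * k) • M.N θ θ η
      + (2 * Λ + 2 - n) • D θ + (2 : ℂ) • ∑ m : Fin n, M.N θ (e m) (D (e m))
      - (2 : ℂ) • ∑ m : Fin n, M.N (e m) θ (D (e m)) + ∑ i : Fin n, H (e i) (e i) := by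
  have hc : ∑ m : Fin n, M.conn Λ θ (e m) (D (e m)) = Λ • D θ
      + ∑ m : Fin n, M.N θ (e m) (D (e m)) - ∑ m : Fin n, M.N (e m) θ (D (e m)) := by
    simp only [conn, Finset.sum_add_distrib, Finset.sum_sub_distrib, inner_e_right, mul_smul,
      ← real_smul_eq, ← Finset.smul_sum, map_eq_sum]
  simp only [hessConn, conn_add, inner_e_right, e_apply, if_true, add_sub_cancel_right,
    Finset.sum_add_distrib, Finset.sum_sub_distrib, sum_smul_conn, conn_self, map_eq_sum,
    sum_conn_conn, hc, Finset.sum_const, Finset.card_univ, Fintype.card_fin]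
  simp only [← Nat.cast_smul_eq_nsmul ℂ, real_smul_eq]
  push_cast
  module

/-- The double trace is taken one index at a time, so that each connection term falls under one of
the two single contractions. -/
theorem sum_N_hessConn (η : V) (D : Euc n →ₗ[ℝ] V) (H : Euc n → Euc n → V) :
    ∑ i : Fin n, ∑ j : Fin n, M.N (e i) (e j) (M.hessConn Λ θ η D H (e i) (e j)) =
      (Λ - n + k) • ((Λ - k + 1) • M.N θ θ η + (k * (‖θ‖ ^ 2 : ℝ) / 2 : ℂ) • η)
      + (Λ - k + 2) • ∑ m : Fin n, M.N θ (e m) (D (e m))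
      + (Λ - n + k) • ∑ m : Fin n, M.N (e m) θ (D (e m))
      + ∑ i : Fin n, ∑ j : Fin n, M.N (e i) (e j) (H (e i) (e j)) := by
  have hB : ∀ i : Fin n, ∑ j : Fin n,
      M.N (e i) (e j) (M.conn Λ θ (e j) (M.conn Λ θ (e i) η + D (e i))) = (Λ - n + k) • (M.N (e i) θ (M.conn Λ θ (e i) η) + M.N (e i) θ (D (e i))) := fun i => by
    rw [sum_N_conn_right, map_add]
  have hC : ∑ i : Fin n, ∑ j : Fin n, M.N (e i) (e j) (M.conn Λ θ (e i) (D (e j))) =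
      (Λ - k + 1) • ∑ j : Fin n, M.N θ (e j) (D (e j)) + (k : ℂ) • D θ
        - ∑ j : Fin n, M.N (e j) θ (D (e j)) := by
    rw [Finset.sum_comm]
    simp only [sum_N_conn_left, Finset.sum_add_distrib, Finset.sum_sub_distrib, inner_e_right,
      mul_smul, ← real_smul_eq, ← Finset.smul_sum, map_eq_sum]
  have hA : ∑ i : Fin n, ∑ j : Fin n, M.N (e i) (e j) ((θ i : ℝ) • M.conn Λ θ (e j) η) =
      (Λ - n + k) • M.N θ θ η := by
    simp only [map_smul, ← Finset.smul_sum, sum_N_conn_right, smul_comm _ (Λ - n + k),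
      sum_smul_N_left]
  have hδ : ∀ ζ : V, ∑ i : Fin n, ∑ j : Fin n, (e i j : ℝ) • M.N (e i) (e j) ζ = (k : ℝ) • ζ := by
    intro ζ
    simp only [e_apply, ite_smul, one_smul, zero_smul, Finset.sum_ite_eq', Finset.mem_univ,
      if_true, M.sum_N]
  have hδ' : ∀ ζ : V, ∑ i : Fin n, ∑ j : Fin n, M.N (e i) (e j) ((e j i : ℝ) • ζ) = (k : ℝ) • ζ := by
    intro ζ
    simp only [map_smul]
    simp only [e_apply, ite_smul, one_smul, zero_smul, Finset.sum_ite_eq, Finset.mem_univ, if_true, M.sum_N]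
  have hE : ∑ i : Fin n, ∑ j : Fin n, M.N (e i) (e j) ((θ i : ℝ) • D (e j)) =
      ∑ j : Fin n, M.N θ (e j) (D (e j)) := by
    rw [Finset.sum_comm]
    simp only [map_smul, sum_smul_N_left]
  have hF : ∑ i : Fin n, ∑ j : Fin n, M.N (e i) (e j) ((θ j : ℝ) • D (e i)) =
      ∑ j : Fin n, M.N (e j) θ (D (e j)) := by
    simp only [map_smul, sum_smul_N_right]
  have hG : ∑ i : Fin n, ∑ j : Fin n, M.N (e i) (e j) ((‖θ‖ ^ 2 / 2) •
      ((Λ * ((e i j : ℝ) : ℂ)) • η + M.N (e i) (e j) η - M.N (e j) (e i) η)) =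
      (‖θ‖ ^ 2 / 2) • (((k : ℂ) * (Λ - n + k)) • η) := by
    simp only [map_smul, map_add, map_sub, mul_smul, M.N_csmul, ← real_smul_eq,
      Finset.sum_add_distrib, Finset.sum_sub_distrib, ← Finset.smul_sum, M.sum_N_N_right,
      M.sum_N_N_middle, M.sum_N, hδ]
    simp only [real_smul_eq]
    push_cast
    module
  simp only [hessConn, inner_e_right, map_add, map_sub, Finset.sum_add_distrib,
    Finset.sum_sub_distrib, hA, hB, hC, hδ', hE, hF, hG, ← Finset.smul_sum, sum_N_conn_left,
    real_inner_self_eq_norm_sq]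
  simp only [real_smul_eq]
  push_cast
  module

/-- The coefficient 4(n − 2k) in □ cancels the N θ θ terms of the two traces; the terms linear in D
combine into exactly −∇_θ. -/
theorem boxSymbol_conn (η : V) (D : Euc n →ₗ[ℝ] V) (H : Euc n → Euc n → V) :
    M.boxSymbol (n - 2 * Λ) (M.hessConn Λ θ η D H) = M.boxSymbol (n - 2 * Λ) H
      - M.nablaSymbol (n - 2 * Λ) θ D
      - (potential n k (n - 2 * Λ) / 4 * (‖θ‖ ^ 2 : ℝ)) • η := by
  simp only [boxSymbol, nablaSymbol, sum_hessConn, sum_N_hessConn, alpha, potential]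
  module

end FormModule

/-! ### Traces over the image of an orthonormal basis under a conformal linear map. -/

section Frames

variable {n : ℕ} {W : Type*} [AddCommGroup W] [Module ℝ W]

/-- A conformal map with nonzero factor is injective, hence surjective in finite dimension. Writing
u = L u', v = L v' reduces the sum to Parseval for the standard basis. -/
theorem sum_inner_frame {L : Euc n →L[ℝ] Euc n} {c : ℝ} (hc : c ≠ 0)
    (hL : ∀ u v, inner ℝ (L u) (L v) = c * inner ℝ u v) (u v : Euc n) :
    ∑ m : Fin n, inner ℝ (L (e m)) u * inner ℝ (L (e m)) v = c * inner ℝ u v := by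
  have hinj : Function.Injective (L : Euc n →ₗ[ℝ] Euc n) := by
    rw [injective_iff_map_eq_zero]
    intro u hu
    have h := hL u u
    rw [show L u = 0 from hu, inner_zero_left] at h
    exact inner_self_eq_zero.1 ((mul_eq_zero.1 h.symm).resolve_left hc)
  obtain ⟨u', rfl⟩ := LinearMap.injective_iff_surjective.1 hinj u
  obtain ⟨v', rfl⟩ := LinearMap.injective_iff_surjective.1 hinj v
  simp only [ContinuousLinearMap.coe_coe, hL, inner_e_left, inner_eq_sum u' v', Finset.mul_sum]
  refine Finset.sum_congr rfl fun m _ => by ring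

theorem conformal_surjective {L : Euc n →L[ℝ] Euc n} {c : ℝ} (hc : c ≠ 0)
    (hL : ∀ u v, inner ℝ (L u) (L v) = c * inner ℝ u v) (u : Euc n) :
    ∃ v, L v = u := by
  have hinj : Function.Injective (L : Euc n →ₗ[ℝ] Euc n) := by
    rw [injective_iff_map_eq_zero]
    intro u hu
    have h := hL u u
    rw [show L u = 0 from hu, inner_zero_left] at h
    exact inner_self_eq_zero.1 ((mul_eq_zero.1 h.symm).resolve_left hc)
  exact LinearMap.injective_iff_surjective.1 hinj u

/-- Besides LᵀL = c, a conformal L satisfies LLᵀ = c, and the trace sees only LLᵀ. -/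
theorem sum_frame {L : Euc n →L[ℝ] Euc n} {c : ℝ} (hc : c ≠ 0)
    (hL : ∀ u v, inner ℝ (L u) (L v) = c * inner ℝ u v) (B : Euc n →ₗ[ℝ] Euc n →ₗ[ℝ] W) :
    ∑ m : Fin n, B (L (e m)) (L (e m)) = c • ∑ m : Fin n, B (e m) (e m) := by
  have h : ∀ m : Fin n, B (L (e m)) (L (e m)) =
      ∑ i : Fin n, ∑ j : Fin n, (L (e m) i * L (e m) j) • B (e i) (e j) := fun m => by
    simp only [mul_smul, ← Finset.smul_sum, map_eq_sum]
    exact (map_eq_sum (B.flip (L (e m))) (L (e m))).symm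
  have h' : ∀ i j : Fin n, ∑ m : Fin n, L (e m) i * L (e m) j = if j = i then c else 0 :=
    fun i j => by
      have := sum_inner_frame hc hL (e i) (e j)
      simpa using this
  simp only [h]
  rw [Finset.sum_comm]
  rw [Finset.smul_sum]
  refine Finset.sum_congr rfl fun i _ => ?_
  rw [Finset.sum_comm]
  simp only [← Finset.sum_smul, h', ite_smul, zero_smul, Finset.sum_ite_eq', Finset.mem_univ,
    if_true]

end Frames

/-- `Φ` is a Möbius map on the open set `U`, with conformal factor `Ω` and `θ = ∇ log Ω`. -/
structure IsMobius {n : ℕ} (U : Set (Euc n)) (Φ : Euc n → Euc n) (Ω : Euc n → ℝ)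
    (θ : Euc n → Euc n) : Prop where
  isOpen : IsOpen U
  pos : ∀ x ∈ U, 0 < Ω x
  contDiffOn : ContDiffOn ℝ ((⊤ : ℕ∞) : WithTop ℕ∞) Φ U
  inner_fderiv : ∀ x ∈ U, ∀ a b,
    inner ℝ (fderiv ℝ Φ x a) (fderiv ℝ Φ x b) = Ω x ^ 2 * inner ℝ a b
  fderiv_fderiv : ∀ x ∈ U, ∀ b a, fderiv ℝ (fderiv ℝ Φ) x b a =
    (inner ℝ (θ x) b : ℝ) • fderiv ℝ Φ x a + (inner ℝ (θ x) a : ℝ) • fderiv ℝ Φ x b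
      - (inner ℝ a b : ℝ) • fderiv ℝ Φ x (θ x)
  hasFDerivAt_factor : ∀ x ∈ U, HasFDerivAt Ω (Ω x • innerSL ℝ (θ x)) x
  hasFDerivAt_grad : ∀ x ∈ U, HasFDerivAt θ
    ((innerSL ℝ (θ x)).smulRight (θ x) - (‖θ x‖ ^ 2 / 2) • ContinuousLinearMap.id ℝ (Euc n)) x

/-! ### First consequences of the Möbius relations. -/

namespace IsMobius

variable {n : ℕ} {U : Set (Euc n)} {Φ : Euc n → Euc n} {Ω : Euc n → ℝ} {θ : Euc n → Euc n}

theorem contDiffAt (h : IsMobius U Φ Ω θ) {x : Euc n} (hx : x ∈ U) :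
    ContDiffAt ℝ ((⊤ : ℕ∞) : WithTop ℕ∞) Φ x :=
  h.contDiffOn.contDiffAt (h.isOpen.mem_nhds hx)

theorem hasFDerivAt (h : IsMobius U Φ Ω θ) {x : Euc n} (hx : x ∈ U) :
    HasFDerivAt Φ (fderiv ℝ Φ x) x :=
  ((h.contDiffAt hx).differentiableAt (by simp)).hasFDerivAt

theorem hasFDerivAt_fderiv (h : IsMobius U Φ Ω θ) {x : Euc n} (hx : x ∈ U) :
    HasFDerivAt (fderiv ℝ Φ) (fderiv ℝ (fderiv ℝ Φ) x) x :=
  (((h.contDiffAt hx).fderiv_right (m := 1) (by norm_cast)).differentiableAt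
    (by simp)).hasFDerivAt

theorem hasFDerivAt_cpow (h : IsMobius U Φ Ω θ) (lam : ℂ) {x : Euc n} (hx : x ∈ U) :
    HasFDerivAt (fun y => (Ω y : ℂ) ^ lam)
      ((innerSL ℝ (θ x)).smulRight (lam * (Ω x : ℂ) ^ lam)) x := by
  have h1 : HasDerivAt (fun t : ℝ => (t : ℂ) ^ lam) (lam * (Ω x : ℂ) ^ (lam - 1)) (Ω x) := by
    have := (hasStrictDerivAt_id (Ω x : ℂ)).hasDerivAt.cpow_const (c := lam)
      (Or.inl (by simpa using h.pos x hx))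
    simpa using this.comp_ofReal
  refine (h1.hasFDerivAt.comp x (h.hasFDerivAt_factor x hx)).congr_fderiv ?_
  ext a
  have hne : (Ω x : ℂ) ≠ 0 := by exact_mod_cast (h.pos x hx).ne'
  simp only [ContinuousLinearMap.comp_apply, ContinuousLinearMap.smulRight_apply,
    ContinuousLinearMap.toSpanSingleton_apply, smul_apply, innerSL_apply_apply, smul_eq_mul,
    Complex.real_smul, Complex.cpow_sub _ _ hne, Complex.cpow_one]
  push_cast
  field_simp

end IsMobius

/-! ### Transformation of ∇ and □ under weighted pull-back in one variable. -/

namespace FormModule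

variable {n k : ℕ} {V : Type} [NormedAddCommGroup V] [NormedSpace ℝ V] [NormedSpace ℂ V]
  [IsScalarTower ℝ ℂ V] (M : FormModule n k V)

/-- The operator `∇_{k,s,v}` in one variable. -/
def nabla (s : ℂ) (v : Euc n) (f : Euc n → V) (x : Euc n) : V :=
  M.nablaSymbol s v (fderiv ℝ f x : Euc n →ₗ[ℝ] V)

/-- The operator `□_{k,s}` in one variable. -/
def box (s : ℂ) (f : Euc n → V) (x : Euc n) : V :=
  M.boxSymbol s fun b a => fderiv ℝ (fun y => fderiv ℝ f y a) x b

/-- The weighted pull-back `Ω^λ Φ^* f`. -/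
def pullForm (lam : ℂ) (Φ : Euc n → Euc n) (Ω : Euc n → ℝ) (f : Euc n → V) (x : Euc n) : V :=
  (Ω x : ℂ) ^ lam • M.pull (fderiv ℝ Φ x) (f (Φ x))

/-- Pull-back is linear in the form but not in the map; its joint smoothness allows the derivative
to be split into the two partial ones. -/
theorem hasFDerivAt_pull {E : Type*} [NormedAddCommGroup E] [NormedSpace ℝ E]
    {L : E → Euc n →L[ℝ] Euc n} {L' : E →L[ℝ] Euc n →L[ℝ] Euc n} {f : E → V} {f' : E →L[ℝ] V}
    {x : E} (hL : HasFDerivAt L L' x) (hf : HasFDerivAt f f' x) :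
    HasFDerivAt (fun y => M.pull (L y) (f y))
      ((fderiv ℝ (fun A => M.pull A (f x)) (L x)).comp L' + (M.pull (L x)).comp f') x := by
  have hG : DifferentiableAt ℝ (fun q : (Euc n →L[ℝ] Euc n) × V => M.pull q.1 q.2) (L x, f x) :=
    (M.contDiff_pull.differentiable (by simp)).differentiableAt
  have h1' : HasFDerivAt (fun A => (A, f x)) _ (L x) :=
    (hasFDerivAt_id (𝕜 := ℝ) (L x)).prodMk (hasFDerivAt_const (f x) (L x))
  have h2' : HasFDerivAt (fun ζ => (L x, ζ)) _ (f x) :=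
    (hasFDerivAt_const (𝕜 := ℝ) (L x) (f x)).prodMk (hasFDerivAt_id (f x))
  have h1 := HasFDerivAt.comp (L x)
    (g := fun q : (Euc n →L[ℝ] Euc n) × V => M.pull q.1 q.2) hG.hasFDerivAt h1'
  have h2 := HasFDerivAt.comp (f x)
    (g := fun q : (Euc n →L[ℝ] Euc n) × V => M.pull q.1 q.2) hG.hasFDerivAt h2'
  refine (hG.hasFDerivAt.comp x (hL.prodMk hf)).congr_fderiv ?_
  have e1 : fderiv ℝ (fun A => M.pull A (f x)) (L x) = _ := h1.fderiv
  have e2 : M.pull (L x) = _ := (M.pull (L x)).hasFDerivAt.unique h2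
  rw [e1, e2]
  ext a
  simp only [ContinuousLinearMap.comp_apply, add_apply, ContinuousLinearMap.prod_apply,
    ContinuousLinearMap.id_apply, zero_apply]
  rw [← map_add]
  simp

/-- Euler's relation: pull-back of k-forms is homogeneous of degree k in the map. Decomposing the
identity into rank-one maps turns this into the number operator. -/
theorem fderiv_pull_self (L : Euc n →L[ℝ] Euc n) (η : V) :
    fderiv ℝ (fun A => M.pull A η) L L = (k : ℝ) • M.pull L η := by
  have h : L = ∑ m : Fin n, L.comp ((innerSL ℝ (e m)).smulRight (e m)) := by
    ext1 v
    conv_lhs => rw [← sum_smul_e v]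
    simp [sum_apply]
  conv_lhs => rw [show ∀ T : (Euc n →L[ℝ] Euc n) →L[ℝ] V, T L = T (∑ m : Fin n,
    L.comp ((innerSL ℝ (e m)).smulRight (e m))) from fun T => by rw [← h]]
  rw [map_sum]
  simp only [M.fderiv_pull, M.sum_N]

variable {U : Set (Euc n)} {Φ : Euc n → Euc n} {Ω : Euc n → ℝ} {θ : Euc n → Euc n}

/-- The Möbius relation reads D²Φ(a) = DΦ ∘ (⟨θ,a⟩ + θ^* ⊗ a − a^* ⊗ θ), and the bracket lies in the
Lie algebra of the conformal linear group; each summand acts on forms as a derivation. -/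
theorem fderiv_pull_fderiv (h : IsMobius U Φ Ω θ) {x : Euc n} (hx : x ∈ U) (a : Euc n) (η : V) :
    fderiv ℝ (fun A => M.pull A η) (fderiv ℝ Φ x) (fderiv ℝ (fderiv ℝ Φ) x a) =
      ((k : ℝ) * inner ℝ (θ x) a) • M.pull (fderiv ℝ Φ x) η
        + M.N (θ x) a (M.pull (fderiv ℝ Φ x) η) - M.N a (θ x) (M.pull (fderiv ℝ Φ x) η) := by
  have hA : fderiv ℝ (fderiv ℝ Φ) x a = (inner ℝ (θ x) a : ℝ) • fderiv ℝ Φ x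
      + (fderiv ℝ Φ x).comp ((innerSL ℝ (θ x)).smulRight a)
      - (fderiv ℝ Φ x).comp ((innerSL ℝ a).smulRight (θ x)) := by
    ext1 b
    simp [h.fderiv_fderiv x hx a b, real_inner_comm]
  rw [hA, map_sub, map_add, map_smul, M.fderiv_pull_self, M.fderiv_pull, M.fderiv_pull, smul_smul,
    mul_comm]

/-- The scalar coefficient of ⟨θ,a⟩ is lam from the power of Ω plus k from the homogeneity of
pull-back: this is where lam + k appears. -/
theorem hasFDerivAt_pullForm (h : IsMobius U Φ Ω θ) (lam : ℂ) {f : Euc n → V} {x : Euc n}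
    (hx : x ∈ U) (hf : DifferentiableAt ℝ f (Φ x)) :
    DifferentiableAt ℝ (M.pullForm lam Φ Ω f) x ∧ ∀ a, fderiv ℝ (M.pullForm lam Φ Ω f) x a =
      M.conn (lam + k) (θ x) a (M.pullForm lam Φ Ω f x)
      + (Ω x : ℂ) ^ lam • M.pull (fderiv ℝ Φ x) (fderiv ℝ f (Φ x) (fderiv ℝ Φ x a)) := by
  have h1 := (h.hasFDerivAt_cpow lam hx).smul (M.hasFDerivAt_pull (h.hasFDerivAt_fderiv hx)
    (hf.hasFDerivAt.comp x (h.hasFDerivAt hx)))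
  refine ⟨h1.differentiableAt, fun a => ?_⟩
  have h2 : fderiv ℝ (M.pullForm lam Φ Ω f) x = _ := h1.fderiv
  rw [h2]
  simp only [add_apply, smul_apply, ContinuousLinearMap.comp_apply,
    ContinuousLinearMap.smulRight_apply, innerSL_apply_apply, Function.comp_apply, pullForm, conn,
    M.fderiv_pull_fderiv h hx, M.N_csmul, real_smul_eq, smul_eq_mul]
  push_cast
  module

/-- `ε_u ι_v` as a continuous linear function of `u`. -/
def NLeft (v : Euc n) : Euc n →L[ℝ] V →L[ℝ] V :=
  LinearMap.toContinuousLinearMap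
    { toFun := fun u => M.N u v
      map_add' := fun u w => ContinuousLinearMap.ext fun η => M.N_add_left u w v η
      map_smul' := fun c u => ContinuousLinearMap.ext fun η => M.N_smul_left c u v η }

/-- `ε_v ι_u` as a continuous linear function of `u`. -/
def NRight (v : Euc n) : Euc n →L[ℝ] V →L[ℝ] V :=
  LinearMap.toContinuousLinearMap
    { toFun := fun u => M.N v u
      map_add' := fun u w => ContinuousLinearMap.ext fun η => M.N_add_right v u w η
      map_smul' := fun c u => ContinuousLinearMap.ext fun η => M.N_smul_right c v u η }

/-- The connection term is linear in θ, so its first two summands here are those obtained by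
inserting Dθ(b) = ⟨θ,b⟩θ − ½|θ|²b. -/
theorem hasFDerivAt_conn (h : IsMobius U Φ Ω θ) (Λ : ℂ) {x : Euc n} (hx : x ∈ U) (a : Euc n)
    {ζ : Euc n → V} (hζ : DifferentiableAt ℝ ζ x) :
    DifferentiableAt ℝ (fun y => M.conn Λ (θ y) a (ζ y)) x ∧
      ∀ b, fderiv ℝ (fun y => M.conn Λ (θ y) a (ζ y)) x b =
        (inner ℝ (θ x) b : ℝ) • M.conn Λ (θ x) a (ζ x)
        - (‖θ x‖ ^ 2 / 2) • ((Λ * (inner ℝ b a : ℝ)) • ζ x + M.N b a (ζ x) - M.N a b (ζ x))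
        + M.conn Λ (θ x) a (fderiv ℝ ζ x b) := by
  have hθ := h.hasFDerivAt_grad x hx
  have h0 : HasFDerivAt (fun y => (inner ℝ a (θ y) : ℝ)) _ x :=
    (innerSL ℝ a).hasFDerivAt.comp x hθ
  have hs := h0.fun_smul hζ.hasFDerivAt
  have hs' : HasFDerivAt (fun y => Λ • ((inner ℝ a (θ y) : ℝ) • ζ y)) _ x := hs.fun_const_smul Λ
  have h1 := (hs'.add (((M.NLeft a).hasFDerivAt.comp x hθ).clm_apply hζ.hasFDerivAt)).sub
    (((M.NRight a).hasFDerivAt.comp x hθ).clm_apply hζ.hasFDerivAt)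
  have h2 := h1.congr_of_eventuallyEq (f₁ := fun y => M.conn Λ (θ y) a (ζ y))
    (Filter.Eventually.of_forall fun y => by
      simp only [conn, mul_smul, ← real_smul_eq, real_inner_comm a]
      rfl)
  refine ⟨h2.differentiableAt, fun b => ?_⟩
  rw [h2.fderiv]
  have hl : ∀ u v, M.NLeft u v = M.N v u := fun u v => rfl
  have hr : ∀ u v, M.NRight u v = M.N u v := fun u v => rfl
  have hNl : ∀ (c d : ℝ) (u w : Euc n) (η : V), M.N (c • u - d • w) a η =
      c • M.N u a η - d • M.N w a η := fun c d u w η => by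
    rw [sub_eq_add_neg, ← neg_smul, M.N_add_left, M.N_smul_left, M.N_smul_left, neg_smul,
      ← sub_eq_add_neg]
  have hNr : ∀ (c d : ℝ) (u w : Euc n) (η : V), M.N a (c • u - d • w) η =
      c • M.N a u η - d • M.N a w η := fun c d u w η => by
    rw [sub_eq_add_neg, ← neg_smul, M.N_add_right, M.N_smul_right, M.N_smul_right, neg_smul,
      ← sub_eq_add_neg]
  simp only [Function.comp_apply, add_apply, sub_apply, smul_apply, ContinuousLinearMap.comp_apply,
    ContinuousLinearMap.smulRight_apply, ContinuousLinearMap.flip_apply, hNl, hNr,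
    ContinuousLinearMap.id_apply, innerSL_apply_apply, map_sub, map_smul, hl, hr, smul_eq_mul,
    conn, real_smul_eq, real_inner_comm (θ x) a, real_inner_comm b a]
  push_cast
  module

theorem fderiv_fderiv_apply {E W : Type*} [NormedAddCommGroup E] [NormedSpace ℝ E]
    [NormedAddCommGroup W] [NormedSpace ℝ W] {f : E → W} {x : E}
    (hf : DifferentiableAt ℝ (fderiv ℝ f) x) (a b : E) :
    fderiv ℝ (fun y => fderiv ℝ f y a) x b = fderiv ℝ (fderiv ℝ f) x b a := by
  have h := hf.hasFDerivAt.clm_apply (hasFDerivAt_const a x)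
  rw [h.fderiv]
  simp

theorem conn_smul (Λ : ℂ) (θ a : Euc n) (c : ℝ) (ζ : V) :
    M.conn Λ θ a (c • ζ) = c • M.conn Λ θ a ζ := by
  simp only [conn, map_smul]
  simp only [real_smul_eq]
  module

/-- `conn` as an additive map. -/
def connHom (Λ : ℂ) (θ a : Euc n) : V →+ V where
  toFun := M.conn Λ θ a
  map_zero' := by simp [conn]
  map_add' := M.conn_add Λ θ a

theorem fderiv_fderiv_pullForm (h : IsMobius U Φ Ω θ) (lam : ℂ) {f : Euc n → V}
    (hf : ContDiff ℝ ((⊤ : ℕ∞) : WithTop ℕ∞) f) {x : Euc n} (hx : x ∈ U) (b a : Euc n) :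
    fderiv ℝ (fun y => fderiv ℝ (M.pullForm lam Φ Ω f) y a) x b =
      M.hessConn (lam + k) (θ x) (M.pullForm lam Φ Ω f x)
        ((Ω x : ℂ) ^ lam • ((M.pull (fderiv ℝ Φ x)).comp
          ((fderiv ℝ f (Φ x)).comp (fderiv ℝ Φ x)) : Euc n →L[ℝ] V) : Euc n →L[ℝ] V)
        (fun b a => (Ω x : ℂ) ^ lam • M.pull (fderiv ℝ Φ x)
          (fderiv ℝ (fun y => fderiv ℝ f y (fderiv ℝ Φ x a)) (Φ x) (fderiv ℝ Φ x b))) b a := by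
  have hd : Differentiable ℝ f := hf.differentiable (by simp)
  have hd2 : Differentiable ℝ (fderiv ℝ f) :=
    (hf.fderiv_right (m := 1) (by norm_cast)).differentiable (by simp)
  have hdm : ∀ v : Euc n, Differentiable ℝ fun z => fderiv ℝ f z v := fun v z =>
    (hd2 z).clm_apply (differentiableAt_const v)
  -- The pulled-back derivative is expanded in the fixed basis. Each coefficient form is then a
  -- weighted pull-back of ∂_m f, so the first-derivative law can be used a second time.
  have heq : (fun y => fderiv ℝ (M.pullForm lam Φ Ω f) y a) =ᶠ[nhds x] fun y =>
      M.conn (lam + k) (θ y) a (M.pullForm lam Φ Ω f y)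
      + ∑ m : Fin n, (inner ℝ (e m) (fderiv ℝ Φ y a) : ℝ) •
          M.pullForm lam Φ Ω (fun z => fderiv ℝ f z (e m)) y := by
    filter_upwards [h.isOpen.mem_nhds hx] with y hy
    rw [(M.hasFDerivAt_pullForm h lam hy (hd _)).2]
    congr 1
    simp only [pullForm, inner_e_left, real_smul_eq, smul_comm _ ((Ω y : ℂ) ^ lam),
      ← Finset.smul_sum]
    simp only [← real_smul_eq, ← map_smul, ← map_sum, sum_smul_e]
  have hη := M.hasFDerivAt_pullForm h lam hx (hd (Φ x))
  have hm := fun m : Fin n => M.hasFDerivAt_pullForm h lam hx (hdm (e m) (Φ x))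
  have hc := M.hasFDerivAt_conn h (lam + k) hx a hη.1
  have hL : ∀ m : Fin n, HasFDerivAt (fun y => (inner ℝ (e m) (fderiv ℝ Φ y a) : ℝ)) _ x := fun m =>
    (innerSL ℝ (e m)).hasFDerivAt.comp x
      ((h.hasFDerivAt_fderiv hx).clm_apply (hasFDerivAt_const a x))
  have hs := hc.1.hasFDerivAt.fun_add (HasFDerivAt.fun_sum (u := Finset.univ) fun m _ =>
    (hL m).fun_smul (hm m).1.hasFDerivAt)
  rw [heq.fderiv_eq, hs.fderiv]
  simp only [add_apply, sum_apply, smul_apply, hc.2, (hm _).2, hη.2,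
    ContinuousLinearMap.smulRight_apply, ContinuousLinearMap.comp_apply,
    ContinuousLinearMap.flip_apply, innerSL_apply_apply, zero_apply, map_zero,
    h.fderiv_fderiv x hx b a]
  have hD : ∀ w : Euc n, ∑ m : Fin n, w m • M.pullForm lam Φ Ω (fun z => fderiv ℝ f z (e m)) x =
      (Ω x : ℂ) ^ lam • M.pull (fderiv ℝ Φ x) (fderiv ℝ f (Φ x) w) := fun w => by
    have := map_eq_sum ((((Ω x : ℂ) ^ lam • ((M.pull (fderiv ℝ Φ x)).comp (fderiv ℝ f (Φ x)) :
      Euc n →L[ℝ] V)) : Euc n →L[ℝ] V) : Euc n →ₗ[ℝ] V) w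
    exact this
  have hH : ∀ v : Euc n, fderiv ℝ (fun z => fderiv ℝ f z v) (Φ x) (fderiv ℝ Φ x b) =
      fderiv ℝ (fderiv ℝ f) (Φ x) (fderiv ℝ Φ x b) v := fun v => fderiv_fderiv_apply (hd2 _) _ _
  have hE : ∀ w : Euc n, ∑ m : Fin n, w m • ((Ω x : ℂ) ^ lam • M.pull (fderiv ℝ Φ x)
      (fderiv ℝ (fderiv ℝ f) (Φ x) (fderiv ℝ Φ x b) (e m))) = (Ω x : ℂ) ^ lam •
        M.pull (fderiv ℝ Φ x) (fderiv ℝ (fderiv ℝ f) (Φ x) (fderiv ℝ Φ x b) w) := fun w =>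
    map_eq_sum ((((Ω x : ℂ) ^ lam • ((M.pull (fderiv ℝ Φ x)).comp
      (fderiv ℝ (fderiv ℝ f) (Φ x) (fderiv ℝ Φ x b)) :
      Euc n →L[ℝ] V)) : Euc n →L[ℝ] V) : Euc n →ₗ[ℝ] V) w
  have hC : ∀ w : Euc n, ∑ m : Fin n, w m • M.conn (lam + k) (θ x) b
      (M.pullForm lam Φ Ω (fun z => fderiv ℝ f z (e m)) x) = M.conn (lam + k) (θ x) b
        ((Ω x : ℂ) ^ lam • M.pull (fderiv ℝ Φ x) (fderiv ℝ f (Φ x) w)) := fun w => by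
    rw [← hD]
    simp only [← conn_smul]
    exact (map_sum (M.connHom (lam + k) (θ x) b) _ _).symm
  simp only [zero_add, inner_add_right, inner_sub_right, inner_smul_right, add_smul, sub_smul,
    smul_add, Finset.sum_add_distrib, Finset.sum_sub_distrib, hH, inner_e_left, hC, hE, hD,
    mul_smul, ← Finset.smul_sum]
  simp only [hessConn, ContinuousLinearMap.coe_coe, smul_apply, ContinuousLinearMap.comp_apply,
    mul_smul, add_smul, smul_add, smul_sub, hH]
  abel

/-- Commuting N with the pull-back costs c⁻¹, and replacing the frame L e_m by e_m in the trace
gains c, so no factor remains. -/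
theorem nablaSymbol_pull {L : Euc n →L[ℝ] Euc n} {c : ℝ} (hc : c ≠ 0)
    (hL : ∀ u v, inner ℝ (L u) (L v) = c * inner ℝ u v) (s z : ℂ) (v : Euc n) {D : Euc n →ₗ[ℝ] V}
    (T : Euc n →ₗ[ℝ] V) (hD : ∀ a, D a = z • M.pull L (T (L a))) :
    M.nablaSymbol s v D = z • M.pull L (M.nablaSymbol s (L v) T) := by
  have hN : ∀ u w ζ, M.N u w (M.pull L ζ) = c⁻¹ • M.pull L (M.N (L u) (L w) ζ) := fun u w ζ => by
    rw [M.pull_N L c hL, smul_smul, inv_mul_cancel₀ hc, one_smul]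
  have h1 := sum_frame hc hL (LinearMap.mk₂ ℝ (fun u w => M.N (L v) u (T w))
    (fun u u' w => M.N_add_right _ _ _ _) (fun a u w => M.N_smul_right _ _ _ _)
    (fun u w w' => by simp) (fun a u w => by simp))
  have h2 := sum_frame hc hL (LinearMap.mk₂ ℝ (fun u w => M.N u (L v) (T w))
    (fun u u' w => M.N_add_left _ _ _ _) (fun a u w => M.N_smul_left _ _ _ _)
    (fun u w w' => by simp) (fun a u w => by simp))
  simp only [LinearMap.mk₂_apply] at h1 h2
  simp only [nablaSymbol, hD, M.N_csmul, hN, ← Finset.smul_sum, ← map_sum, h1, h2, map_smul,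
    smul_smul, inv_mul_cancel₀ hc, one_smul, map_add, map_sub, M.pull_csmul]
  module

/-- The Laplacian trace scales by c. The double trace scales by c², but N past the pull-back costs
c⁻¹, so both parts of □ scale alike. -/
theorem boxSymbol_pull {L : Euc n →L[ℝ] Euc n} {c : ℝ} (hc : c ≠ 0)
    (hL : ∀ u v, inner ℝ (L u) (L v) = c * inner ℝ u v) (s z : ℂ) {H : Euc n → Euc n → V}
    (T : Euc n →ₗ[ℝ] Euc n →ₗ[ℝ] V) (hH : ∀ b a, H b a = z • M.pull L (T (L b) (L a))) :
    M.boxSymbol s H = (c : ℂ) • z • M.pull L (M.boxSymbol s fun b a => T b a) := by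
  have hN : ∀ u w ζ, M.N u w (M.pull L ζ) = c⁻¹ • M.pull L (M.N (L u) (L w) ζ) := fun u w ζ => by
    rw [M.pull_N L c hL, smul_smul, inv_mul_cancel₀ hc, one_smul]
  have h1 : ∀ i : Fin n, ∑ j : Fin n, M.N (L (e i)) (L (e j)) (T (L (e i)) (L (e j))) =
      c • ∑ j : Fin n, M.N (L (e i)) (e j) (T (L (e i)) (e j)) := fun i => by
    have := sum_frame hc hL (LinearMap.mk₂ ℝ (fun u w => M.N (L (e i)) u (T (L (e i)) w))
      (fun u u' w => M.N_add_right _ _ _ _) (fun a u w => M.N_smul_right _ _ _ _)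
      (fun u w w' => by simp) (fun a u w => by simp))
    simpa only [LinearMap.mk₂_apply] using this
  have h2 : ∀ j : Fin n, ∑ i : Fin n, M.N (L (e i)) (e j) (T (L (e i)) (e j)) =
      c • ∑ i : Fin n, M.N (e i) (e j) (T (e i) (e j)) := fun j => by
    have := sum_frame hc hL (LinearMap.mk₂ ℝ (fun u w => M.N u (e j) (T w (e j)))
      (fun u u' w => M.N_add_left _ _ _ _) (fun a u w => M.N_smul_left _ _ _ _)
      (fun u w w' => by simp) (fun a u w => by simp))
    simpa only [LinearMap.mk₂_apply] using this
  have h3 : ∑ i : Fin n, ∑ j : Fin n, M.N (L (e i)) (L (e j)) (T (L (e i)) (L (e j))) =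
      (c * c) • ∑ i : Fin n, ∑ j : Fin n, M.N (e i) (e j) (T (e i) (e j)) := by
    simp only [h1, ← Finset.smul_sum]
    rw [Finset.sum_comm]
    simp only [h2, ← Finset.smul_sum, smul_smul]
    rw [Finset.sum_comm]
  simp only [boxSymbol, hH, M.N_csmul, hN, ← Finset.smul_sum, ← map_sum, h3, sum_frame hc hL T,
    map_smul, smul_smul, inv_mul_cancel_left₀ hc, map_neg, map_sub, M.pull_csmul]
  simp only [real_smul_eq]
  module

theorem nabla_pullForm (h : IsMobius U Φ Ω θ) (lam : ℂ) {f : Euc n → V} {x : Euc n} (hx : x ∈ U)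
    (hf : DifferentiableAt ℝ f (Φ x)) (v : Euc n) :
    M.nabla (n - 2 * (lam + k)) v (M.pullForm lam Φ Ω f) x =
      (Ω x : ℂ) ^ lam • M.pull (fderiv ℝ Φ x)
        (M.nabla (n - 2 * (lam + k)) (fderiv ℝ Φ x v) f (Φ x))
      + (potential n k (n - 2 * (lam + k)) / 2 * (inner ℝ (θ x) v : ℝ)) •
        M.pullForm lam Φ Ω f x := by
  have hΩ : Ω x ^ 2 ≠ 0 := pow_ne_zero 2 (h.pos x hx).ne'
  rw [nabla, M.nablaSymbol_conn (lam + k) (θ x) (M.pullForm lam Φ Ω f x)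
    (((Ω x : ℂ) ^ lam • ((M.pull (fderiv ℝ Φ x)).comp
          ((fderiv ℝ f (Φ x)).comp (fderiv ℝ Φ x)) : Euc n →L[ℝ] V) : Euc n →L[ℝ] V) :
            Euc n →ₗ[ℝ] V) _ (M.hasFDerivAt_pullForm h lam hx hf).2]
  congr 1
  exact M.nablaSymbol_pull hΩ (h.inner_fderiv x hx) _ _ v _ fun a => rfl

theorem box_pullForm (h : IsMobius U Φ Ω θ) (lam : ℂ) {f : Euc n → V} {x : Euc n} (hx : x ∈ U)
    (hf : ContDiff ℝ ((⊤ : ℕ∞) : WithTop ℕ∞) f) :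
    M.box (n - 2 * (lam + k)) (M.pullForm lam Φ Ω f) x =
      ((Ω x ^ 2 : ℝ) : ℂ) • (Ω x : ℂ) ^ lam • M.pull (fderiv ℝ Φ x)
        (M.box (n - 2 * (lam + k)) f (Φ x))
      - (Ω x : ℂ) ^ lam • M.pull (fderiv ℝ Φ x)
        (M.nabla (n - 2 * (lam + k)) (fderiv ℝ Φ x (θ x)) f (Φ x))
      - (potential n k (n - 2 * (lam + k)) / 4 * (‖θ x‖ ^ 2 : ℝ)) • M.pullForm lam Φ Ω f x := by
  have hΩ : Ω x ^ 2 ≠ 0 := pow_ne_zero 2 (h.pos x hx).ne'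
  have hd2 : Differentiable ℝ (fderiv ℝ f) :=
    (hf.fderiv_right (m := 1) (by norm_cast)).differentiable (by simp)
  have hfun : (fun b a => fderiv ℝ (fun y => fderiv ℝ (M.pullForm lam Φ Ω f) y a) x b) = _ :=
    funext fun b => funext fun a => M.fderiv_fderiv_pullForm h lam hf hx b a
  rw [box, hfun]
  refine (M.boxSymbol_conn (lam + k) (θ x) _ _ _).trans ?_
  congr 2
  · have hT : ∀ b a : Euc n, fderiv ℝ (fun y => fderiv ℝ f y a) (Φ x) b =
        fderiv ℝ (fderiv ℝ f) (Φ x) b a := fun b a => fderiv_fderiv_apply (hd2 _) a b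
    simp only [box, hT]
    exact M.boxSymbol_pull hΩ (h.inner_fderiv x hx) _ _ (LinearMap.mk₂ ℝ
      (fun b a => fderiv ℝ (fderiv ℝ f) (Φ x) b a) (by simp) (by simp) (by simp) (by simp))
      fun b a => rfl
  · exact M.nablaSymbol_pull hΩ (h.inner_fderiv x hx) _ _ _ _ fun a => rfl

end FormModule

/-- The algebraic identity behind the covariance of the source operator: `bb`, `nb*`, … are the
pulled-back values of `□ ⊗ □`, `∇_* ⊗ □`, … . -/
theorem source_identity {V : Type*} [AddCommGroup V] [Module ℂ V]
    {Ω Ω' r R a b tz tz' tt P Q c c' : ℂ}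
    {bb b1 ob oo nbx nbz nbt bnx bnz bnt nntt nnzt nntz S T n1t n1z n1t' ont onz ont' : V}
    (h1 : Ω • nbx = Ω' • (nbz + (r / 2) • nbt)) (h2 : Ω' • bnx = Ω • (bnz - (r / 2) • bnt))
    (h3 : R = Ω * Ω' * r) (h4 : (Ω * Ω') • T = S + nntz - nnzt - (r / 2) • nntt)
    (hP : P = 1 - tz' + b * r / 4) (hQ : Q = 1 + tz + a * r / 4)
    (h5 : Ω' = Ω * P) (h6 : Ω = Ω' * Q)
    (h7 : n1t' = P • n1t + (b / 2) • n1z) (h8 : ont' = Q • ont - (a / 2) • onz)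
    (h9 : P * a = b) (h10 : Q * b = a) (h11 : P * a = tt - b * tz / 2) :
    -(r • (Ω ^ 2 • (Ω' ^ 2 • bb - bnt - (c' / 4 * b) • b1)
          - (Ω' ^ 2 • nbt - nntt - (c' / 4 * b) • n1t)
          - (c / 4 * a) • (Ω' ^ 2 • ob - ont - (c' / 4 * b) • oo)))
      + (2 : ℂ) • ((Ω' ^ 2 • nbz - nnzt - (c' / 4 * b) • n1z
            + (c / 2 * tz) • (Ω' ^ 2 • ob - ont - (c' / 4 * b) • oo))
          - (Ω ^ 2 • (bnz + (c' / 2 * tz') • b1) - (nntz + (c' / 2 * tz') • n1t)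
            - (c / 4 * a) • (onz + (c' / 2 * tz') • oo)))
      + (2 : ℂ) • (S + (c' / 2) • n1t' + (c / 2) • ont' + (c * c' / 4 * tt) • oo)
      + c' • (Ω ^ 2 • b1 - n1t - (c / 4 * a) • oo)
      + c • (Ω' ^ 2 • ob - ont - (c' / 4 * b) • oo) =
    (Ω * Ω') • (-(R • bb) + (2 : ℂ) • (nbx - bnx) + (2 : ℂ) • T + c' • b1 + c • ob) := by
  have e1 : (Ω * Ω') • nbx = Ω' ^ 2 • (nbz + (r / 2) • nbt) := by
    rw [mul_comm, mul_smul, h1, smul_smul, sq]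
  have e2 : (Ω * Ω') • bnx = Ω ^ 2 • (bnz - (r / 2) • bnt) := by
    rw [mul_smul, h2, smul_smul, sq]
  have e5 : (Ω * Ω') • b1 = (Ω ^ 2 * (1 - tz' + b * r / 4)) • b1 := by
    congr 1
    linear_combination Ω * h5 + Ω ^ 2 * hP
  have e6 : (Ω * Ω') • ob = (Ω' ^ 2 * (1 + tz + a * r / 4)) • ob := by
    congr 1
    linear_combination Ω' * h6 + Ω' ^ 2 * hQ
  have e7 : n1t' = (1 - tz' + b * r / 4) • n1t + (b / 2) • n1z := by rw [h7, hP]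
  have e8 : ont' = (1 + tz + a * r / 4) • ont - (a / 2) • onz := by rw [h8, hQ]
  -- The zeroth-order terms, with their common factor c c'/4 removed. They have no counterpart on
  -- the right-hand side and must cancel among themselves.
  have e9 : (-(r * a * b) / 4 - tz * b + a * tz' + 2 * tt - a - b) • oo = (0 : ℂ) • oo := by
    congr 1
    rw [hP] at h9 h11
    rw [hQ] at h10
    linear_combination -2 * h11 + h9
  rw [h3]
  linear_combination (norm := module) (-2 : ℂ) • e1 + (2 : ℂ) • e2 - (2 : ℂ) • h4 - c' • e5 - c • e6
    + c' • e7 + c • e8 + (c * c' / 4) • e9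

/-! ### Linearity, locality and smooth parameter dependence of ∇ and □. -/

namespace FormModule

variable {n k l : ℕ} {V : Type} [NormedAddCommGroup V] [NormedSpace ℝ V] [NormedSpace ℂ V]
  [IsScalarTower ℝ ℂ V]

section Linearity

variable (M : FormModule n k V)

theorem nablaSymbol_add (s : ℂ) (v : Euc n) (D D' : Euc n →ₗ[ℝ] V) :
    M.nablaSymbol s v (D + D') = M.nablaSymbol s v D + M.nablaSymbol s v D' := by
  simp only [nablaSymbol, LinearMap.add_apply, map_add, Finset.sum_add_distrib]
  module

/-- Applied to maps acting on the other tensor factor, such as its weighted pull-back, and to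
complex scalars; both commute with every N. -/
theorem nablaSymbol_map (s : ℂ) (v : Euc n) {D D' : Euc n →ₗ[ℝ] V} (A : V →L[ℝ] V)
    (hA : ∀ (c : ℂ) η, A (c • η) = c • A η) (hN : ∀ u w η, A (M.N u w η) = M.N u w (A η))
    (hD : ∀ a, D' a = A (D a)) :
    M.nablaSymbol s v D' = A (M.nablaSymbol s v D) := by
  simp only [nablaSymbol, hD, map_add, map_sub, map_sum, hA, hN]

theorem boxSymbol_add (s : ℂ) (H H' : Euc n → Euc n → V) :
    M.boxSymbol s (fun b a => H b a + H' b a) = M.boxSymbol s H + M.boxSymbol s H' := by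
  simp only [boxSymbol, map_add, Finset.sum_add_distrib]
  module

theorem boxSymbol_map (s : ℂ) {H H' : Euc n → Euc n → V} (A : V →L[ℝ] V)
    (hA : ∀ (c : ℂ) η, A (c • η) = c • A η) (hN : ∀ u w η, A (M.N u w η) = M.N u w (A η))
    (hH : ∀ b a, H' b a = A (H b a)) :
    M.boxSymbol s H' = A (M.boxSymbol s H) := by
  simp only [boxSymbol, hH, map_neg, map_sub, map_sum, hA, hN]

/-- `∇_{k,s,v}` as a linear function of `v`. -/
def nablaLin (s : ℂ) (f : Euc n → V) (x : Euc n) : Euc n →ₗ[ℝ] V where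
  toFun v := M.nabla s v f x
  map_add' v w := by
    simp only [nabla, nablaSymbol, map_add, M.N_add_left, M.N_add_right, Finset.sum_add_distrib]
    module
  map_smul' c v := by
    simp only [nabla, nablaSymbol, map_smul, M.N_smul_left, M.N_smul_right, ← Finset.smul_sum,
      real_smul_eq, RingHom.id_apply]
    module

variable {f g : Euc n → V} {x : Euc n}

theorem nabla_congr (s : ℂ) (v : Euc n) (h : f =ᶠ[nhds x] g) :
    M.nabla s v f x = M.nabla s v g x := by
  rw [nabla, nabla, h.fderiv_eq]

theorem box_congr (s : ℂ) (h : f =ᶠ[nhds x] g) : M.box s f x = M.box s g x := by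
  have : (fun b a => fderiv ℝ (fun y => fderiv ℝ f y a) x b) =
      fun b a => fderiv ℝ (fun y => fderiv ℝ g y a) x b := by
    funext b a
    have h2 : (fun y => fderiv ℝ f y a) =ᶠ[nhds x] fun y => fderiv ℝ g y a := by
      filter_upwards [h.eventuallyEq_nhds] with y hy
      rw [hy.fderiv_eq]
    rw [h2.fderiv_eq]
  rw [box, box, this]

theorem nabla_map (s : ℂ) (v : Euc n) (A : V →L[ℝ] V)
    (hA : ∀ (c : ℂ) η, A (c • η) = c • A η) (hN : ∀ u w η, A (M.N u w η) = M.N u w (A η))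
    (hf : ContDiff ℝ ((⊤ : ℕ∞) : WithTop ℕ∞) f) :
    M.nabla s v (fun y => A (f y)) x = A (M.nabla s v f x) := by
  refine M.nablaSymbol_map s v A hA hN fun a => ?_
  exact (map_fderiv_of_contDiff A hf x a).symm

theorem box_map (s : ℂ) (A : V →L[ℝ] V)
    (hA : ∀ (c : ℂ) η, A (c • η) = c • A η) (hN : ∀ u w η, A (M.N u w η) = M.N u w (A η))
    (hf : ContDiff ℝ ((⊤ : ℕ∞) : WithTop ℕ∞) f) :
    M.box s (fun y => A (f y)) x = A (M.box s f x) := by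
  refine M.boxSymbol_map s A hA hN fun b a => ?_
  have h : (fun y => fderiv ℝ (fun y => A (f y)) y a) = fun y => A (fderiv ℝ f y a) :=
    funext fun y => (map_fderiv_of_contDiff A hf y a).symm
  rw [h]
  exact (map_fderiv_of_contDiff A ((hf.fderiv_right (by norm_cast)).clm_apply contDiff_const)
    x b).symm

theorem nabla_add (s : ℂ) (v : Euc n) (hf : ContDiff ℝ ((⊤ : ℕ∞) : WithTop ℕ∞) f)
    (hg : ContDiff ℝ ((⊤ : ℕ∞) : WithTop ℕ∞) g) :
    M.nabla s v (fun y => f y + g y) x = M.nabla s v f x + M.nabla s v g x := by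
  rw [nabla, nabla, nabla, ← nablaSymbol_add]
  congr 1
  ext1 a
  exact congrArg (fun T => T a)
    (fderiv_fun_add (hf.differentiable (by simp) x) (hg.differentiable (by simp) x))

theorem box_add (s : ℂ) (hf : ContDiff ℝ ((⊤ : ℕ∞) : WithTop ℕ∞) f)
    (hg : ContDiff ℝ ((⊤ : ℕ∞) : WithTop ℕ∞) g) :
    M.box s (fun y => f y + g y) x = M.box s f x + M.box s g x := by
  rw [box, box, box, ← boxSymbol_add]
  congr 1
  funext b a
  have h : (fun y => fderiv ℝ (fun y => f y + g y) y a) =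
      fun y => fderiv ℝ f y a + fderiv ℝ g y a := funext fun y => congrArg (fun T => T a)
    (fderiv_fun_add (hf.differentiable (by simp) y) (hg.differentiable (by simp) y))
  have hd : ∀ {f : Euc n → V}, ContDiff ℝ ((⊤ : ℕ∞) : WithTop ℕ∞) f →
      DifferentiableAt ℝ (fun y => fderiv ℝ f y a) x := fun hf =>
    ((hf.fderiv_right (m := 1) (by norm_cast)).clm_apply contDiff_const).differentiable
      (by simp) x
  rw [h]
  exact congrArg (fun T => T b) (fderiv_fun_add (hd hf) (hd hg))

/-- Multiplication by a complex number. -/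
def csmul (c : ℂ) : V →L[ℝ] V := (c • ContinuousLinearMap.id ℝ V : V →L[ℝ] V)

theorem nabla_csmul (s : ℂ) (v : Euc n) (c : ℂ) (hf : ContDiff ℝ ((⊤ : ℕ∞) : WithTop ℕ∞) f) :
    M.nabla s v (fun y => c • f y) x = c • M.nabla s v f x :=
  M.nabla_map s v (csmul c) (fun _ _ => smul_comm _ _ _) (fun u w η => (M.N_csmul u w c η).symm) hf

theorem box_csmul (s : ℂ) (c : ℂ) (hf : ContDiff ℝ ((⊤ : ℕ∞) : WithTop ℕ∞) f) :
    M.box s (fun y => c • f y) x = c • M.box s f x :=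
  M.box_map s (csmul c) (fun _ _ => smul_comm _ _ _) (fun u w η => (M.N_csmul u w c η).symm) hf

end Linearity

section Slices

variable {G : Type*} [NormedAddCommGroup G] [NormedSpace ℝ G]

/-- The inner operator of a composition over the two variables must be smooth in the remaining
variable before the outer one is applied. -/
theorem contDiff_fderiv_slice {f : G → Euc n → V}
    (hf : ContDiff ℝ ((⊤ : ℕ∞) : WithTop ℕ∞) (Function.uncurry f)) (a : Euc n) :
    ContDiff ℝ ((⊤ : ℕ∞) : WithTop ℕ∞) (fun q : G × Euc n => fderiv ℝ (f q.1) q.2 a) := by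
  have h : ContDiff ℝ ((⊤ : ℕ∞) : WithTop ℕ∞)
      (Function.uncurry fun (q : G × Euc n) (y : Euc n) => f q.1 y) :=
    hf.comp ((contDiff_fst.comp contDiff_fst).prodMk contDiff_snd)
  exact (h.fderiv contDiff_snd (by norm_cast)).clm_apply contDiff_const

variable (M : FormModule n k V)

theorem contDiff_nabla_slice {f : G → Euc n → V}
    (hf : ContDiff ℝ ((⊤ : ℕ∞) : WithTop ℕ∞) (Function.uncurry f)) (s : ℂ) (v : Euc n) :
    ContDiff ℝ ((⊤ : ℕ∞) : WithTop ℕ∞) (fun q : G × Euc n => M.nabla s v (f q.1) q.2) := by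
  have h := contDiff_fderiv_slice hf
  exact (((h v).const_smul (alpha n k s)).sub ((ContDiff.sum fun m _ =>
    (M.N v (e m)).contDiff.comp (h (e m))).const_smul (2 * (s - n + 2 * k)))).add
    ((ContDiff.sum fun m _ =>
    (M.N (e m) v).contDiff.comp (h (e m))).const_smul (2 * (s + n - 2 * k))) |>.const_smul (2 - s)

theorem contDiff_box_slice {f : G → Euc n → V}
    (hf : ContDiff ℝ ((⊤ : ℕ∞) : WithTop ℕ∞) (Function.uncurry f)) (s : ℂ) :
    ContDiff ℝ ((⊤ : ℕ∞) : WithTop ℕ∞) (fun q : G × Euc n => M.box s (f q.1) q.2) := by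
  have h : ∀ b a, ContDiff ℝ ((⊤ : ℕ∞) : WithTop ℕ∞)
      (fun q : G × Euc n => fderiv ℝ (fun y => fderiv ℝ (f q.1) y a) q.2 b) := fun b a =>
    contDiff_fderiv_slice (f := fun g y => fderiv ℝ (f g) y a) (contDiff_fderiv_slice hf a) b
  exact ((ContDiff.sum fun i _ => h (e i) (e i)).const_smul (alpha n k s)).neg.sub
    ((ContDiff.sum fun i _ => ContDiff.sum fun j _ =>
      (M.N (e i) (e j)).contDiff.comp (h (e i) (e j))).const_smul (4 * ((n : ℂ) - 2 * k)))

end Slices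

end FormModule

/-- The relations between the values of a Möbius map with factor `Ω` and `θ = d log Ω` at two
points: `L`, `Ω`, `θ` belong to `x`, `L'`, `Ω'`, `θ'` to `y`, `z = x - y`, and `w` is the difference
of the images. -/
structure TwoPoint {n : ℕ} (L L' : Euc n →L[ℝ] Euc n) (Ω Ω' : ℝ) (θ θ' z w : Euc n) : Prop where
  fst : Ω • w = Ω' • L (z + (‖z‖ ^ 2 / 2) • θ)
  snd : Ω' • w = Ω • L' (z - (‖z‖ ^ 2 / 2) • θ')
  norm_sq : ‖w‖ ^ 2 = Ω * Ω' * ‖z‖ ^ 2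
  frame : ∀ a, Ω' • L a = Ω • L' (a + (inner ℝ θ a : ℝ) • z - (inner ℝ z a : ℝ) • θ'
    - (‖z‖ ^ 2 / 2 * inner ℝ θ a) • θ')
  factor_snd : Ω' = Ω * (1 - inner ℝ θ' z + ‖θ'‖ ^ 2 * ‖z‖ ^ 2 / 4)
  factor_fst : Ω = Ω' * (1 + inner ℝ θ z + ‖θ‖ ^ 2 * ‖z‖ ^ 2 / 4)
  grad_snd : θ' = (1 - inner ℝ θ' z + ‖θ'‖ ^ 2 * ‖z‖ ^ 2 / 4) • θ + (‖θ'‖ ^ 2 / 2) • z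
  grad_fst : θ = (1 + inner ℝ θ z + ‖θ‖ ^ 2 * ‖z‖ ^ 2 / 4) • θ' - (‖θ‖ ^ 2 / 2) • z
  norm_snd : (1 - inner ℝ θ' z + ‖θ'‖ ^ 2 * ‖z‖ ^ 2 / 4) * ‖θ‖ ^ 2 = ‖θ'‖ ^ 2
  norm_fst : (1 + inner ℝ θ z + ‖θ‖ ^ 2 * ‖z‖ ^ 2 / 4) * ‖θ'‖ ^ 2 = ‖θ‖ ^ 2

/-- The relation `frame` replaces Ω' L e_m in the second slot of the trace of B over the frame L e_m
by Ω L' applied to e_m and a correction in the directions z and θ'. The trace over the frame is Ω²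
times the standard one, and one factor Ω is cancelled. -/
theorem TwoPoint.sum_frame {n : ℕ} {L L' : Euc n →L[ℝ] Euc n} {Ω Ω' : ℝ} {θ θ' z w : Euc n}
    (h : TwoPoint L L' Ω Ω' θ θ' z w) (hΩ : 0 < Ω) (hL : ∀ u v, inner ℝ (L u) (L v) = Ω ^ 2 * inner ℝ u v)
    {W : Type} [AddCommGroup W] [Module ℝ W] (B : Euc n →ₗ[ℝ] Euc n →ₗ[ℝ] W) :
    (Ω * Ω') • ∑ m : Fin n, B (e m) (e m) = ∑ m : Fin n, B (L (e m)) (L' (e m))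
      + B (L θ) (L' z) - B (L z) (L' θ') - (‖z‖ ^ 2 / 2) • B (L θ) (L' θ') := by
  have h1 := ConformalForms.sum_frame (pow_ne_zero 2 hΩ.ne') hL B
  have h2 : Ω' • ∑ m : Fin n, B (L (e m)) (L (e m)) = Ω • (∑ m : Fin n, B (L (e m)) (L' (e m))
      + B (L θ) (L' z) - B (L z) (L' θ') - (‖z‖ ^ 2 / 2) • B (L θ) (L' θ')) := by
    have h3 : ∀ v w : Euc n, ∑ m : Fin n, v m • B (L (e m)) w = B (L v) w := fun v w =>
      map_eq_sum ((B.flip w).comp (L : Euc n →ₗ[ℝ] Euc n)) v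
    rw [← h3 θ, ← h3 z, ← h3 θ, Finset.smul_sum, Finset.smul_sum, ← Finset.sum_add_distrib,
      ← Finset.sum_sub_distrib, ← Finset.sum_sub_distrib, Finset.smul_sum]
    refine Finset.sum_congr rfl fun m _ => ?_
    rw [← map_smul, h.frame (e m), inner_e_right, inner_e_right]
    simp only [map_smul, map_add, map_sub]
    module
  rw [h1] at h2
  have h3 : Ω • ((Ω * Ω') • ∑ m : Fin n, B (e m) (e m)) = Ω • (∑ m : Fin n, B (L (e m)) (L' (e m))
      + B (L θ) (L' z) - B (L z) (L' θ') - (‖z‖ ^ 2 / 2) • B (L θ) (L' θ')) := by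
    rw [← h2]; module
  exact smul_right_injective W hΩ.ne' h3

/-! ### The operator E for two commuting form-module structures. -/

namespace FormModule

variable {n k l : ℕ} {V : Type} [NormedAddCommGroup V] [NormedSpace ℝ V] [NormedSpace ℂ V]
  [IsScalarTower ℝ ℂ V]

/-- The operators of two structures of form modules on the same space commute. -/
structure Commuting (M₁ : FormModule n k V) (M₂ : FormModule n l V) : Prop where
  N_pull : ∀ a b L η, M₁.N a b (M₂.pull L η) = M₂.pull L (M₁.N a b η)
  pull_N : ∀ a b L η, M₁.pull L (M₂.N a b η) = M₂.N a b (M₁.pull L η)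
  pull_pull : ∀ L L' η, M₁.pull L (M₂.pull L' η) = M₂.pull L' (M₁.pull L η)

/-- The operator `E_{s,t}` for forms with values in a space with two commuting structures. -/
def twoE (M₁ : FormModule n k V) (M₂ : FormModule n l V) (s t : ℂ) (ω : Euc n → Euc n → V)
    (x y : Euc n) : V :=
  -(‖x - y‖ ^ 2 • M₁.box s (fun x => M₂.box t (ω x) y) x)
    + (2 : ℂ) • ∑ j : Fin n, (x j - y j) • (M₁.nabla s (e j) (fun x => M₂.box t (ω x) y) x
        - M₁.box s (fun x => M₂.nabla t (e j) (ω x) y) x)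
    + (2 : ℂ) • ∑ j : Fin n, M₁.nabla s (e j) (fun x => M₂.nabla t (e j) (ω x) y) x
    + potential n l t • M₁.box s (fun x => ω x y) x
    + potential n k s • M₂.box t (ω x) y

section

variable (M₁ : FormModule n k V) (M₂ : FormModule n l V) (s t : ℂ) {ω ω' : Euc n → Euc n → V}
  {x y : Euc n}

/-- E is local. Equality near (x, y) gives, for all x' near x, equality of the slices near y, which
is what the nested derivatives see. -/
theorem twoE_congr
    (h : Function.uncurry ω =ᶠ[nhds (x, y)] Function.uncurry ω') :
    M₁.twoE M₂ s t ω x y = M₁.twoE M₂ s t ω' x y := by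
  rw [Filter.EventuallyEq, nhds_prod_eq] at h
  have h1 : ∀ᶠ x' in nhds x, ω x' =ᶠ[nhds y] ω' x' := h.curry
  have hb : (fun x => M₂.box t (ω x) y) =ᶠ[nhds x] fun x => M₂.box t (ω' x) y := by
    filter_upwards [h1] with x' hx' using M₂.box_congr t hx'
  have hn : ∀ v, (fun x => M₂.nabla t v (ω x) y) =ᶠ[nhds x] fun x => M₂.nabla t v (ω' x) y := by
    intro v
    filter_upwards [h1] with x' hx' using M₂.nabla_congr t v hx'
  have h0 : (fun x => ω x y) =ᶠ[nhds x] fun x => ω' x y := by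
    filter_upwards [h1] with x' hx' using hx'.eq_of_nhds
  simp only [twoE, M₁.box_congr s hb, M₁.nabla_congr s _ hb, M₁.box_congr s (hn _),
    M₁.nabla_congr s _ (hn _), M₁.box_congr s h0, M₂.box_congr t h1.self_of_nhds]

theorem sum_smul_nabla (v : Euc n) (f : Euc n → V) :
    ∑ j : Fin n, v j • M₁.nabla s (e j) f x = M₁.nabla s v f x :=
  map_eq_sum (M₁.nablaLin s f x) v

theorem nabla_lincomb (v : Euc n) (a c : ℂ) {f g h : Euc n → V}
    (hf : ContDiff ℝ ((⊤ : ℕ∞) : WithTop ℕ∞) f) (hg : ContDiff ℝ ((⊤ : ℕ∞) : WithTop ℕ∞) g)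
    (hh : ContDiff ℝ ((⊤ : ℕ∞) : WithTop ℕ∞) h) :
    M₁.nabla s v (fun y => a • f y - g y - c • h y) x =
      a • M₁.nabla s v f x - M₁.nabla s v g x - c • M₁.nabla s v h x := by
  have h1 : (fun y => a • f y - g y - c • h y) = fun y => (a • f y + (-1 : ℂ) • g y) + (-c) • h y := by
    funext y; module
  rw [h1, nabla_add M₁ s v ((hf.const_smul a).add (hg.const_smul (-1 : ℂ))) (hh.const_smul (-c)),
    nabla_add M₁ s v (hf.const_smul a) (hg.const_smul (-1 : ℂ)), M₁.nabla_csmul s v a hf,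
    M₁.nabla_csmul s v _ hg, M₁.nabla_csmul s v _ hh]
  module

theorem box_lincomb (a c : ℂ) {f g h : Euc n → V}
    (hf : ContDiff ℝ ((⊤ : ℕ∞) : WithTop ℕ∞) f) (hg : ContDiff ℝ ((⊤ : ℕ∞) : WithTop ℕ∞) g)
    (hh : ContDiff ℝ ((⊤ : ℕ∞) : WithTop ℕ∞) h) :
    M₁.box s (fun y => a • f y - g y - c • h y) x =
      a • M₁.box s f x - M₁.box s g x - c • M₁.box s h x := by
  have h1 : (fun y => a • f y - g y - c • h y) = fun y => (a • f y + (-1 : ℂ) • g y) + (-c) • h y := by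
    funext y; module
  rw [h1, box_add M₁ s ((hf.const_smul a).add (hg.const_smul (-1 : ℂ))) (hh.const_smul (-c)),
    box_add M₁ s (hf.const_smul a) (hg.const_smul (-1 : ℂ)), M₁.box_csmul s a hf,
    M₁.box_csmul s _ hg, M₁.box_csmul s _ hh]
  module

theorem contDiff_nabla_param (hω : ContDiff ℝ ((⊤ : ℕ∞) : WithTop ℕ∞) (Function.uncurry ω))
    (v : Euc n) : ContDiff ℝ ((⊤ : ℕ∞) : WithTop ℕ∞) (fun ξ => M₂.nabla t v (ω ξ) y) :=
  (M₂.contDiff_nabla_slice hω t v).comp (contDiff_id.prodMk contDiff_const)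

theorem contDiff_box_param (hω : ContDiff ℝ ((⊤ : ℕ∞) : WithTop ℕ∞) (Function.uncurry ω)) :
    ContDiff ℝ ((⊤ : ℕ∞) : WithTop ℕ∞) (fun ξ => M₂.box t (ω ξ) y) :=
  (M₂.contDiff_box_slice hω t).comp (contDiff_id.prodMk contDiff_const)

/-- `∇_{k,s,v} ⊗ ∇_{ℓ,t,w}` as a bilinear function of `(v, w)`. -/
def nablaBilin (hω : ContDiff ℝ ((⊤ : ℕ∞) : WithTop ℕ∞) (Function.uncurry ω)) (x y : Euc n) :
    Euc n →ₗ[ℝ] Euc n →ₗ[ℝ] V :=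
  LinearMap.mk₂ ℝ (fun v w => M₁.nabla s v (fun ξ => M₂.nabla t w (ω ξ) y) x)
    (fun v v' w => (M₁.nablaLin s (fun ξ => M₂.nabla t w (ω ξ) y) x).map_add v v')
    (fun c v w => (M₁.nablaLin s (fun ξ => M₂.nabla t w (ω ξ) y) x).map_smul c v)
    (fun v w w' => by
      rw [← M₁.nabla_add s v (M₂.contDiff_nabla_param t hω w) (M₂.contDiff_nabla_param t hω w')]
      congr 1
      funext ξ
      exact (M₂.nablaLin t (ω ξ) y).map_add w w')
    (fun c v w => by
      rw [real_smul_eq (V := V), ← M₁.nabla_csmul s v _ (M₂.contDiff_nabla_param t hω w)]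
      congr 1
      funext ξ
      rw [← real_smul_eq (V := V)]
      exact (M₂.nablaLin t (ω ξ) y).map_smul c w)

/-- `□_{k,s} ⊗ ∇_{ℓ,t,v}` as a linear function of `v`. -/
def boxNablaLin (hω : ContDiff ℝ ((⊤ : ℕ∞) : WithTop ℕ∞) (Function.uncurry ω)) (x y : Euc n) :
    Euc n →ₗ[ℝ] V where
  toFun w := M₁.box s (fun ξ => M₂.nabla t w (ω ξ) y) x
  map_add' w w' := by
    rw [← M₁.box_add s (M₂.contDiff_nabla_param t hω w) (M₂.contDiff_nabla_param t hω w')]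
    congr 1
    funext ξ
    exact (M₂.nablaLin t (ω ξ) y).map_add w w'
  map_smul' c w := by
    rw [RingHom.id_apply, real_smul_eq (V := V),
      ← M₁.box_csmul s _ (M₂.contDiff_nabla_param t hω w)]
    congr 1
    funext ξ
    rw [← real_smul_eq (V := V)]
    exact (M₂.nablaLin t (ω ξ) y).map_smul c w

end

end FormModule

/-! ### Covariance of E under a Möbius map acting diagonally. -/

namespace FormModule

variable {n k l : ℕ} {V : Type} [NormedAddCommGroup V] [NormedSpace ℝ V] [NormedSpace ℂ V]
  [IsScalarTower ℝ ℂ V] {U : Set (Euc n)} {Φ : Euc n → Euc n} {Ω : Euc n → ℝ} {θ : Euc n → Euc n}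

/-- The weighted pull-back by the differential `L` as a linear map on the values. -/
def wpull (M : FormModule n k V) (lam : ℂ) (c : ℝ) (L : Euc n →L[ℝ] Euc n) : V →L[ℝ] V :=
  (csmul ((c : ℂ) ^ lam)).comp (M.pull L)

theorem wpull_apply (M : FormModule n k V) (lam : ℂ) (c : ℝ) (L : Euc n →L[ℝ] Euc n) (η : V) :
    M.wpull lam c L η = (c : ℂ) ^ lam • M.pull L η := rfl

theorem wpull_csmul (M : FormModule n k V) (lam : ℂ) (c : ℝ) (L : Euc n →L[ℝ] Euc n) (a : ℂ)
    (η : V) : M.wpull lam c L (a • η) = a • M.wpull lam c L η := by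
  rw [wpull_apply, wpull_apply, M.pull_csmul, smul_comm]

variable {M₁ : FormModule n k V} {M₂ : FormModule n l V} {ω : Euc n → Euc n → V} (lam mu : ℂ)
  {x y : Euc n}

theorem wpull_wpull (hM : Commuting M₁ M₂) (c c' : ℝ) (L L' : Euc n →L[ℝ] Euc n) (η : V) :
    M₁.wpull lam c L (M₂.wpull mu c' L' η) = M₂.wpull mu c' L' (M₁.wpull lam c L η) := by
  rw [wpull_apply, wpull_apply, wpull_apply, wpull_apply, M₁.pull_csmul, M₂.pull_csmul, smul_comm,
    hM.pull_pull]

theorem N_wpull (hM : Commuting M₁ M₂) (c : ℝ) (L : Euc n →L[ℝ] Euc n) (a b : Euc n) (η : V) :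
    M₂.wpull mu c L (M₁.N a b η) = M₁.N a b (M₂.wpull mu c L η) := by
  rw [wpull_apply, wpull_apply, M₁.N_csmul, hM.N_pull]

theorem wpull_N (hM : Commuting M₁ M₂) (c : ℝ) (L : Euc n →L[ℝ] Euc n) (a b : Euc n) (η : V) :
    M₁.wpull lam c L (M₂.N a b η) = M₂.N a b (M₁.wpull lam c L η) := by
  rw [wpull_apply, wpull_apply, M₂.N_csmul, hM.pull_N]

/-- The simultaneous weighted pull-back in both variables. -/
def twoPull (M₁ : FormModule n k V) (M₂ : FormModule n l V) (lam mu : ℂ) (Φ : Euc n → Euc n)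
    (Ω : Euc n → ℝ) (ω : Euc n → Euc n → V) (x y : Euc n) : V :=
  M₁.wpull lam (Ω x) (fderiv ℝ Φ x) (M₂.wpull mu (Ω y) (fderiv ℝ Φ y) (ω (Φ x) (Φ y)))

/-- Since the two structures commute, for fixed x this is a one-variable weighted pull-back in y. -/
theorem twoPull_eq_pullForm_snd (hM : Commuting M₁ M₂) (x : Euc n) :
    M₁.twoPull M₂ lam mu Φ Ω ω x =
      M₂.pullForm mu Φ Ω fun ζ => M₁.wpull lam (Ω x) (fderiv ℝ Φ x) (ω (Φ x) ζ) :=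
  funext fun y => wpull_wpull lam mu hM _ _ _ _ _

/-- Stated as an equality of functions of x whose right-hand side is again a weighted pull-back, so
that the one-variable laws in x can follow. -/
theorem nabla_twoPull_snd (hM : Commuting M₁ M₂) (h : IsMobius U Φ Ω θ)
    (hω : ContDiff ℝ ((⊤ : ℕ∞) : WithTop ℕ∞) (Function.uncurry ω)) (hy : y ∈ U) (v : Euc n) :
    (fun x => M₂.nabla (n - 2 * (mu + l)) v (M₁.twoPull M₂ lam mu Φ Ω ω x) y) =
      M₁.pullForm lam Φ Ω fun ξ => M₂.wpull mu (Ω y) (fderiv ℝ Φ y)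
          (M₂.nabla (n - 2 * (mu + l)) (fderiv ℝ Φ y v) (ω ξ) (Φ y))
        + (potential n l (n - 2 * (mu + l)) / 2 * (inner ℝ (θ y) v : ℝ)) •
          M₂.wpull mu (Ω y) (fderiv ℝ Φ y) (ω ξ (Φ y)) := by
  funext x
  have hω1 : ContDiff ℝ ((⊤ : ℕ∞) : WithTop ℕ∞) (ω (Φ x)) :=
    hω.comp (contDiff_prodMk_right (Φ x))
  rw [twoPull_eq_pullForm_snd lam mu hM, M₂.nabla_pullForm h mu hy
    (f := fun ζ => M₁.wpull lam (Ω x) (fderiv ℝ Φ x) (ω (Φ x) ζ)) ((((M₁.wpull lam (Ω x) (fderiv ℝ Φ x)).contDiff.comp hω1).differentiable (by simp)) _),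
    M₂.nabla_map _ _ (M₁.wpull lam (Ω x) (fderiv ℝ Φ x)) (M₁.wpull_csmul _ _ _)
    (fun u w η => wpull_N lam hM _ _ _ _ _) hω1]
  change M₂.wpull mu (Ω y) (fderiv ℝ Φ y) _ + _ • M₂.wpull mu (Ω y) (fderiv ℝ Φ y) _ =
    M₁.wpull lam (Ω x) (fderiv ℝ Φ x) _
  rw [map_add, wpull_csmul, wpull_wpull lam mu hM, wpull_wpull lam mu hM]

theorem box_twoPull_snd (hM : Commuting M₁ M₂) (h : IsMobius U Φ Ω θ)
    (hω : ContDiff ℝ ((⊤ : ℕ∞) : WithTop ℕ∞) (Function.uncurry ω)) (hy : y ∈ U) :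
    (fun x => M₂.box (n - 2 * (mu + l)) (M₁.twoPull M₂ lam mu Φ Ω ω x) y) =
      M₁.pullForm lam Φ Ω fun ξ => ((Ω y ^ 2 : ℝ) : ℂ) • M₂.wpull mu (Ω y) (fderiv ℝ Φ y)
          (M₂.box (n - 2 * (mu + l)) (ω ξ) (Φ y))
        - M₂.wpull mu (Ω y) (fderiv ℝ Φ y)
          (M₂.nabla (n - 2 * (mu + l)) (fderiv ℝ Φ y (θ y)) (ω ξ) (Φ y))
        - (potential n l (n - 2 * (mu + l)) / 4 * (‖θ y‖ ^ 2 : ℝ)) •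
          M₂.wpull mu (Ω y) (fderiv ℝ Φ y) (ω ξ (Φ y)) := by
  funext x
  have hω1 : ContDiff ℝ ((⊤ : ℕ∞) : WithTop ℕ∞) (ω (Φ x)) :=
    hω.comp (contDiff_prodMk_right (Φ x))
  rw [twoPull_eq_pullForm_snd lam mu hM, M₂.box_pullForm h mu hy
    (f := fun ζ => M₁.wpull lam (Ω x) (fderiv ℝ Φ x) (ω (Φ x) ζ)) ((M₁.wpull lam (Ω x) (fderiv ℝ Φ x)).contDiff.comp hω1),
    M₂.nabla_map _ _ (M₁.wpull lam (Ω x) (fderiv ℝ Φ x)) (M₁.wpull_csmul _ _ _)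
    (fun u w η => wpull_N lam hM _ _ _ _ _) hω1,
    M₂.box_map _ (M₁.wpull lam (Ω x) (fderiv ℝ Φ x)) (M₁.wpull_csmul _ _ _)
    (fun u w η => wpull_N lam hM _ _ _ _ _) hω1]
  change _ • M₂.wpull mu (Ω y) (fderiv ℝ Φ y) _ - M₂.wpull mu (Ω y) (fderiv ℝ Φ y) _
    - _ • M₂.wpull mu (Ω y) (fderiv ℝ Φ y) _ = M₁.wpull lam (Ω x) (fderiv ℝ Φ x) _
  rw [map_sub, map_sub, wpull_csmul, wpull_csmul, wpull_wpull lam mu hM, wpull_wpull lam mu hM,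
    wpull_wpull lam mu hM]

theorem nabla_lincomb₂ (M : FormModule n k V) (s : ℂ) (v : Euc n) (c : ℂ) {f h : Euc n → V}
    (hf : ContDiff ℝ ((⊤ : ℕ∞) : WithTop ℕ∞) f) (hh : ContDiff ℝ ((⊤ : ℕ∞) : WithTop ℕ∞) h) :
    M.nabla s v (fun y => f y + c • h y) x = M.nabla s v f x + c • M.nabla s v h x := by
  rw [M.nabla_add s v hf (hh.const_smul c), M.nabla_csmul s v c hh]

theorem box_lincomb₂ (M : FormModule n k V) (s : ℂ) (c : ℂ) {f h : Euc n → V}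
    (hf : ContDiff ℝ ((⊤ : ℕ∞) : WithTop ℕ∞) f) (hh : ContDiff ℝ ((⊤ : ℕ∞) : WithTop ℕ∞) h) :
    M.box s (fun y => f y + c • h y) x = M.box s f x + c • M.box s h x := by
  rw [M.box_add s hf (hh.const_smul c), M.box_csmul s c hh]

/-- Both one-variable laws turn every summand of E into pulled-back values at (Φ x, Φ y). The
two-point relations align the directions and scalars at x and y, and `source_identity` does the
rest. -/
theorem twoE_twoPull (hM : Commuting M₁ M₂) (h : IsMobius U Φ Ω θ) (hx : x ∈ U) (hy : y ∈ U)
    (hω : ContDiff ℝ ((⊤ : ℕ∞) : WithTop ℕ∞) (Function.uncurry ω))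
    (hxy : TwoPoint (fderiv ℝ Φ x) (fderiv ℝ Φ y) (Ω x) (Ω y) (θ x) (θ y) (x - y) (Φ x - Φ y)) :
    M₁.twoE M₂ (n - 2 * (lam + k)) (n - 2 * (mu + l)) (M₁.twoPull M₂ lam mu Φ Ω ω) x y =
      ((Ω x : ℂ) * Ω y) • M₁.wpull lam (Ω x) (fderiv ℝ Φ x) (M₂.wpull mu (Ω y) (fderiv ℝ Φ y)
        (M₁.twoE M₂ (n - 2 * (lam + k)) (n - 2 * (mu + l)) ω (Φ x) (Φ y))) := by
  obtain ⟨s, hs⟩ : ∃ s : ℂ, s = n - 2 * (lam + k) := ⟨_, rfl⟩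
  obtain ⟨t, ht⟩ : ∃ t : ℂ, t = n - 2 * (mu + l) := ⟨_, rfl⟩
  obtain ⟨A, hA⟩ : ∃ A : V →L[ℝ] V, A = M₁.wpull lam (Ω x) (fderiv ℝ Φ x) := ⟨_, rfl⟩
  obtain ⟨B, hB⟩ : ∃ B : V →L[ℝ] V, B = M₂.wpull mu (Ω y) (fderiv ℝ Φ y) := ⟨_, rfl⟩
  have hBc : ∀ (c : ℂ) η, B (c • η) = c • B η := hB ▸ M₂.wpull_csmul _ _ _
  have hAc : ∀ (c : ℂ) η, A (c • η) = c • A η := hA ▸ M₁.wpull_csmul _ _ _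
  have hBN : ∀ u w η, B (M₁.N u w η) = M₁.N u w (B η) := fun u w η => hB ▸ N_wpull mu hM _ _ _ _ _
  have c0 : ContDiff ℝ ((⊤ : ℕ∞) : WithTop ℕ∞) fun ξ => ω ξ (Φ y) :=
    hω.comp (contDiff_prodMk_left (Φ y))
  have cn := fun v => M₂.contDiff_nabla_param (y := Φ y) t hω v
  have cb := M₂.contDiff_box_param (y := Φ y) t hω
  have d0 : ContDiff ℝ ((⊤ : ℕ∞) : WithTop ℕ∞) fun ξ => B (ω ξ (Φ y)) := B.contDiff.comp c0
  have dn : ∀ v, ContDiff ℝ ((⊤ : ℕ∞) : WithTop ℕ∞) fun ξ => B (M₂.nabla t v (ω ξ) (Φ y)) :=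
    fun v => B.contDiff.comp (cn v)
  have db : ContDiff ℝ ((⊤ : ℕ∞) : WithTop ℕ∞) fun ξ => B (M₂.box t (ω ξ) (Φ y)) :=
    B.contDiff.comp cb
  have hnab : ∀ (v : Euc n) {f : Euc n → V}, ContDiff ℝ ((⊤ : ℕ∞) : WithTop ℕ∞) f →
      M₁.nabla s v (M₁.pullForm lam Φ Ω f) x = A (M₁.nabla s (fderiv ℝ Φ x v) f (Φ x))
        + (potential n k s / 2 * (inner ℝ (θ x) v : ℝ)) • A (f (Φ x)) := by
    intro v f hf
    rw [hs, hA]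
    exact M₁.nabla_pullForm h lam hx (hf.differentiable (by simp) _) v
  have hbox : ∀ {f : Euc n → V}, ContDiff ℝ ((⊤ : ℕ∞) : WithTop ℕ∞) f →
      M₁.box s (M₁.pullForm lam Φ Ω f) x = ((Ω x ^ 2 : ℝ) : ℂ) • A (M₁.box s f (Φ x))
        - A (M₁.nabla s (fderiv ℝ Φ x (θ x)) f (Φ x))
        - (potential n k s / 4 * (‖θ x‖ ^ 2 : ℝ)) • A (f (Φ x)) := by
    intro f hf
    rw [hs, hA]
    exact M₁.box_pullForm h lam hx hf
  have hn2 := nabla_twoPull_snd lam mu hM h hω hy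
  have hb2 := box_twoPull_snd lam mu hM h hω hy
  rw [← ht, ← hB] at hn2 hb2
  have h0 : (fun x => M₁.twoPull M₂ lam mu Φ Ω ω x y) =
      M₁.pullForm lam Φ Ω fun ξ => B (ω ξ (Φ y)) := by rw [hB]; rfl
  let AB : V →ₗ[ℝ] V := (A.comp B : V →L[ℝ] V)
  obtain ⟨L, hL⟩ : ∃ L : Euc n →ₗ[ℝ] Euc n, L = (fderiv ℝ Φ x : Euc n →ₗ[ℝ] Euc n) := ⟨_, rfl⟩
  obtain ⟨L', hL'⟩ : ∃ L : Euc n →ₗ[ℝ] Euc n, L = (fderiv ℝ Φ y : Euc n →ₗ[ℝ] Euc n) := ⟨_, rfl⟩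
  -- The first letter records the operator in x and the second the one in y: b for □, n for ∇, and 1
  -- or o for the identity. All values are taken at (Φ x, Φ y) and pulled back.
  obtain ⟨bb, hbb⟩ : ∃ v, v = A (B (M₁.box s (fun ξ => M₂.box t (ω ξ) (Φ y)) (Φ x))) := ⟨_, rfl⟩
  obtain ⟨b1, hb1⟩ : ∃ v, v = A (B (M₁.box s (fun ξ => ω ξ (Φ y)) (Φ x))) := ⟨_, rfl⟩
  obtain ⟨ob, hob⟩ : ∃ v, v = A (B (M₂.box t (ω (Φ x)) (Φ y))) := ⟨_, rfl⟩
  obtain ⟨oo, hoo⟩ : ∃ v, v = A (B (ω (Φ x) (Φ y))) := ⟨_, rfl⟩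
  -- Values involving ∇ are kept as linear functions of the direction, so that the vector relations
  -- of `TwoPoint` can be transported to them.
  obtain ⟨nb, hnb⟩ : ∃ T : Euc n →ₗ[ℝ] V, ∀ v, T v =
      A (B (M₁.nabla s v (fun ξ => M₂.box t (ω ξ) (Φ y)) (Φ x))) :=
    ⟨AB.comp (M₁.nablaLin s _ _), fun _ => rfl⟩
  obtain ⟨bn, hbn⟩ : ∃ T : Euc n →ₗ[ℝ] V, ∀ v, T v =
      A (B (M₁.box s (fun ξ => M₂.nabla t v (ω ξ) (Φ y)) (Φ x))) :=
    ⟨AB.comp (M₁.boxNablaLin M₂ s t hω _ _), fun _ => rfl⟩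
  obtain ⟨n1, hn1⟩ : ∃ T : Euc n →ₗ[ℝ] V, ∀ v, T v =
      A (B (M₁.nabla s v (fun ξ => ω ξ (Φ y)) (Φ x))) :=
    ⟨AB.comp (M₁.nablaLin s _ _), fun _ => rfl⟩
  obtain ⟨on, hon⟩ : ∃ T : Euc n →ₗ[ℝ] V, ∀ v, T v =
      A (B (M₂.nabla t v (ω (Φ x)) (Φ y))) :=
    ⟨AB.comp (M₂.nablaLin t _ _), fun _ => rfl⟩
  obtain ⟨nn, hnn⟩ : ∃ T : Euc n →ₗ[ℝ] Euc n →ₗ[ℝ] V, ∀ v w, T v w =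
      A (B (M₁.nabla s v (fun ξ => M₂.nabla t w (ω ξ) (Φ y)) (Φ x))) :=
    ⟨(M₁.nablaBilin M₂ s t hω _ _).compr₂ AB, fun _ _ => rfl⟩
  have hBnab : ∀ (v : Euc n) {f : Euc n → V}, ContDiff ℝ ((⊤ : ℕ∞) : WithTop ℕ∞) f →
      M₁.nabla s v (fun ξ => B (f ξ)) (Φ x) = B (M₁.nabla s v f (Φ x)) :=
    fun v f hf => M₁.nabla_map s v B hBc hBN hf
  have hBbox : ∀ {f : Euc n → V}, ContDiff ℝ ((⊤ : ℕ∞) : WithTop ℕ∞) f →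
      M₁.box s (fun ξ => B (f ξ)) (Φ x) = B (M₁.box s f (Φ x)) :=
    fun hf => M₁.box_map s B hBc hBN hf
  have hLa : ∀ v, fderiv ℝ Φ x v = L v := fun v => by rw [hL]; rfl
  have hLa' : ∀ v, fderiv ℝ Φ y v = L' v := fun v => by rw [hL']; rfl
  have Enn : ∀ v w, M₁.nabla s w (fun x => M₂.nabla t v (M₁.twoPull M₂ lam mu Φ Ω ω x) y) x =
      nn (L w) (L' v) + (potential n l t / 2 * (inner ℝ (θ y) v : ℝ)) • n1 (L w)
        + (potential n k s / 2 * (inner ℝ (θ x) w : ℝ)) •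
          (on (L' v) + (potential n l t / 2 * (inner ℝ (θ y) v : ℝ)) • oo) := by
    intro v w
    rw [hn2 v, hnab w ((dn _).add (d0.const_smul _)), M₁.nabla_lincomb₂ s _ _ (dn _) d0,
      hBnab _ (cn _), hBnab _ c0, map_add, map_add, hAc, hAc, hLa, hLa', ← hnn, ← hn1, ← hon, ← hoo]
  have Ebn : ∀ v, M₁.box s (fun x => M₂.nabla t v (M₁.twoPull M₂ lam mu Φ Ω ω x) y) x =
      ((Ω x ^ 2 : ℝ) : ℂ) • (bn (L' v) + (potential n l t / 2 * (inner ℝ (θ y) v : ℝ)) • b1)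
        - (nn (L (θ x)) (L' v) + (potential n l t / 2 * (inner ℝ (θ y) v : ℝ)) • n1 (L (θ x)))
        - (potential n k s / 4 * (‖θ x‖ ^ 2 : ℝ)) •
          (on (L' v) + (potential n l t / 2 * (inner ℝ (θ y) v : ℝ)) • oo) := by
    intro v
    rw [hn2 v, hbox ((dn _).add (d0.const_smul _)), M₁.nabla_lincomb₂ s _ _ (dn _) d0,
      M₁.box_lincomb₂ s _ (dn _) d0, hBbox (cn _), hBbox c0,
      hBnab _ (cn _), hBnab _ c0, map_add, map_add, map_add, hAc, hAc, hAc, hLa, hLa', ← hnn,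
      ← hn1, ← hon, ← hoo, ← hbn, ← hb1]
  have Enb : ∀ w, M₁.nabla s w (fun x => M₂.box t (M₁.twoPull M₂ lam mu Φ Ω ω x) y) x =
      ((Ω y ^ 2 : ℝ) : ℂ) • nb (L w) - nn (L w) (L' (θ y))
        - (potential n l t / 4 * (‖θ y‖ ^ 2 : ℝ)) • n1 (L w)
        + (potential n k s / 2 * (inner ℝ (θ x) w : ℝ)) •
          (((Ω y ^ 2 : ℝ) : ℂ) • ob - on (L' (θ y))
            - (potential n l t / 4 * (‖θ y‖ ^ 2 : ℝ)) • oo) := by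
    intro w
    rw [hb2, hnab w (((db.const_smul _).sub (dn _)).sub (d0.const_smul _)),
      M₁.nabla_lincomb s _ _ _ db (dn _) d0, hBnab _ cb,
      hBnab _ (cn _), hBnab _ c0]
    simp only [map_sub, hAc, hLa, hLa', ← hnn, ← hn1, ← hon, ← hoo, ← hnb, ← hob]
  have Ebb : M₁.box s (fun x => M₂.box t (M₁.twoPull M₂ lam mu Φ Ω ω x) y) x =
      ((Ω x ^ 2 : ℝ) : ℂ) • (((Ω y ^ 2 : ℝ) : ℂ) • bb - bn (L' (θ y))
          - (potential n l t / 4 * (‖θ y‖ ^ 2 : ℝ)) • b1)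
        - (((Ω y ^ 2 : ℝ) : ℂ) • nb (L (θ x)) - nn (L (θ x)) (L' (θ y))
          - (potential n l t / 4 * (‖θ y‖ ^ 2 : ℝ)) • n1 (L (θ x)))
        - (potential n k s / 4 * (‖θ x‖ ^ 2 : ℝ)) • (((Ω y ^ 2 : ℝ) : ℂ) • ob - on (L' (θ y))
          - (potential n l t / 4 * (‖θ y‖ ^ 2 : ℝ)) • oo) := by
    rw [hb2, hbox (((db.const_smul _).sub (dn _)).sub (d0.const_smul _)),
      M₁.nabla_lincomb s _ _ _ db (dn _) d0, M₁.box_lincomb s _ _ db (dn _) d0, hBnab _ cb,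
      hBnab _ (cn _), hBnab _ c0, hBbox cb, hBbox (cn _), hBbox c0]
    simp only [map_sub, hAc, hLa, hLa', ← hnn, ← hn1, ← hon, ← hoo, ← hnb, ← hob, ← hbb, ← hbn,
      ← hb1]
  have Eb1 : M₁.box s (fun x => M₁.twoPull M₂ lam mu Φ Ω ω x y) x =
      ((Ω x ^ 2 : ℝ) : ℂ) • b1 - n1 (L (θ x))
        - (potential n k s / 4 * (‖θ x‖ ^ 2 : ℝ)) • oo := by
    rw [h0, hbox d0, hBbox c0, hBnab _ c0, hLa, ← hb1, ← hn1, ← hoo]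
  have Eob : M₂.box t (M₁.twoPull M₂ lam mu Φ Ω ω x) y =
      ((Ω y ^ 2 : ℝ) : ℂ) • ob - on (L' (θ y))
        - (potential n l t / 4 * (‖θ y‖ ^ 2 : ℝ)) • oo := by
    rw [congrFun hb2 x]
    change M₁.wpull lam (Ω x) (fderiv ℝ Φ x) _ = _
    rw [← hA]
    simp only [map_sub, hAc, hLa', ← hon, ← hoo, ← hob]
  have hsum : ∀ (T : Euc n →ₗ[ℝ] V) (v : Euc n), ∑ j : Fin n, ((v j : ℝ) : ℂ) • T (e j) = T v :=
    fun T v => by simpa only [real_smul_eq] using map_eq_sum T v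
  have hsub : ∀ (a b : Euc n) j, a j - b j = (a - b) j := fun a b j => rfl
  have hrhs : A (B (M₁.twoE M₂ s t ω (Φ x) (Φ y))) =
      -(((‖Φ x - Φ y‖ ^ 2 : ℝ) : ℂ) • bb) + (2 : ℂ) • (nb (Φ x - Φ y) - bn (Φ x - Φ y))
        + (2 : ℂ) • ∑ j : Fin n, nn (e j) (e j) + potential n l t • b1 + potential n k s • ob := by
    rw [twoE]
    simp only [map_add, map_neg, map_sub, map_sum, hAc, hBc, real_smul_eq (V := V), smul_sub,
      Finset.sum_sub_distrib, ← hbb, ← hb1, ← hob, ← hbn, ← hnb, ← hnn, hsub, hsum]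
  have hlin : ∀ g : Euc n → V, (∀ u v, g (u + v) = g u + g v) →
      (∀ (c : ℝ) v, g (c • v) = c • g v) → ∀ v, ∑ j : Fin n, v j • g (e j) = g v :=
    fun g h1 h2 v => map_eq_sum { toFun := g, map_add' := h1, map_smul' := h2 } v
  have hz : ∑ j : Fin n, (x j - y j) •
      (M₁.nabla s (e j) (fun x => M₂.box t (M₁.twoPull M₂ lam mu Φ Ω ω x) y) x
        - M₁.box s (fun x => M₂.nabla t (e j) (M₁.twoPull M₂ lam mu Φ Ω ω x) y) x) =
      (((Ω y ^ 2 : ℝ) : ℂ) • nb (L (x - y)) - nn (L (x - y)) (L' (θ y))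
        - (potential n l t / 4 * (‖θ y‖ ^ 2 : ℝ)) • n1 (L (x - y))
        + (potential n k s / 2 * (inner ℝ (θ x) (x - y) : ℝ)) •
          (((Ω y ^ 2 : ℝ) : ℂ) • ob - on (L' (θ y))
            - (potential n l t / 4 * (‖θ y‖ ^ 2 : ℝ)) • oo))
      - (((Ω x ^ 2 : ℝ) : ℂ) • (bn (L' (x - y))
            + (potential n l t / 2 * (inner ℝ (θ y) (x - y) : ℝ)) • b1)
        - (nn (L (θ x)) (L' (x - y))
            + (potential n l t / 2 * (inner ℝ (θ y) (x - y) : ℝ)) • n1 (L (θ x)))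
        - (potential n k s / 4 * (‖θ x‖ ^ 2 : ℝ)) •
          (on (L' (x - y)) + (potential n l t / 2 * (inner ℝ (θ y) (x - y) : ℝ)) • oo)) := by
    have h1 : ∀ v : Euc n, ∑ j : Fin n, v j •
        M₁.box s (fun x => M₂.nabla t (e j) (M₁.twoPull M₂ lam mu Φ Ω ω x) y) x =
        M₁.box s (fun x => M₂.nabla t v (M₁.twoPull M₂ lam mu Φ Ω ω x) y) x := by
      refine hlin (fun v => M₁.box s (fun x => M₂.nabla t v
        (M₁.twoPull M₂ lam mu Φ Ω ω x) y) x) (fun u v => ?_) fun c v => ?_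
      · simp only [Ebn, map_add, inner_add_right, LinearMap.add_apply, Complex.ofReal_add]
        module
      · simp only [Ebn, map_smul, inner_smul_right, real_smul_eq (V := V), LinearMap.smul_apply,
          Complex.ofReal_mul]
        module
    rw [← Ebn, ← Enb, ← h1, ← sum_smul_nabla, ← Finset.sum_sub_distrib]
    exact Finset.sum_congr rfl fun j _ => smul_sub _ _ _
  have hd : ∑ j : Fin n, M₁.nabla s (e j)
        (fun x => M₂.nabla t (e j) (M₁.twoPull M₂ lam mu Φ Ω ω x) y) x =
      ∑ j : Fin n, nn (L (e j)) (L' (e j)) + (potential n l t / 2) • n1 (L (θ y))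
        + (potential n k s / 2) • on (L' (θ x))
        + (potential n k s * potential n l t / 4 * (inner ℝ (θ x) (θ y) : ℝ)) • oo := by
    have h1 : ∀ (c : ℂ) (u : Euc n) (T : Euc n →ₗ[ℝ] V),
        ∑ j : Fin n, (c * ((u j : ℝ) : ℂ)) • T (e j) = c • T u := by
      intro c u T
      rw [← hsum T u, Finset.smul_sum]
      exact Finset.sum_congr rfl fun j _ => mul_smul _ _ _
    have h2 : (inner ℝ (θ x) (θ y) : ℝ) = ∑ j : Fin n, θ x j * θ y j := inner_eq_sum _ _
    have h3 : (potential n k s * potential n l t / 4 * (inner ℝ (θ x) (θ y) : ℝ)) • oo =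
        ∑ j : Fin n, (potential n k s / 2 * (θ x j : ℝ)) •
          (potential n l t / 2 * (θ y j : ℝ)) • oo := by
      rw [h2, Complex.ofReal_sum, Finset.mul_sum, Finset.sum_smul]
      refine Finset.sum_congr rfl fun j _ => ?_
      rw [smul_smul, Complex.ofReal_mul]
      congr 1
      ring
    have h4 := h1 (potential n l t / 2) (θ y) (n1.comp L)
    have h5 := h1 (potential n k s / 2) (θ x) (on.comp L')
    simp only [LinearMap.comp_apply] at h4 h5
    simp only [Enn, inner_e_right, smul_add, Finset.sum_add_distrib]
    rw [h3, h4, h5]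
    abel
  have hL2 : ∀ u v, inner ℝ (fderiv ℝ Φ x u) (fderiv ℝ Φ x v) = Ω x ^ 2 * inner ℝ u v :=
    h.inner_fderiv x hx
  have hframe := hxy.sum_frame (h.pos x hx) hL2 nn
  rw [← hs, ← ht, ← hA, ← hB, hrhs, twoE, Ebb, hz, hd, Eb1, Eob, real_smul_eq (V := V)]
  simp only [Complex.ofReal_pow]
  have hP := hxy.factor_snd
  have hQ := hxy.factor_fst
  -- P and Q are the quotients Ω'/Ω and Ω/Ω' of the factors at y and x; r, a, b are |x−y|², |θ(x)|²,
  -- |θ(y)|².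
  refine source_identity (r := (‖x - y‖ : ℂ) ^ 2) (a := (‖θ x‖ : ℂ) ^ 2)
    (b := (‖θ y‖ : ℂ) ^ 2)
    (P := (1 - inner ℝ (θ y) (x - y) + ‖θ y‖ ^ 2 * ‖x - y‖ ^ 2 / 4 : ℝ))
    (Q := (1 + inner ℝ (θ x) (x - y) + ‖θ x‖ ^ 2 * ‖x - y‖ ^ 2 / 4 : ℝ)) ?_ ?_ ?_ ?_ ?_ ?_ ?_ ?_
    ?_ ?_ ?_ ?_ ?_
  · rw [← real_smul_eq, ← map_smul, hxy.fst, hLa]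
    simp only [map_smul, map_add, real_smul_eq (V := V)]
    push_cast
    module
  · rw [← real_smul_eq, ← map_smul, hxy.snd, hLa']
    simp only [map_smul, map_sub, real_smul_eq (V := V)]
    push_cast
    module
  · rw [← Complex.ofReal_pow, hxy.norm_sq]
    push_cast
    ring
  · rw [← Complex.ofReal_mul, ← real_smul_eq, hframe]
    simp only [hLa, hLa', real_smul_eq (V := V)]
    push_cast
    module
  · push_cast
    ring
  · push_cast
    ring
  · rw [← Complex.ofReal_mul, ← hP]
  · rw [← Complex.ofReal_mul, ← hQ]
  · conv_lhs => rw [hxy.grad_snd]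
    simp only [map_smul, map_add, real_smul_eq (V := V)]
    push_cast
    module
  · conv_lhs => rw [hxy.grad_fst]
    simp only [map_smul, map_sub, real_smul_eq (V := V)]
    push_cast
    module
  · rw [← Complex.ofReal_pow, ← Complex.ofReal_pow, ← Complex.ofReal_mul, hxy.norm_snd]
  · rw [← Complex.ofReal_pow, ← Complex.ofReal_pow, ← Complex.ofReal_mul, hxy.norm_fst]
  -- The inner product of `grad_snd` with θ(x).
  · have h1 : (inner ℝ (θ x) (θ y) : ℝ) =
        (1 - inner ℝ (θ y) (x - y) + ‖θ y‖ ^ 2 * ‖x - y‖ ^ 2 / 4) * ‖θ x‖ ^ 2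
          + ‖θ y‖ ^ 2 / 2 * inner ℝ (θ x) (x - y) := by
      conv_lhs => rw [hxy.grad_snd]
      rw [inner_add_right, inner_smul_right, inner_smul_right, real_inner_self_eq_norm_sq]
    rw [h1]
    push_cast
    ring

end FormModule

/-- The quadratic form `2 (α β - |a|²)` on `ℝ × ℝⁿ × ℝ`, polarized. -/
def coneForm {n : ℕ} (X Y : ℝ × Euc n × ℝ) : ℝ :=
  X.1 * Y.2.2 + X.2.2 * Y.1 - 2 * inner ℝ X.2.1 Y.2.1

/-- A linear isometry of the form `coneForm`, given by its components. -/
structure ConeMap (n : ℕ) where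
  w : ℝ × Euc n × ℝ →L[ℝ] ℝ
  u : ℝ × Euc n × ℝ →L[ℝ] Euc n
  h : ℝ × Euc n × ℝ →L[ℝ] ℝ
  isometry : ∀ X Y, w X * h Y + h X * w Y - 2 * inner ℝ (u X) (u Y) = coneForm X Y

/-- The point `(1, x, |x|²)` of the light cone. -/
def conePt {n : ℕ} (x : Euc n) : ℝ × Euc n × ℝ := (1, x, ‖x‖ ^ 2)

/-- The tangent vector `(0, a, 2 ⟨x, a⟩)` of the light cone. -/
def coneTan {n : ℕ} (x a : Euc n) : ℝ × Euc n × ℝ := (0, a, 2 * inner ℝ x a)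

/-- The point at infinity of the light cone. -/
def coneInf (n : ℕ) : ℝ × Euc n × ℝ := (0, 0, 1)

/-! ### The light-cone model: one-point and two-point relations for rational conformal maps. -/

namespace ConeMap

variable {n : ℕ} (T : ConeMap n) {x y : Euc n}

/-- The denominator of the rational action. -/
def den (x : Euc n) : ℝ := T.w (conePt x)

/-- The rational action on `ℝⁿ`. -/
def toFun (x : Euc n) : Euc n := (T.den x)⁻¹ • T.u (conePt x)

/-- The gradient of the denominator. -/
def gradDen (x : Euc n) : Euc n :=
  WithLp.toLp 2 fun i => T.w (coneTan x (e i))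

/-- The gradient of the logarithm of the conformal factor. -/
def logGrad (x : Euc n) : Euc n := -(T.den x)⁻¹ • T.gradDen x

/-- The projection of `T X` along `T (conePt x)`. -/
def proj (x : Euc n) (X : ℝ × Euc n × ℝ) : Euc n := T.u X - T.w X • T.toFun x

theorem hasFDerivAt_conePt (x : Euc n) : HasFDerivAt conePt
    ((0 : Euc n →L[ℝ] ℝ).prod ((ContinuousLinearMap.id ℝ (Euc n)).prod
      ((2 : ℝ) • innerSL ℝ x))) x :=
  (hasFDerivAt_const _ _).prodMk ((hasFDerivAt_id x).prodMk (by
    rw [ofNat_smul_eq_nsmul]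
    exact (hasStrictFDerivAt_norm_sq x).hasFDerivAt))

theorem hasFDerivAt_comp_conePt {W : Type*} [NormedAddCommGroup W] [NormedSpace ℝ W]
    (S : ℝ × Euc n × ℝ →L[ℝ] W) (x : Euc n) :
    ∃ S' : Euc n →L[ℝ] W, HasFDerivAt (fun x => S (conePt x)) S' x ∧ ∀ a, S' a = S (coneTan x a) :=
  ⟨_, S.hasFDerivAt.comp x (hasFDerivAt_conePt x), fun a => by simp [coneTan]⟩

theorem contDiff_conePt : ContDiff ℝ ((⊤ : ℕ∞) : WithTop ℕ∞) (conePt (n := n)) :=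
  contDiff_const.prodMk (contDiff_id.prodMk (contDiff_norm_sq ℝ))

theorem coneTan_add (x a b : Euc n) : coneTan x (a + b) = coneTan x a + coneTan x b := by
  simp [coneTan, inner_add_right, mul_add]

theorem coneTan_smul (x : Euc n) (c : ℝ) (a : Euc n) : coneTan x (c • a) = c • coneTan x a := by
  simp [coneTan, inner_smul_right, mul_left_comm]

theorem inner_gradDen (x a : Euc n) : inner ℝ (T.gradDen x) a = T.w (coneTan x a) := by
  have h := map_eq_sum (n := n) (W := ℝ)
    { toFun := fun a => T.w (coneTan x a)
      map_add' := fun a b => by rw [coneTan_add, map_add]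
      map_smul' := fun c a => by rw [coneTan_smul, map_smul, RingHom.id_apply] } a
  simp only [LinearMap.coe_mk, AddHom.coe_mk] at h
  rw [← h, inner_eq_sum]
  exact Finset.sum_congr rfl fun i _ => by simp [gradDen, mul_comm]

theorem coneTan_sub_coneTan (x y a : Euc n) :
    coneTan x a = coneTan y a + (2 * inner ℝ (x - y) a) • coneInf n := by
  simp [coneTan, coneInf, inner_sub_left]
  ring

/-- The second-order Taylor expansion, exact because the embedding is quadratic. Together with
`coneTan_sub_coneTan` it makes the relations between distant points as explicit as infinitesimal
ones. -/
theorem conePt_eq (x y : Euc n) :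
    conePt x = conePt y + coneTan y (x - y) + (‖x - y‖ ^ 2) • coneInf n := by
  have h : ‖x‖ ^ 2 = ‖y‖ ^ 2 + 2 * inner ℝ y (x - y) + ‖x - y‖ ^ 2 := by
    rw [← norm_add_sq_real, add_sub_cancel]
  simp [conePt, coneTan, coneInf, h]

theorem w_coneTan (hx : T.den x ≠ 0) (a : Euc n) :
    T.w (coneTan x a) = -(T.den x * inner ℝ (T.logGrad x) a) := by
  rw [logGrad, inner_smul_left, inner_gradDen]
  simp
  field_simp

theorem u_conePt (hx : T.den x ≠ 0) : T.u (conePt x) = T.den x • T.toFun x := by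
  rw [toFun, smul_inv_smul₀ hx]

/-- The image of a light-like vector is light-like, so its components satisfy w h = |u|². -/
theorem h_conePt (hx : T.den x ≠ 0) : T.h (conePt x) = T.den x * ‖T.toFun x‖ ^ 2 := by
  have h := T.isometry (conePt x) (conePt x)
  rw [T.u_conePt hx, real_inner_self_eq_norm_sq, norm_smul, mul_pow, Real.norm_eq_abs, sq_abs,
    ← den] at h
  have h2 : coneForm (conePt x) (conePt x) = 0 := by
    simp [coneForm, conePt]
    ring
  rw [h2] at h
  have h3 : T.den x * (T.h (conePt x) - T.den x * ‖T.toFun x‖ ^ 2) = 0 := by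
    linear_combination h / 2
  linear_combination (mul_eq_zero.1 h3).resolve_left hx

/-- Subtracting from X the multiple of `conePt x` that makes the w-component of the image vanish
leaves u-component `proj x X`. On vectors with w = 0 the form is −2⟨u,u⟩, and T is an isometry. -/
theorem den_mul_inner_proj (hx : T.den x ≠ 0) (X Y : ℝ × Euc n × ℝ) :
    2 * T.den x * inner ℝ (T.proj x X) (T.proj x Y) =
      T.w X * coneForm Y (conePt x) + T.w Y * coneForm X (conePt x)
        - T.den x * coneForm X Y := by
  rw [← T.isometry Y (conePt x), ← T.isometry X (conePt x), ← T.isometry X Y, T.h_conePt hx,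
    T.u_conePt hx, ← den, proj, proj]
  simp only [inner_sub_left, inner_sub_right, inner_smul_left, inner_smul_right,
    real_inner_self_eq_norm_sq, real_inner_comm]
  simp only [conj_trivial]
  rw [real_inner_comm (T.u Y) (T.toFun x)]
  ring

/-- The quotient rule for u/w. -/
theorem fderiv_toFun (hx : T.den x ≠ 0) :
    HasFDerivAt T.toFun (fderiv ℝ T.toFun x) x ∧
      ∀ a, T.den x • fderiv ℝ T.toFun x a = T.proj x (coneTan x a) := by
  obtain ⟨w', hw, hw'⟩ := hasFDerivAt_comp_conePt T.w x
  obtain ⟨u', hu, hu'⟩ := hasFDerivAt_comp_conePt T.u x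
  have h : HasFDerivAt T.toFun _ x := ((hasDerivAt_inv hx).comp_hasFDerivAt x hw).smul hu
  refine ⟨h.differentiableAt.hasFDerivAt, fun a => ?_⟩
  rw [h.fderiv, proj, ← hu', ← hw', toFun]
  simp only [add_apply, smul_apply, ContinuousLinearMap.smulRight_apply, Function.comp_apply,
    smul_eq_mul]
  change T.den x • ((T.den x)⁻¹ • u' a + (-(T.den x ^ 2)⁻¹ * w' a) • T.u (conePt x)) = _
  match_scalars <;> field_simp

/-- Tangent vectors are orthogonal to `conePt x`, so in `den_mul_inner_proj` only the form of the
two tangent vectors survives. -/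
theorem inner_fderiv_toFun (hx : T.den x ≠ 0) (a b : Euc n) :
    inner ℝ (fderiv ℝ T.toFun x a) (fderiv ℝ T.toFun x b) = (T.den x)⁻¹ ^ 2 * inner ℝ a b := by
  have h := T.den_mul_inner_proj hx (coneTan x a) (coneTan x b)
  rw [← (T.fderiv_toFun hx).2, ← (T.fderiv_toFun hx).2, inner_smul_left, inner_smul_right] at h
  have h1 : ∀ a, coneForm (coneTan x a) (conePt x) = 0 := fun a => by
    simp [coneForm, coneTan, conePt, real_inner_comm]
  have h2 : coneForm (coneTan x a) (coneTan x b) = -(2 * inner ℝ a b) := by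
    simp [coneForm, coneTan]
  rw [h1, h1, h2] at h
  simp only [conj_trivial] at h
  field_simp
  have h3 : T.den x * (T.den x ^ 2 * inner ℝ (fderiv ℝ T.toFun x a) (fderiv ℝ T.toFun x b)
      - inner ℝ a b) = 0 := by linear_combination h / 2
  linear_combination (mul_eq_zero.1 h3).resolve_left hx

theorem coneForm_coneInf_conePt (x : Euc n) : coneForm (coneInf n) (conePt x) = 1 := by
  simp [coneForm, coneInf, conePt]

theorem coneForm_coneTan_conePt (x a : Euc n) : coneForm (coneTan x a) (conePt x) = 0 := by
  simp [coneForm, coneTan, conePt, real_inner_comm]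

/-- DΦ is surjective, so this vector is DΦ v for some v; v is found by pairing with every DΦ a
through `den_mul_inner_proj`. -/
theorem proj_coneInf (hx : T.den x ≠ 0) :
    T.proj x (coneInf n) = -(T.den x / 2) • fderiv ℝ T.toFun x (T.logGrad x) := by
  obtain ⟨v, hv⟩ := conformal_surjective (pow_ne_zero 2 (inv_ne_zero hx))
    (T.inner_fderiv_toFun hx) (T.proj x (coneInf n))
  have h1 : ∀ a, inner ℝ v a = inner ℝ (-(T.den x / 2) • T.logGrad x) a := by
    intro a
    have h := T.den_mul_inner_proj hx (coneInf n) (coneTan x a)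
    rw [← (T.fderiv_toFun hx).2, ← hv, inner_smul_right, T.inner_fderiv_toFun hx,
      coneForm_coneInf_conePt, coneForm_coneTan_conePt, T.w_coneTan hx] at h
    have h2 : coneForm (coneInf n) (coneTan x a) = 0 := by simp [coneForm, coneInf, coneTan]
    rw [h2] at h
    rw [inner_smul_left]
    simp only [conj_trivial]
    field_simp at h ⊢
    linarith
  rw [← hv, ← map_smul, ext_inner_right ℝ h1]

/-- The point at infinity is isotropic and pairs to 1 with every `conePt x`, so the norm of its
projection is known. -/
theorem den_mul_norm_logGrad_sq (hx : T.den x ≠ 0) :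
    T.den x * ‖T.logGrad x‖ ^ 2 = 4 * T.w (coneInf n) := by
  have h := T.den_mul_inner_proj hx (coneInf n) (coneInf n)
  have h2 : coneForm (coneInf n) (coneInf n) = 0 := by simp [coneForm, coneInf]
  rw [coneForm_coneInf_conePt, h2, T.proj_coneInf hx, inner_smul_left, inner_smul_right,
    T.inner_fderiv_toFun hx, real_inner_self_eq_norm_sq] at h
  simp only [conj_trivial] at h
  field_simp at h
  linarith

theorem den_eq (hy : T.den y ≠ 0) (x : Euc n) : T.den x =
    T.den y * (1 - inner ℝ (T.logGrad y) (x - y) + ‖T.logGrad y‖ ^ 2 * ‖x - y‖ ^ 2 / 4) := by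
  rw [den, conePt_eq x y, map_add, map_add, map_smul, ← den, T.w_coneTan hy,
    smul_eq_mul]
  linear_combination -(‖x - y‖ ^ 2 / 4) * T.den_mul_norm_logGrad_sq hy

theorem gradDen_sub (x y : Euc n) :
    T.gradDen x = T.gradDen y + (2 * T.w (coneInf n)) • (x - y) := by
  refine ext_inner_right ℝ fun a => ?_
  rw [inner_add_left, inner_smul_left, inner_gradDen, inner_gradDen, coneTan_sub_coneTan x y,
    map_add, map_smul, smul_eq_mul, conj_trivial]
  ring

/-- The expansion of `conePt y` around x is projected along the image of `conePt x`: the constant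
term dies, the linear term gives DΦ, and the term at infinity gives DΦθ. -/
theorem toFun_sub (hx : T.den x ≠ 0) (hy : T.den y ≠ 0) :
    T.den y • (T.toFun x - T.toFun y) =
      T.den x • fderiv ℝ T.toFun x ((x - y) + (‖x - y‖ ^ 2 / 2) • T.logGrad x) := by
  have h1 : T.proj x (conePt y) = T.den y • (T.toFun y - T.toFun x) := by
    rw [proj, T.u_conePt hy, ← den, smul_sub]
  have h2 : T.proj x (conePt y) = T.proj x (coneTan x (y - x))
      + ‖y - x‖ ^ 2 • T.proj x (coneInf n) := by
    have h3 : T.proj x (conePt x) = 0 := by rw [proj, T.u_conePt hx, ← den, sub_self]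
    rw [← zero_add (T.proj x (coneTan x (y - x))), ← h3]
    conv_lhs => rw [conePt_eq y x]
    simp only [proj, map_add, map_smul]
    simp only [smul_eq_mul]
    module
  rw [h1, T.proj_coneInf hx, ← (T.fderiv_toFun hx).2, ← neg_sub x y, norm_neg] at h2
  simp only [map_add, map_smul, map_neg] at h2 ⊢
  linear_combination (norm := module) -h2

/-- The form of two points of the cone is the squared distance of their base points, and T preserves
it. -/
theorem norm_toFun_sub_sq (hx : T.den x ≠ 0) (hy : T.den y ≠ 0) :
    ‖T.toFun x - T.toFun y‖ ^ 2 = (T.den x)⁻¹ * (T.den y)⁻¹ * ‖x - y‖ ^ 2 := by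
  have h := T.isometry (conePt x) (conePt y)
  have h2 : coneForm (conePt x) (conePt y) = ‖x - y‖ ^ 2 := by
    simp [coneForm, conePt, norm_sub_sq_real]
    ring
  rw [T.u_conePt hx, T.u_conePt hy, T.h_conePt hx, T.h_conePt hy, ← den, ← den, h2,
    inner_smul_left, inner_smul_right, conj_trivial] at h
  rw [norm_sub_sq_real]
  field_simp
  linarith

theorem den_eq' (hx : T.den x ≠ 0) (y : Euc n) : T.den y =
    T.den x * (1 + inner ℝ (T.logGrad x) (x - y) + ‖T.logGrad x‖ ^ 2 * ‖x - y‖ ^ 2 / 4) := by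
  rw [T.den_eq hx y, ← neg_sub x y, norm_neg, inner_neg_right, sub_neg_eq_add]

theorem den_smul_logGrad (hx : T.den x ≠ 0) (hy : T.den y ≠ 0) :
    T.den y • T.logGrad y = T.den x • T.logGrad x + (2 * T.w (coneInf n)) • (x - y) := by
  have h : ∀ {x}, T.den x ≠ 0 → T.den x • T.logGrad x = -T.gradDen x := fun hx => by
    rw [logGrad, neg_smul, smul_neg, smul_inv_smul₀ hx]
  rw [h hx, h hy, T.gradDen_sub x y]
  module

/-- The same tangent vector at x is projected at x and at y. The projections differ by a multiple of
Φx − Φy, and tangent vectors with the same a at x and y differ by a multiple of the point at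
infinity. -/
theorem den_smul_fderiv (hx : T.den x ≠ 0) (hy : T.den y ≠ 0) (a : Euc n) :
    T.den x • fderiv ℝ T.toFun x a = T.den y • fderiv ℝ T.toFun y
      (a + (inner ℝ (T.logGrad x) a : ℝ) • (x - y) - (inner ℝ (x - y) a : ℝ) • T.logGrad y
        - (‖x - y‖ ^ 2 / 2 * inner ℝ (T.logGrad x) a) • T.logGrad y) := by
  have h1 : T.proj x (coneTan x a) = T.proj y (coneTan x a)
      - T.w (coneTan x a) • (T.toFun x - T.toFun y) := by
    rw [proj, proj]
    module
  have h2 : T.proj y (coneTan x a) = T.proj y (coneTan y a)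
      + (2 * inner ℝ (x - y) a) • T.proj y (coneInf n) := by
    rw [coneTan_sub_coneTan x y a]
    simp only [proj, map_add, map_smul, smul_eq_mul]
    module
  have h3 := T.toFun_sub hy hx
  rw [← neg_sub x y, norm_neg, ← neg_sub (T.toFun x), smul_neg] at h3
  rw [(T.fderiv_toFun hx).2, h1, h2, T.proj_coneInf hy, ← (T.fderiv_toFun hy).2, T.w_coneTan hx]
  simp only [map_add, map_smul, map_neg, map_sub] at h3 ⊢
  linear_combination (norm := module) -(inner ℝ (T.logGrad x) a : ℝ) • h3

theorem twoPoint (hx : T.den x ≠ 0) (hy : T.den y ≠ 0) :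
    TwoPoint (fderiv ℝ T.toFun x) (fderiv ℝ T.toFun y) (T.den x)⁻¹ (T.den y)⁻¹ (T.logGrad x)
      (T.logGrad y) (x - y) (T.toFun x - T.toFun y) := by
  have hP := T.den_eq hy x
  have hQ := T.den_eq' hx y
  have hg := T.den_smul_logGrad hx hy
  have hnx := T.den_mul_norm_logGrad_sq hx
  have hny := T.den_mul_norm_logGrad_sq hy
  refine ⟨?_, ?_, T.norm_toFun_sub_sq hx hy, fun a => ?_, ?_, ?_, ?_, ?_, ?_, ?_⟩
  · rw [inv_smul_eq_iff₀ hx, smul_comm, eq_inv_smul_iff₀ hy, T.toFun_sub hx hy]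
  · have h := T.toFun_sub hy hx
    rw [← neg_sub x y, norm_neg, ← neg_sub (T.toFun x), smul_neg] at h
    rw [inv_smul_eq_iff₀ hy, smul_comm, eq_inv_smul_iff₀ hx, ← neg_inj, h, ← smul_neg, ← map_neg]
    congr 2
    module
  · rw [inv_smul_eq_iff₀ hy, smul_comm, eq_inv_smul_iff₀ hx, T.den_smul_fderiv hx hy a]
  · field_simp
    linear_combination 4 * hP
  · field_simp
    linear_combination 4 * hQ
  · refine smul_right_injective _ hy ?_
    change T.den y • _ = T.den y • _
    rw [hg, smul_add, smul_smul, ← hP, smul_smul]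
    congr 2
    linarith
  · refine smul_right_injective _ hx ?_
    change T.den x • _ = T.den x • _
    rw [smul_sub, smul_smul, ← hQ, hg, smul_smul]
    have h : T.den x * (‖T.logGrad x‖ ^ 2 / 2) = 2 * T.w (coneInf n) := by linarith
    rw [h, add_sub_cancel_right]
  · refine mul_left_cancel₀ hy ?_
    rw [← mul_assoc, ← hP, hnx, hny]
  · refine mul_left_cancel₀ hx ?_
    rw [← mul_assoc, ← hQ, hnx, hny]

theorem isOpen_den_pos : IsOpen {x | 0 < T.den x} :=
  isOpen_lt continuous_const (T.w.continuous.comp contDiff_conePt.continuous)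

theorem contDiff_den : ContDiff ℝ ((⊤ : ℕ∞) : WithTop ℕ∞) T.den :=
  T.w.contDiff.comp contDiff_conePt

theorem contDiffAt_toFun (hx : T.den x ≠ 0) :
    ContDiffAt ℝ ((⊤ : ℕ∞) : WithTop ℕ∞) T.toFun x :=
  (T.contDiff_den.contDiffAt.inv hx).smul (T.u.contDiff.comp contDiff_conePt).contDiffAt

theorem hasFDerivAt_den (hx : T.den x ≠ 0) :
    HasFDerivAt T.den (-(T.den x • innerSL ℝ (T.logGrad x))) x := by
  obtain ⟨w', hw, hw'⟩ := hasFDerivAt_comp_conePt T.w x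
  refine hw.congr_fderiv (ContinuousLinearMap.ext fun a => ?_)
  rw [hw', T.w_coneTan hx]
  simp

/-- Differentiating den · DΦ a = `proj` of the tangent vector: that vector moves only along the
point at infinity, whose projection is a multiple of DΦθ. This gives the term with ⟨a,b⟩. -/
theorem fderiv_fderiv_toFun (hx : T.den x ≠ 0) (b a : Euc n) :
    fderiv ℝ (fderiv ℝ T.toFun) x b a =
      (inner ℝ (T.logGrad x) b : ℝ) • fderiv ℝ T.toFun x a
        + (inner ℝ (T.logGrad x) a : ℝ) • fderiv ℝ T.toFun x b
        - (inner ℝ a b : ℝ) • fderiv ℝ T.toFun x (T.logGrad x) := by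
  have hd : DifferentiableAt ℝ (fderiv ℝ T.toFun) x :=
    ((T.contDiffAt_toFun hx).fderiv_right (m := 1) (by norm_cast)).differentiableAt (by simp)
  have h1 : HasFDerivAt (fun y => T.den y • fderiv ℝ T.toFun y a) _ x :=
    (T.hasFDerivAt_den hx).smul (hd.hasFDerivAt.clm_apply (hasFDerivAt_const a x))
  have h2 : (fun y => T.den y • fderiv ℝ T.toFun y a) =ᶠ[nhds x] fun y => T.proj y (coneTan y a) := by
    filter_upwards [T.contDiff_den.continuous.continuousAt.eventually_ne hx] with y hy
    exact (T.fderiv_toFun hy).2 a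
  have h3 : HasFDerivAt (fun y => coneTan y a) ((0 : Euc n →L[ℝ] ℝ).prod
      ((0 : Euc n →L[ℝ] Euc n).prod ((2 : ℝ) • innerSL ℝ a))) x := by
    refine (hasFDerivAt_const _ _).prodMk ((hasFDerivAt_const _ _).prodMk ?_)
    have h : (fun y : Euc n => 2 * inner ℝ y a) = fun y => ((2 : ℝ) • innerSL ℝ a) y := by
      funext y
      simp [real_inner_comm]
    rw [h]
    exact ContinuousLinearMap.hasFDerivAt _
  have h4 : HasFDerivAt (fun y => T.proj y (coneTan y a)) _ x :=
    (T.u.hasFDerivAt.comp x h3).sub ((T.w.hasFDerivAt.comp x h3).smul (T.fderiv_toFun hx).1)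
  have h5 := congrArg (fun S => S b) (h1.unique (h4.congr_of_eventuallyEq h2))
  have h6 := T.proj_coneInf hx
  have h7 : ((0 : ℝ), (0 : Euc n), 2 * inner ℝ a b) = (2 * inner ℝ a b : ℝ) • coneInf n := by
    simp [coneInf]
  simp at h5
  rw [h7, map_smul, map_smul, T.w_coneTan hx] at h5
  rw [proj] at h6
  refine smul_right_injective _ hx ?_
  change T.den x • _ = T.den x • _
  simp only [smul_eq_mul] at h5
  linear_combination (norm := module) h5 + (2 * inner ℝ a b : ℝ) • h6

theorem isMobius : IsMobius {x | 0 < T.den x} T.toFun (fun x => (T.den x)⁻¹) T.logGrad where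
  isOpen := T.isOpen_den_pos
  pos x hx := inv_pos.2 hx
  contDiffOn x hx := (T.contDiffAt_toFun (ne_of_gt hx)).contDiffWithinAt
  inner_fderiv x hx := T.inner_fderiv_toFun (ne_of_gt hx)
  fderiv_fderiv x hx := T.fderiv_fderiv_toFun (ne_of_gt hx)
  hasFDerivAt_factor x hx := by
    have hx' : T.den x ≠ 0 := ne_of_gt hx
    have h : HasFDerivAt (fun x => (T.den x)⁻¹) _ x :=
      (hasDerivAt_inv hx').comp_hasFDerivAt x (T.hasFDerivAt_den hx')
    refine h.congr_fderiv (ContinuousLinearMap.ext fun a => ?_)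
    simp
    rw [sq, mul_inv, mul_assoc, inv_mul_cancel_left₀ hx']
  hasFDerivAt_grad x hx := by
    have hx' : T.den x ≠ 0 := ne_of_gt hx
    have h0 : T.gradDen = fun y => (T.gradDen x + (2 * T.w (coneInf n)) • (y - x)) :=
      funext fun y => T.gradDen_sub y x
    have h1 : HasFDerivAt T.gradDen ((2 * T.w (coneInf n)) • ContinuousLinearMap.id ℝ (Euc n)) x := by
      rw [h0]
      exact (((hasFDerivAt_id x).sub_const x).const_smul (2 * T.w (coneInf n))).const_add
        (T.gradDen x)
    have h : HasFDerivAt T.logGrad _ x :=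
      ((hasDerivAt_inv hx').comp_hasFDerivAt x (T.hasFDerivAt_den hx')).neg.smul h1
    -- The denominator has constant Hessian; this relation turns it into the term −½|θ|² of Dθ.
    have h2 := T.den_mul_norm_logGrad_sq hx'
    refine h.congr_fderiv (ContinuousLinearMap.ext fun a => ?_)
    simp
    have h3 : T.gradDen x = -(T.den x • T.logGrad x) := by
      rw [logGrad, neg_smul, smul_neg, neg_neg, smul_inv_smul₀ hx']
    have h4 : T.w (coneInf n) = T.den x * ‖T.logGrad x‖ ^ 2 / 4 := by linarith
    rw [h3, h4]
    match_scalars <;> field_simp <;> ring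

end ConeMap

/-! ### From Lorentz isometries to maps of the light cone. -/

variable {n : ℕ}

/-- The linear coordinates on `ℝ^{1,n+1}` adapted to the light cone. -/
def emb (X : ℝ × Euc n × ℝ) : Unit ⊕ SphIdx n → ℝ :=
  Sum.elim (fun _ => X.1 + X.2.2) (Sum.elim (fun i => 2 * X.2.1 i) fun _ => X.1 - X.2.2)

theorem emb_add (X Y : ℝ × Euc n × ℝ) : emb (X + Y) = emb X + emb Y := by
  ext (i | i | i) <;> simp [emb] <;> ring

theorem emb_smul (c : ℝ) (X : ℝ × Euc n × ℝ) : emb (c • X) = c • emb X := by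
  ext (i | i | i) <;> simp [emb] <;> ring

/-- The polar form of `x₀² - (x₁² + ⋯ + x_{n+1}²)`. -/
theorem dotProduct_lorentz (W W' : Unit ⊕ SphIdx n → ℝ) :
    W ⬝ᵥ (lorentz n *ᵥ W') = W (Sum.inl ()) * W' (Sum.inl ())
      - (∑ i : Fin n, W (Sum.inr (Sum.inl i)) * W' (Sum.inr (Sum.inl i))
        + W (Sum.inr (Sum.inr ())) * W' (Sum.inr (Sum.inr ()))) := by
  simp [lorentz, LieAlgebra.Orthogonal.indefiniteDiagonal, Matrix.mulVec_diagonal, dotProduct]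
  ring

theorem dotProduct_lorentz_of_mem {h : LMat n} (hh : h ∈ isometries n)
    (W W' : Unit ⊕ SphIdx n → ℝ) :
    (h *ᵥ W) ⬝ᵥ (lorentz n *ᵥ (h *ᵥ W')) = W ⬝ᵥ (lorentz n *ᵥ W') := by
  have hh' : hᵀ * lorentz n * h = lorentz n := hh
  conv_rhs => rw [← hh']
  rw [← Matrix.mulVec_mulVec, ← Matrix.mulVec_mulVec, Matrix.dotProduct_mulVec,
    Matrix.dotProduct_mulVec W, Matrix.vecMul_transpose, ← Matrix.dotProduct_mulVec]

theorem dotProduct_lorentz_emb (X Y : ℝ × Euc n × ℝ) :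
    emb X ⬝ᵥ (lorentz n *ᵥ emb Y) = 2 * coneForm X Y := by
  rw [dotProduct_lorentz, coneForm, inner_eq_sum, Finset.mul_sum]
  have h : ∑ i : Fin n, emb X (Sum.inr (Sum.inl i)) * emb Y (Sum.inr (Sum.inl i)) =
      2 * ∑ i : Fin n, 2 * (X.2.1 i * Y.2.1 i) := by
    rw [Finset.mul_sum]
    exact Finset.sum_congr rfl fun i _ => by simp [emb]; ring
  rw [h]
  simp [emb]
  ring

/-- The action of an isometry of the Lorentzian form on the light cone. -/
def coneMap (h : LMat n) (hh : h ∈ isometries n) : ConeMap n where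
  -- The components w, u, h are those of emb⁻¹(h · emb X), hence the sum, the difference and the
  -- halves.
  w := LinearMap.toContinuousLinearMap
    { toFun := fun X => ((h *ᵥ emb X) (Sum.inl ()) + (h *ᵥ emb X) (Sum.inr (Sum.inr ()))) / 2
      map_add' := fun X Y => by
        simp only [emb_add, Matrix.mulVec_add, Pi.add_apply]; ring
      map_smul' := fun a X => by
        simp only [emb_smul, Matrix.mulVec_smul, Pi.smul_apply, smul_eq_mul, RingHom.id_apply]
        ring }
  u := LinearMap.toContinuousLinearMap
    { toFun := fun X => WithLp.toLp 2 fun i => (h *ᵥ emb X) (Sum.inr (Sum.inl i)) / 2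
      map_add' := fun X Y => by
        ext i; simp [emb_add, Matrix.mulVec_add]; ring
      map_smul' := fun a X => by
        ext i; simp [emb_smul, Matrix.mulVec_smul]; ring }
  h := LinearMap.toContinuousLinearMap
    { toFun := fun X => ((h *ᵥ emb X) (Sum.inl ()) - (h *ᵥ emb X) (Sum.inr (Sum.inr ()))) / 2
      map_add' := fun X Y => by
        simp only [emb_add, Matrix.mulVec_add, Pi.add_apply]; ring
      map_smul' := fun a X => by
        simp only [emb_smul, Matrix.mulVec_smul, Pi.smul_apply, smul_eq_mul, RingHom.id_apply]
        ring }
  isometry X Y := by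
    have h1 := dotProduct_lorentz_of_mem hh (emb X) (emb Y)
    rw [dotProduct_lorentz_emb, dotProduct_lorentz] at h1
    have h2 : ∑ i : Fin n, (h *ᵥ emb X) (Sum.inr (Sum.inl i)) * (h *ᵥ emb Y) (Sum.inr (Sum.inl i))
        = 4 * ∑ i : Fin n, (h *ᵥ emb X) (Sum.inr (Sum.inl i)) / 2 *
          ((h *ᵥ emb Y) (Sum.inr (Sum.inl i)) / 2) := by
      rw [Finset.mul_sum]
      exact Finset.sum_congr rfl fun i _ => by ring
    rw [h2] at h1
    rw [inner_eq_sum]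
    simp only [LinearMap.coe_toContinuousLinearMap', LinearMap.coe_mk, AddHom.coe_mk]
    linear_combination h1 / 2

/-- An isometry that maps the light cone of the future to itself. -/
structure IsFuture (h : LMat n) : Prop where
  mem : h ∈ isometries n
  pos : ∀ x : Euc n, 0 < (h *ᵥ emb (conePt x)) (Sum.inl ())

theorem emb_conePt (x : Euc n) : emb (conePt x) = (1 + ‖x‖ ^ 2) • lift (kappa x) := by
  have h : (1 + ‖x‖ ^ 2) ≠ 0 := by positivity
  ext (i | i | i) <;> simp [emb, conePt, lift, kappa] <;> field_simp

theorem sphereFactor_kappa (h : LMat n) (x : Euc n) :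
    sphereFactor h (kappa x) = (1 + ‖x‖ ^ 2) / (h *ᵥ emb (conePt x)) (Sum.inl ()) := by
  have h1 : (1 + ‖x‖ ^ 2) ≠ 0 := by positivity
  rw [emb_conePt, Matrix.mulVec_smul, sphereFactor, Pi.smul_apply, smul_eq_mul,
    div_mul_eq_div_div, div_self h1, one_div]

theorem sphereAct_kappa (h : LMat n) (x : Euc n) (i : SphIdx n) :
    sphereAct h (kappa x) i =
      (h *ᵥ emb (conePt x)) (Sum.inr i) / (h *ᵥ emb (conePt x)) (Sum.inl ()) := by
  have h1 : (1 + ‖x‖ ^ 2) ≠ 0 := by positivity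
  rw [emb_conePt, Matrix.mulVec_smul, sphereAct, sphereFactor, Pi.smul_apply, Pi.smul_apply,
    smul_eq_mul, smul_eq_mul, mul_div_mul_left _ _ h1, mul_comm, div_eq_mul_inv]

namespace IsFuture

variable {h : LMat n} (hh : IsFuture h) (x : Euc n)

/-- The light cone map of an isometry. -/
def cone {h : LMat n} (hh : IsFuture h) : ConeMap n := coneMap h hh.mem

theorem den_eq : hh.cone.den x = ((h *ᵥ emb (conePt x)) (Sum.inl ())
    + (h *ᵥ emb (conePt x)) (Sum.inr (Sum.inr ()))) / 2 := rfl

theorem act_eq : act h = hh.cone.toFun := by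
  funext x
  have h0 := (hh.pos x).ne'
  ext i
  have h1 : hh.cone.toFun x i = (hh.cone.den x)⁻¹ *
    ((h *ᵥ emb (conePt x)) (Sum.inr (Sum.inl i)) / 2) := rfl
  rw [h1, den_eq]
  simp only [act, stereo, sphereAct_kappa]
  rw [one_add_div h0, div_div_div_cancel_right₀ h0]
  -- At points sent to infinity both sides are 0, since division by 0 gives 0. The equality
  -- therefore holds on all of ℝⁿ.
  rcases eq_or_ne ((h *ᵥ emb (conePt x)) (Sum.inl ())
    + (h *ᵥ emb (conePt x)) (Sum.inr (Sum.inr ()))) 0 with h2 | h2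
  · simp [h2]
  · field_simp

theorem sq_eq (hh : IsFuture h) (x : Euc n) : ((h *ᵥ emb (conePt x)) (Sum.inl ())) ^ 2 =
    ∑ i : Fin n, ((h *ᵥ emb (conePt x)) (Sum.inr (Sum.inl i))) ^ 2
      + ((h *ᵥ emb (conePt x)) (Sum.inr (Sum.inr ()))) ^ 2 := by
  have h1 := dotProduct_lorentz_of_mem hh.mem (emb (conePt x)) (emb (conePt x))
  have h2 : coneForm (conePt x) (conePt x) = 0 := by
    simp [coneForm, conePt]
    ring
  rw [dotProduct_lorentz_emb, h2, dotProduct_lorentz] at h1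
  simp only [sq]
  linarith

/-- For a future light-like vector the time component dominates the last coordinate in absolute
value. Hence being defined at x is the same as having positive denominator. -/
theorem den_nonneg : 0 ≤ hh.cone.den x := by
  have h1 := hh.sq_eq x
  have h2 : 0 ≤ ∑ i : Fin n, ((h *ᵥ emb (conePt x)) (Sum.inr (Sum.inl i))) ^ 2 :=
    Finset.sum_nonneg fun i _ => sq_nonneg _
  have h3 : |(h *ᵥ emb (conePt x)) (Sum.inr (Sum.inr ()))| ≤
      (h *ᵥ emb (conePt x)) (Sum.inl ()) := abs_le_of_sq_le_sq (by linarith) (hh.pos x).le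
  rw [den_eq]
  linarith [neg_le_of_abs_le h3]

theorem definedAt_iff : DefinedAt h x ↔ 0 < hh.cone.den x := by
  have h0 := (hh.pos x).ne'
  rw [(hh.den_nonneg x).lt_iff_ne', DefinedAt, sphereAct_kappa, den_eq, not_iff_not,
    div_eq_iff h0]
  constructor <;> intro h <;> linarith

/-- The time component of the image of `conePt x` is den · (1 + |Φx|²), so the spherical factor and
the two stereographic factors multiply to 1/den. -/
theorem confFactor_eq (hx : 0 < hh.cone.den x) : confFactor h x = (hh.cone.den x)⁻¹ := by
  have h0 := (hh.pos x).ne'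
  have h1 : (1 + ‖x‖ ^ 2) ≠ 0 := by positivity
  have h2 : (1 + ‖hh.cone.toFun x‖ ^ 2) ≠ 0 := by positivity
  have h3 : (h *ᵥ emb (conePt x)) (Sum.inl ()) = hh.cone.den x * (1 + ‖hh.cone.toFun x‖ ^ 2) := by
    have h4 := hh.cone.h_conePt hx.ne'
    have h5 : hh.cone.h (conePt x) = ((h *ᵥ emb (conePt x)) (Sum.inl ())
      - (h *ᵥ emb (conePt x)) (Sum.inr (Sum.inr ()))) / 2 := rfl
    have h6 := hh.den_eq x
    linarith
  rw [confFactor, sphereFactor_kappa, hh.act_eq, h3]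
  have := hx.ne'
  field_simp

end IsFuture

/-! ### The identity component preserves the future cone. -/

theorem lorentz_mul_self : lorentz n * lorentz n = 1 := by
  rw [lorentz, LieAlgebra.Orthogonal.indefiniteDiagonal, Matrix.diagonal_mul_diagonal,
    ← Matrix.diagonal_one]
  congr 1
  ext (i | i) <;> simp

theorem lorentz_transpose : (lorentz n)ᵀ = lorentz n := by
  simp [lorentz, LieAlgebra.Orthogonal.indefiniteDiagonal]

/-- The inverse of an isometry, as a continuous function of the isometry. -/
def lorentzAdjoint (g : LMat n) : LMat n := lorentz n * gᵀ * lorentz n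

theorem lorentzAdjoint_mul {g : LMat n} (hg : g ∈ isometries n) : lorentzAdjoint g * g = 1 := by
  have h : gᵀ * lorentz n * g = lorentz n := hg
  rw [lorentzAdjoint, mul_assoc, mul_assoc, ← mul_assoc gᵀ, h, lorentz_mul_self]

theorem inv_eq_lorentzAdjoint {g : LMat n} (hg : g ∈ isometries n) : g⁻¹ = lorentzAdjoint g :=
  Matrix.inv_eq_left_inv (lorentzAdjoint_mul hg)

theorem lorentzAdjoint_mem {g : LMat n} (hg : g ∈ isometries n) :
    lorentzAdjoint g ∈ isometries n := by
  have h : g * lorentzAdjoint g = 1 := mul_eq_one_comm.1 (lorentzAdjoint_mul hg)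
  change (lorentzAdjoint g)ᵀ * lorentz n * lorentzAdjoint g = lorentz n
  have h2 : (lorentzAdjoint g)ᵀ = lorentz n * g * lorentz n := by
    simp [lorentzAdjoint, Matrix.transpose_mul, lorentz_transpose, mul_assoc]
  rw [h2, mul_assoc (lorentz n * g), lorentz_mul_self, mul_one, mul_assoc, h, mul_one]

theorem one_mem_isometries : (1 : LMat n) ∈ isometries n := by
  simp [isometries]

/-- A light-like vector without time component is zero, and an isometry is invertible. -/
theorem timeComponent_ne_zero {h : LMat n} (hh : h ∈ isometries n) (x : Euc n) :
    (h *ᵥ emb (conePt x)) (Sum.inl ()) ≠ 0 := by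
  intro h0
  have h1 := dotProduct_lorentz_of_mem hh (emb (conePt x)) (emb (conePt x))
  have h2 : coneForm (conePt x) (conePt x) = 0 := by
    simp [coneForm, conePt]
    ring
  rw [dotProduct_lorentz_emb, h2, dotProduct_lorentz, h0] at h1
  have h3 : 0 ≤ ∑ i : Fin n, (h *ᵥ emb (conePt x)) (Sum.inr (Sum.inl i)) *
    (h *ᵥ emb (conePt x)) (Sum.inr (Sum.inl i)) := Finset.sum_nonneg fun i _ => mul_self_nonneg _
  have h4 := mul_self_nonneg ((h *ᵥ emb (conePt x)) (Sum.inr (Sum.inr ())))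
  have h5 : h *ᵥ emb (conePt x) = 0 := by
    have h6 : ∑ i : Fin n, (h *ᵥ emb (conePt x)) (Sum.inr (Sum.inl i)) *
      (h *ᵥ emb (conePt x)) (Sum.inr (Sum.inl i)) = 0 := by linarith
    rw [Finset.sum_eq_zero_iff_of_nonneg fun i _ => mul_self_nonneg _] at h6
    ext (i | i | i)
    · exact h0
    · exact mul_self_eq_zero.1 (h6 i (Finset.mem_univ i))
    · exact mul_self_eq_zero.1 (by linarith)
  have h6 : emb (conePt x) = 0 := by
    rw [← Matrix.one_mulVec (emb (conePt x)), ← lorentzAdjoint_mul hh, ← Matrix.mulVec_mulVec, h5,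
      Matrix.mulVec_zero]
  have h7 := congrFun h6 (Sum.inl ())
  have h8 : (1 : ℝ) + ‖x‖ ^ 2 ≠ 0 := by positivity
  exact h8 h7

theorem isFuture_one : IsFuture (1 : LMat n) := by
  refine ⟨one_mem_isometries, fun x => ?_⟩
  rw [Matrix.one_mulVec]
  change (0 : ℝ) < 1 + ‖x‖ ^ 2
  positivity

/-- The time component is continuous, positive at the identity and never zero, so it cannot change
sign on a connected set. The map φ allows the argument to be used for inverses. -/
theorem isFuture_of_continuous {S : Set (LMat n)} (hS : IsPreconnected S) (h1 : 1 ∈ S)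
    {φ : LMat n → LMat n} (hφ : Continuous φ) (hφ1 : φ 1 = 1)
    (hφS : ∀ g ∈ S, φ g ∈ isometries n) {g : LMat n} (hg : g ∈ S) : IsFuture (φ g) := by
  refine ⟨hφS g hg, fun x => ?_⟩
  by_contra hneg
  have hc : Continuous fun g => (φ g *ᵥ emb (conePt x)) (Sum.inl ()) :=
    (continuous_apply (A := fun _ => ℝ) (Sum.inl ())).comp (hφ.matrix_mulVec continuous_const)
  have h2 : (0 : ℝ) ≤ (φ 1 *ᵥ emb (conePt x)) (Sum.inl ()) := by
    rw [hφ1]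
    exact (isFuture_one.pos x).le
  obtain ⟨g', hg', h0⟩ := hS.intermediate_value hg h1 hc.continuousOn ⟨not_lt.1 hneg, h2⟩
  exact timeComponent_ne_zero (hφS g' hg') x h0

theorem mem_isometries_of_mem {g : LMat n} (hg : g ∈ conformalGroup n) : g ∈ isometries n :=
  connectedComponentIn_subset _ _ hg

theorem isFuture_inv {g : LMat n} (hg : g ∈ conformalGroup n) : IsFuture g⁻¹ := by
  rw [inv_eq_lorentzAdjoint (mem_isometries_of_mem hg)]
  refine isFuture_of_continuous isPreconnected_connectedComponentIn
    (mem_connectedComponentIn one_mem_isometries) (φ := lorentzAdjoint) ?_ ?_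
    (fun g hg => lorentzAdjoint_mem (mem_isometries_of_mem hg)) hg
  · exact (continuous_const.matrix_mul continuous_id.matrix_transpose).matrix_mul continuous_const
  · rw [lorentzAdjoint, Matrix.transpose_one, mul_one, lorentz_mul_self]

/-! ### Partial derivatives, slices, and δd and dδ in coordinates. -/

section Calculus

variable {E V W : Type*} [NormedAddCommGroup E] [NormedSpace ℝ E] [NormedAddCommGroup V]
  [NormedSpace ℝ V] [NormedAddCommGroup W] [NormedSpace ℝ W] {f : E → V}

theorem contDiff_fderiv_apply_const (hf : ContDiff ℝ ((⊤ : ℕ∞) : WithTop ℕ∞) f) (a : E) :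
    ContDiff ℝ ((⊤ : ℕ∞) : WithTop ℕ∞) fun p => fderiv ℝ f p a :=
  (hf.fderiv_right (by norm_cast)).clm_apply contDiff_const

theorem fderiv_fderiv_comm (hf : ContDiff ℝ ((⊤ : ℕ∞) : WithTop ℕ∞) f) (p a b : E) :
    fderiv ℝ (fun p => fderiv ℝ f p a) p b = fderiv ℝ (fun p => fderiv ℝ f p b) p a := by
  have hd : DifferentiableAt ℝ (fderiv ℝ f) p :=
    ((hf.fderiv_right (m := 1) (by norm_cast)).differentiable (by simp)) p
  rw [FormModule.fderiv_fderiv_apply hd, FormModule.fderiv_fderiv_apply hd]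
  exact (hf.contDiffAt.isSymmSndFDerivAt (by simp; norm_cast)).eq b a

theorem fderiv_sum_clm {ι : Type*} (s : Finset ι) (T : ι → V →L[ℝ] W) {g : ι → E → V}
    (hg : ∀ i, ContDiff ℝ ((⊤ : ℕ∞) : WithTop ℕ∞) (g i)) (p b : E) :
    fderiv ℝ (fun p => ∑ i ∈ s, T i (g i p)) p b = ∑ i ∈ s, T i (fderiv ℝ (g i) p b) := by
  rw [fderiv_fun_sum (A := fun i p => T i (g i p))
    fun i _ => ((T i).contDiff.comp (hg i)).differentiable (by simp) p]
  simp only [FunLike.coe_sum, Finset.sum_apply]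
  exact Finset.sum_congr rfl fun i _ => (map_fderiv_of_contDiff (T i) (hg i) p b).symm

theorem fderiv_slice_fst {E₁ E₂ : Type*} [NormedAddCommGroup E₁] [NormedSpace ℝ E₁]
    [NormedAddCommGroup E₂] [NormedSpace ℝ E₂] {f : E₁ × E₂ → V} {p : E₁ × E₂}
    (hf : DifferentiableAt ℝ f p) (a : E₁) :
    fderiv ℝ f p (a, 0) = fderiv ℝ (fun x => f (x, p.2)) p.1 a := by
  have h := HasFDerivAt.comp (g := f) (f := fun x => (x, p.2)) p.1 hf.hasFDerivAt
    ((hasFDerivAt_id p.1).prodMk (hasFDerivAt_const p.2 p.1))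
  exact (congrArg (fun S => S a) h.fderiv).symm

theorem fderiv_slice_snd {E₁ E₂ : Type*} [NormedAddCommGroup E₁] [NormedSpace ℝ E₁]
    [NormedAddCommGroup E₂] [NormedSpace ℝ E₂] {f : E₁ × E₂ → V} {p : E₁ × E₂}
    (hf : DifferentiableAt ℝ f p) (a : E₂) :
    fderiv ℝ f p (0, a) = fderiv ℝ (fun y => f (p.1, y)) p.2 a := by
  have h := HasFDerivAt.comp (g := f) (f := fun y => (p.1, y)) p.2 hf.hasFDerivAt
    ((hasFDerivAt_const p.1 p.2).prodMk (hasFDerivAt_id p.2))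
  exact (congrArg (fun S => S a) h.fderiv).symm

section Contraction

variable {n : ℕ} (d : Fin n → E)
  (T : Fin n → V →L[ℝ] W) (S : Fin n → W →L[ℝ] V) (p : E)

/-- The anticommutator splits off the Laplacian; symmetry of second derivatives puts the indices of
the rest in order. The directions d are arbitrary so that one computation serves both variables. -/
theorem contracted_delta_d (hf : ContDiff ℝ ((⊤ : ℕ∞) : WithTop ℕ∞) f)
    (N : Fin n → Fin n → V →L[ℝ] V)
    (h : ∀ m i v, S m (T i v) = (inner ℝ (e m) (e i) : ℝ) • v - N i m v) :
    -∑ m, S m (fderiv ℝ (fun p => ∑ i, T i (fderiv ℝ f p (d i))) p (d m)) =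
      -∑ i, fderiv ℝ (fun p => fderiv ℝ f p (d i)) p (d i)
        + ∑ i, ∑ j, N i j (fderiv ℝ (fun p => fderiv ℝ f p (d j)) p (d i)) := by
  simp only [fderiv_sum_clm _ T fun i => contDiff_fderiv_apply_const hf (d i), map_sum, h,
    Finset.sum_sub_distrib]
  rw [neg_sub', sub_neg_eq_add]
  congr 1
  · congr 1
    refine Finset.sum_congr rfl fun i _ => ?_
    simp
  · rw [Finset.sum_comm]
    refine Finset.sum_congr rfl fun i _ => Finset.sum_congr rfl fun j _ => ?_
    rw [fderiv_fderiv_comm hf]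

theorem contracted_d_delta (hf : ContDiff ℝ ((⊤ : ℕ∞) : WithTop ℕ∞) f)
    (T : Fin n → W →L[ℝ] V) (S : Fin n → V →L[ℝ] W) :
    ∑ m, T m (fderiv ℝ (fun p => -∑ i, S i (fderiv ℝ f p (d i))) p (d m)) =
      -∑ i, ∑ j, T i (S j (fderiv ℝ (fun p => fderiv ℝ f p (d j)) p (d i))) := by
  simp only [fderiv_fun_neg, neg_apply,
    fderiv_sum_clm _ S fun i => contDiff_fderiv_apply_const hf (d i), map_sum,
    map_neg, Finset.sum_neg_distrib]

end Contraction

end Calculus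

/-! ### The coordinate operators coincide with the form-module operators. -/

variable {n k l : ℕ} {ω : BiForm n k l}

theorem contDiff_partialX (hω : ContDiff ℝ ((⊤ : ℕ∞) : WithTop ℕ∞) ω) (j : Fin n) :
    ContDiff ℝ ((⊤ : ℕ∞) : WithTop ℕ∞) (partialX j ω) :=
  contDiff_fderiv_apply_const hω _

theorem contDiff_partialY (hω : ContDiff ℝ ((⊤ : ℕ∞) : WithTop ℕ∞) ω) (j : Fin n) :
    ContDiff ℝ ((⊤ : ℕ∞) : WithTop ℕ∞) (partialY j ω) :=
  contDiff_fderiv_apply_const hω _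

theorem deltaX_dX (hω : ContDiff ℝ ((⊤ : ℕ∞) : WithTop ℕ∞) ω) (p : Euc n × Euc n) :
    deltaX (dX ω) p = -∑ i, partialX i (partialX i ω) p
      + ∑ i, ∑ j, (fstModule n k l).N (e i) (e j) (partialX i (partialX j ω) p) :=
  contracted_delta_d (V := BiAlt n k l) (W := BiAlt n (k + 1) l) (fun j => (e j, 0))
    (fun i => extMul (e i)) (fun m => intMul (e m)) p hω
    (fun i j => (fstModule n k l).N (e i) (e j)) fun _ _ _ => intMul_extMul _ _ _

theorem dDeltaX_eq (hω : ContDiff ℝ ((⊤ : ℕ∞) : WithTop ℕ∞) ω) (p : Euc n × Euc n) :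
    dDeltaX ω p =
      -∑ i, ∑ j, (fstModule n k l).N (e i) (e j) (partialX i (partialX j ω) p) := by
  cases k with
  | zero =>
    change (0 : BiAlt n 0 l) = -∑ i : Fin n, ∑ j : Fin n, (0 : BiAlt n 0 l)
    rw [Finset.sum_const_zero, Finset.sum_const_zero, neg_zero]
  | succ k =>
    exact contracted_d_delta (V := BiAlt n (k + 1) l) (W := BiAlt n k l) (fun j => (e j, 0)) p hω
      (fun i => extMul (e i)) (fun m => intMul (e m))

theorem deltaY_dY (hω : ContDiff ℝ ((⊤ : ℕ∞) : WithTop ℕ∞) ω) (p : Euc n × Euc n) :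
    deltaY (dY ω) p = -∑ i, partialY i (partialY i ω) p
      + ∑ i, ∑ j, (sndModule n k l).N (e i) (e j) (partialY i (partialY j ω) p) :=
  contracted_delta_d (V := BiAlt n k l) (W := BiAlt n k (l + 1)) (fun j => (0, e j))
    (fun i => onSnd (extMul (e i))) (fun m => onSnd (intMul (e m))) p hω
    (fun i j => (sndModule n k l).N (e i) (e j))
    fun _ _ _ => ContinuousAlternatingMap.ext fun _ => intMul_extMul _ _ _

theorem dDeltaY_eq (hω : ContDiff ℝ ((⊤ : ℕ∞) : WithTop ℕ∞) ω) (p : Euc n × Euc n) :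
    dDeltaY ω p =
      -∑ i, ∑ j, (sndModule n k l).N (e i) (e j) (partialY i (partialY j ω) p) := by
  cases l with
  | zero =>
    change (0 : BiAlt n k 0) = -∑ i : Fin n, ∑ j : Fin n, (0 : BiAlt n k 0)
    rw [Finset.sum_const_zero, Finset.sum_const_zero, neg_zero]
  | succ l =>
    exact contracted_d_delta (V := BiAlt n k (l + 1)) (W := BiAlt n k l) (fun j => (0, e j)) p hω
      (fun i => onSnd (extMul (e i))) (fun m => onSnd (intMul (e m)))

theorem partialX_eq (hω : ContDiff ℝ ((⊤ : ℕ∞) : WithTop ℕ∞) ω) (j : Fin n) (p : Euc n × Euc n) :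
    partialX j ω p = fderiv ℝ (fun x => ω (x, p.2)) p.1 (e j) :=
  fderiv_slice_fst (hω.differentiable (by simp) p) _

theorem partialY_eq (hω : ContDiff ℝ ((⊤ : ℕ∞) : WithTop ℕ∞) ω) (j : Fin n) (p : Euc n × Euc n) :
    partialY j ω p = fderiv ℝ (fun y => ω (p.1, y)) p.2 (e j) :=
  fderiv_slice_snd (hω.differentiable (by simp) p) _

theorem partialX_partialX_eq (hω : ContDiff ℝ ((⊤ : ℕ∞) : WithTop ℕ∞) ω) (i j : Fin n)
    (p : Euc n × Euc n) : partialX i (partialX j ω) p =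
      fderiv ℝ (fun x => fderiv ℝ (fun x => ω (x, p.2)) x (e j)) p.1 (e i) := by
  rw [partialX_eq (contDiff_partialX hω j)]
  congr 2
  funext x
  exact partialX_eq hω j (x, p.2)

theorem partialY_partialY_eq (hω : ContDiff ℝ ((⊤ : ℕ∞) : WithTop ℕ∞) ω) (i j : Fin n)
    (p : Euc n × Euc n) : partialY i (partialY j ω) p =
      fderiv ℝ (fun y => fderiv ℝ (fun y => ω (p.1, y)) y (e j)) p.2 (e i) := by
  rw [partialY_eq (contDiff_partialY hω j)]
  congr 2
  funext y
  exact partialY_eq hω j (p.1, y)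

/-- The double sum receives the coefficient α − β = −4(n − 2k). -/
theorem FormModule.boxSymbol_eq {V : Type} [NormedAddCommGroup V] [NormedSpace ℝ V]
    [NormedSpace ℂ V] (M : FormModule n k V) (s : ℂ) (H : Euc n → Euc n → V) :
    alpha n k s • (-∑ i, H (e i) (e i) + ∑ i, ∑ j, M.N (e i) (e j) (H (e i) (e j)))
      + beta n k s • (-∑ i, ∑ j, M.N (e i) (e j) (H (e i) (e j))) = M.boxSymbol s H := by
  rw [boxSymbol, alpha, beta]
  module

theorem boxX_eq (s : ℂ) (hω : ContDiff ℝ ((⊤ : ℕ∞) : WithTop ℕ∞) ω) :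
    boxX s ω = fun p => (fstModule n k l).box s (fun x => ω (x, p.2)) p.1 := by
  funext p
  have h := (fstModule n k l).boxSymbol_eq s
    fun b a => fderiv ℝ (fun x => fderiv ℝ (fun x => ω (x, p.2)) x a) p.1 b
  simp only [← partialX_partialX_eq hω] at h
  rw [← deltaX_dX hω, ← dDeltaX_eq hω] at h
  exact h

theorem boxY_eq (t : ℂ) (hω : ContDiff ℝ ((⊤ : ℕ∞) : WithTop ℕ∞) ω) :
    boxY t ω = fun p => (sndModule n k l).box t (fun y => ω (p.1, y)) p.2 := by
  funext p
  have h := (sndModule n k l).boxSymbol_eq t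
    fun b a => fderiv ℝ (fun y => fderiv ℝ (fun y => ω (p.1, y)) y a) p.2 b
  simp only [← partialY_partialY_eq hω] at h
  rw [← deltaY_dY hω, ← dDeltaY_eq hω] at h
  exact h

variable {n k l : ℕ} {ω : BiForm n k l}

theorem extDeltaX_eq (j : Fin n) (ω : BiForm n k l) (p : Euc n × Euc n) :
    extDeltaX j ω p = -∑ m, (fstModule n k l).N (e j) (e m) (partialX m ω p) := by
  cases k with
  | zero =>
    change (0 : BiAlt n 0 l) = -∑ i : Fin n, (0 : BiAlt n 0 l)
    rw [Finset.sum_const_zero, neg_zero]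
  | succ k =>
    change extMul (e j) (-∑ m, intMul (e m) (partialX m ω p)) = _
    rw [map_neg, map_sum]
    rfl

theorem extDeltaY_eq (j : Fin n) (ω : BiForm n k l) (p : Euc n × Euc n) :
    extDeltaY j ω p = -∑ m, (sndModule n k l).N (e j) (e m) (partialY m ω p) := by
  cases l with
  | zero =>
    change (0 : BiAlt n k 0) = -∑ i : Fin n, (0 : BiAlt n k 0)
    rw [Finset.sum_const_zero, neg_zero]
  | succ l =>
    change onSnd (extMul (e j)) (-∑ m, onSnd (intMul (e m)) (partialY m ω p)) = _
    rw [map_neg, map_sum]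
    rfl

theorem sum_fderiv_clm {E V W : Type*} [NormedAddCommGroup E] [NormedSpace ℝ E]
    [NormedAddCommGroup V] [NormedSpace ℝ V] [NormedAddCommGroup W] [NormedSpace ℝ W] {f : E → V}
    (hf : ContDiff ℝ ((⊤ : ℕ∞) : WithTop ℕ∞) f) (d : Fin n → E) (S : V →L[ℝ] W)
    (T : Fin n → W →L[ℝ] V) (p : E) :
    ∑ m, T m (fderiv ℝ (fun p => S (f p)) p (d m)) = ∑ m, T m (S (fderiv ℝ f p (d m))) := by
  simp only [map_fderiv_of_contDiff S hf]

theorem dIntX_eq (hω : ContDiff ℝ ((⊤ : ℕ∞) : WithTop ℕ∞) ω) (j : Fin n) (p : Euc n × Euc n) :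
    dIntX j ω p = ∑ m, (fstModule n k l).N (e m) (e j) (partialX m ω p) := by
  cases k with
  | zero =>
    change (0 : BiAlt n 0 l) = ∑ i : Fin n, (0 : BiAlt n 0 l)
    rw [Finset.sum_const_zero]
  | succ k =>
    exact sum_fderiv_clm (V := BiAlt n (k + 1) l) (W := BiAlt n k l) hω (fun m => (e m, 0))
      (intMul (e j)) (fun m => extMul (e m)) p

theorem dIntY_eq (hω : ContDiff ℝ ((⊤ : ℕ∞) : WithTop ℕ∞) ω) (j : Fin n) (p : Euc n × Euc n) :
    dIntY j ω p = ∑ m, (sndModule n k l).N (e m) (e j) (partialY m ω p) := by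
  cases l with
  | zero =>
    change (0 : BiAlt n k 0) = ∑ i : Fin n, (0 : BiAlt n k 0)
    rw [Finset.sum_const_zero]
  | succ l =>
    exact sum_fderiv_clm (V := BiAlt n k (l + 1)) (W := BiAlt n k l) hω (fun m => (0, e m))
      (onSnd (intMul (e j))) (fun m => onSnd (extMul (e m))) p

theorem FormModule.nablaSymbol_eq {V : Type} [NormedAddCommGroup V] [NormedSpace ℝ V]
    [NormedSpace ℂ V] (M : FormModule n k V) (s : ℂ) (v : Euc n) (D : Euc n →ₗ[ℝ] V) :
    (2 - s) • (alpha n k s • D v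
      + (2 * (s - n + 2 * k)) • (-∑ m, M.N v (e m) (D (e m)))
      + (2 * (s + n - 2 * k)) • ∑ m, M.N (e m) v (D (e m))) = M.nablaSymbol s v D := by
  rw [nablaSymbol]
  module

theorem nablaX_eq (s : ℂ) (j : Fin n) (hω : ContDiff ℝ ((⊤ : ℕ∞) : WithTop ℕ∞) ω) :
    nablaX s j ω = fun p => (fstModule n k l).nabla s (e j) (fun x => ω (x, p.2)) p.1 := by
  funext p
  have h := (fstModule n k l).nablaSymbol_eq s (e j)
    (fderiv ℝ (fun x => ω (x, p.2)) p.1 : Euc n →ₗ[ℝ] BiAlt n k l)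
  simp only [ContinuousLinearMap.coe_coe, ← partialX_eq hω] at h
  rw [← extDeltaX_eq, ← dIntX_eq hω] at h
  exact h

theorem nablaY_eq (t : ℂ) (j : Fin n) (hω : ContDiff ℝ ((⊤ : ℕ∞) : WithTop ℕ∞) ω) :
    nablaY t j ω = fun p => (sndModule n k l).nabla t (e j) (fun y => ω (p.1, y)) p.2 := by
  funext p
  have h := (sndModule n k l).nablaSymbol_eq t (e j)
    (fderiv ℝ (fun y => ω (p.1, y)) p.2 : Euc n →ₗ[ℝ] BiAlt n k l)
  simp only [ContinuousLinearMap.coe_coe, ← partialY_eq hω] at h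
  rw [← extDeltaY_eq, ← dIntY_eq hω] at h
  exact h

theorem contDiff_boxY (t : ℂ) (hω : ContDiff ℝ ((⊤ : ℕ∞) : WithTop ℕ∞) ω) :
    ContDiff ℝ ((⊤ : ℕ∞) : WithTop ℕ∞) (boxY t ω) := by
  rw [boxY_eq t hω]
  exact (sndModule n k l).contDiff_box_slice (f := fun x y => ω (x, y)) hω t

theorem contDiff_nablaY (t : ℂ) (j : Fin n) (hω : ContDiff ℝ ((⊤ : ℕ∞) : WithTop ℕ∞) ω) :
    ContDiff ℝ ((⊤ : ℕ∞) : WithTop ℕ∞) (nablaY t j ω) := by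
  rw [nablaY_eq t j hω]
  exact (sndModule n k l).contDiff_nabla_slice (f := fun x y => ω (x, y)) hω t (e j)

/-- Smoothness enters through replacing partial derivatives on the product by derivatives of slices,
for ω and for the results of the operators in y. -/
theorem opE_eq (s t : ℂ) (hω : ContDiff ℝ ((⊤ : ℕ∞) : WithTop ℕ∞) ω) (p : Euc n × Euc n) :
    opE s t ω p = (fstModule n k l).twoE (sndModule n k l) s t (fun x y => ω (x, y)) p.1 p.2 := by
  rw [opE, FormModule.twoE, boxX_eq s (contDiff_boxY t hω), boxX_eq s hω]
  have h1 : ∀ j, boxX s (nablaY t j ω) = _ := fun j => boxX_eq s (contDiff_nablaY t j hω)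
  have h2 : ∀ j, nablaX s j (nablaY t j ω) = _ := fun j => nablaX_eq s j (contDiff_nablaY t j hω)
  have h3 : ∀ j, nablaX s j (boxY t ω) = _ := fun j => nablaX_eq s j (contDiff_boxY t hω)
  simp only [h1, h2, h3]
  simp only [boxY_eq t hω, nablaY_eq t _ hω]
  rfl

theorem commuting_fst_snd (n k l : ℕ) : (fstModule n k l).Commuting (sndModule n k l) where
  N_pull _ _ _ _ := fstModule_N_onSnd _ _ _ _
  pull_N _ _ _ _ := rfl
  pull_pull _ _ _ := rfl

theorem rep_eq_twoPull (lam mu : ℂ) {g : LMat n} (hg : IsFuture g⁻¹) {p : Euc n × Euc n}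
    (h1 : 0 < hg.cone.den p.1) (h2 : 0 < hg.cone.den p.2) (ω : BiForm n k l) :
    rep lam mu g ω p = (fstModule n k l).twoPull (sndModule n k l) lam mu hg.cone.toFun
      (fun x => (hg.cone.den x)⁻¹) (fun x y => ω (x, y)) p.1 p.2 := by
  rw [rep, rep₂, if_pos ⟨(hg.definedAt_iff _).2 h1, (hg.definedAt_iff _).2 h2⟩,
    hg.confFactor_eq _ h1, hg.confFactor_eq _ h2, hg.act_eq, FormModule.twoPull,
    FormModule.wpull_apply, FormModule.wpull_apply, FormModule.pull_csmul, smul_smul]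
  rfl

theorem rep_eq_zero (lam mu : ℂ) {g : LMat n} (hg : IsFuture g⁻¹) {p : Euc n × Euc n}
    (h : ¬(0 < hg.cone.den p.1 ∧ 0 < hg.cone.den p.2)) (ω : BiForm n k l) :
    rep lam mu g ω p = 0 := by
  rw [rep, rep₂, if_neg]
  rwa [hg.definedAt_iff, hg.definedAt_iff]

/-! ### Smoothness of the represented form, jointly in the point and a parameter of the group
elements. -/

variable {n k l : ℕ}

/-- The numerator of the rational action of `h`. -/
def matNum (h : LMat n) (x : Euc n) : Euc n :=
  WithLp.toLp 2 fun i => (h *ᵥ emb (conePt x)) (Sum.inr (Sum.inl i)) / 2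

/-- The denominator of the rational action of `h`. -/
def matDen (h : LMat n) (x : Euc n) : ℝ :=
  ((h *ᵥ emb (conePt x)) (Sum.inl ()) + (h *ᵥ emb (conePt x)) (Sum.inr (Sum.inr ()))) / 2

/-- The last coordinate of the image of the light cone under `h`. -/
def matHt (h : LMat n) (x : Euc n) : ℝ :=
  ((h *ᵥ emb (conePt x)) (Sum.inl ()) - (h *ᵥ emb (conePt x)) (Sum.inr (Sum.inr ()))) / 2

namespace IsFuture

variable {h : LMat n} (x : Euc n)

theorem act_eq_matNum (hh : IsFuture h) : act h = fun x => (matDen h x)⁻¹ • matNum h x := hh.act_eq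

theorem matHt_eq (hh : IsFuture h) (hx : 0 < matDen h x) :
    matHt h x = matDen h x * ‖act h x‖ ^ 2 := by
  rw [hh.act_eq]
  exact hh.cone.h_conePt (x := x) hx.ne'

theorem matHt_pos (hh : IsFuture h) (hx : matDen h x = 0) : 0 < matHt h x := by
  have h1 := hh.pos x
  rw [matDen] at hx
  rw [matHt]
  linarith

theorem definedAt_iff_matDen (hh : IsFuture h) : DefinedAt h x ↔ 0 < matDen h x :=
  hh.definedAt_iff x

theorem matDen_nonneg (hh : IsFuture h) : 0 ≤ matDen h x := hh.den_nonneg x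

end IsFuture

section Smooth

variable {Q : Type*} [NormedAddCommGroup Q] [NormedSpace ℝ Q] {h : Q → LMat n}

theorem contDiff_emb_conePt (j : Unit ⊕ SphIdx n) :
    ContDiff ℝ ((⊤ : ℕ∞) : WithTop ℕ∞) (fun x : Euc n => emb (conePt x) j) := by
  rcases j with j | j | j
  · exact contDiff_const.add (contDiff_norm_sq ℝ)
  · exact contDiff_const.mul (contDiff_euclidean.1 contDiff_id j)
  · exact contDiff_const.sub (contDiff_norm_sq ℝ)

theorem contDiff_mulVec (hh : ∀ i j, ContDiff ℝ ((⊤ : ℕ∞) : WithTop ℕ∞) fun q => h q i j)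
    (i : Unit ⊕ SphIdx n) : ContDiff ℝ ((⊤ : ℕ∞) : WithTop ℕ∞)
      (fun q : Q × Euc n => (h q.1 *ᵥ emb (conePt q.2)) i) := by
  change ContDiff ℝ _ fun q : Q × Euc n => ∑ j, h q.1 i j * emb (conePt q.2) j
  exact ContDiff.sum fun j _ => ((hh i j).comp contDiff_fst).mul
    ((contDiff_emb_conePt j).comp contDiff_snd)

theorem contDiff_matDen (hh : ∀ i j, ContDiff ℝ ((⊤ : ℕ∞) : WithTop ℕ∞) fun q => h q i j) :
    ContDiff ℝ ((⊤ : ℕ∞) : WithTop ℕ∞) (fun q : Q × Euc n => matDen (h q.1) q.2) :=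
  ((contDiff_mulVec hh _).add (contDiff_mulVec hh _)).div_const 2

theorem contDiff_matHt (hh : ∀ i j, ContDiff ℝ ((⊤ : ℕ∞) : WithTop ℕ∞) fun q => h q i j) :
    ContDiff ℝ ((⊤ : ℕ∞) : WithTop ℕ∞) (fun q : Q × Euc n => matHt (h q.1) q.2) :=
  ((contDiff_mulVec hh _).sub (contDiff_mulVec hh _)).div_const 2

theorem contDiff_matNum (hh : ∀ i j, ContDiff ℝ ((⊤ : ℕ∞) : WithTop ℕ∞) fun q => h q i j) :
    ContDiff ℝ ((⊤ : ℕ∞) : WithTop ℕ∞) (fun q : Q × Euc n => matNum (h q.1) q.2) :=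
  contDiff_euclidean.2 fun _ => (contDiff_mulVec hh _).div_const 2

theorem contDiffAt_act (hh : ∀ i j, ContDiff ℝ ((⊤ : ℕ∞) : WithTop ℕ∞) fun q => h q i j)
    (hF : ∀ q, IsFuture (h q)) {q : Q} {x : Euc n} (hx : 0 < matDen (h q) x) :
    ContDiffAt ℝ ((⊤ : ℕ∞) : WithTop ℕ∞) (fun q : Q × Euc n => act (h q.1) q.2) (q, x) := by
  have h1 : (fun q : Q × Euc n => act (h q.1) q.2) =
      fun q : Q × Euc n => (matDen (h q.1) q.2)⁻¹ • matNum (h q.1) q.2 :=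
    funext fun q => congrFun (hF q.1).act_eq_matNum q.2
  rw [h1]
  exact ((contDiff_matDen hh).contDiffAt.inv hx.ne').smul (contDiff_matNum hh).contDiffAt

theorem contDiffAt_fderiv_act (hh : ∀ i j, ContDiff ℝ ((⊤ : ℕ∞) : WithTop ℕ∞) fun q => h q i j)
    (hF : ∀ q, IsFuture (h q)) {q : Q} {x : Euc n} (hx : 0 < matDen (h q) x) :
    ContDiffAt ℝ ((⊤ : ℕ∞) : WithTop ℕ∞) (fun q : Q × Euc n => fderiv ℝ (act (h q.1)) q.2)
      (q, x) := by
  have h1 : ContDiffAt ℝ ((⊤ : ℕ∞) : WithTop ℕ∞)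
      (Function.uncurry fun (q : Q × Euc n) (y : Euc n) => act (h q.1) y) ((q, x), x) :=
    ContDiffAt.comp (g := fun q : Q × Euc n => act (h q.1) q.2)
      (f := fun q : (Q × Euc n) × Euc n => (q.1.1, q.2)) ((q, x), x)
      (contDiffAt_act hh hF hx)
      ((contDiff_fst.comp contDiff_fst).prodMk contDiff_snd).contDiffAt
  exact h1.fderiv contDiffAt_snd (by norm_cast)

theorem contDiffAt_cpow_matDen (hh : ∀ i j, ContDiff ℝ ((⊤ : ℕ∞) : WithTop ℕ∞) fun q => h q i j)
    (lam : ℂ) {q : Q} {x : Euc n} (hx : 0 < matDen (h q) x) :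
    ContDiffAt ℝ ((⊤ : ℕ∞) : WithTop ℕ∞)
      (fun q : Q × Euc n => (((matDen (h q.1) q.2)⁻¹ : ℝ) : ℂ) ^ lam) (q, x) := by
  -- Near a point with positive denominator the complex power is exp(lam · log) with the real
  -- logarithm, which is smooth.
  have h1 : (fun q : Q × Euc n => (((matDen (h q.1) q.2)⁻¹ : ℝ) : ℂ) ^ lam) =ᶠ[nhds (q, x)]
      fun q : Q × Euc n => Complex.exp (((Real.log (matDen (h q.1) q.2)⁻¹ : ℝ) : ℂ) * lam) := by
    filter_upwards [(contDiff_matDen hh).continuous.continuousAt.eventually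
      (lt_mem_nhds (a := (0 : ℝ)) hx)] with r hr
    have hr' := inv_pos.2 hr
    rw [Complex.cpow_def_of_ne_zero (Complex.ofReal_ne_zero.2 hr'.ne'), Complex.ofReal_log hr'.le]
  refine ContDiffAt.congr_of_eventuallyEq ?_ h1
  refine ContDiffAt.cexp (ContDiffAt.mul ?_ contDiffAt_const)
  exact Complex.ofRealCLM.contDiff.contDiffAt.comp _
    (((contDiff_matDen hh).contDiffAt.inv hx.ne').log (inv_ne_zero hx.ne'))

/-- The value of `rep₂` at the points where it is not zero by definition. -/
theorem rep₂_eq (lam mu : ℂ) {g g' : LMat n} (hg : IsFuture g⁻¹) (hg' : IsFuture g'⁻¹)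
    {p : Euc n × Euc n} (h1 : 0 < matDen g⁻¹ p.1) (h2 : 0 < matDen g'⁻¹ p.2) (ω : BiForm n k l) :
    rep₂ lam mu g g' ω p = (((matDen g⁻¹ p.1)⁻¹ : ℝ) : ℂ) ^ lam •
      (((matDen g'⁻¹ p.2)⁻¹ : ℝ) : ℂ) ^ mu • (fstModule n k l).pull (fderiv ℝ (act g⁻¹) p.1)
        ((sndModule n k l).pull (fderiv ℝ (act g'⁻¹) p.2) (ω (act g⁻¹ p.1, act g'⁻¹ p.2))) := by
  rw [rep₂, if_pos ⟨(hg.definedAt_iff_matDen _).2 h1, (hg'.definedAt_iff_matDen _).2 h2⟩,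
    hg.confFactor_eq _ h1, hg'.confFactor_eq _ h2, smul_smul]
  rfl

theorem rep₂_eq_zero (lam mu : ℂ) {g g' : LMat n} (hg : IsFuture g⁻¹) (hg' : IsFuture g'⁻¹)
    {p : Euc n × Euc n} (ω : BiForm n k l)
    (h : ¬(0 < matDen g⁻¹ p.1 ∧ 0 < matDen g'⁻¹ p.2)) : rep₂ lam mu g g' ω p = 0 := by
  rw [rep₂, if_neg]
  rwa [hg.definedAt_iff_matDen, hg'.definedAt_iff_matDen]

theorem FormModule.contDiffAt_smul_smul_pull_pull {V : Type} [NormedAddCommGroup V]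
    [NormedSpace ℝ V] [NormedSpace ℂ V] [IsScalarTower ℝ ℂ V] (M₁ : FormModule n k V)
    (M₂ : FormModule n l V) {q : Q} {c c' : Q → ℂ} {L L' : Q → Euc n →L[ℝ] Euc n} {f : Q → V}
    (hc : ContDiffAt ℝ ((⊤ : ℕ∞) : WithTop ℕ∞) c q)
    (hc' : ContDiffAt ℝ ((⊤ : ℕ∞) : WithTop ℕ∞) c' q)
    (hL : ContDiffAt ℝ ((⊤ : ℕ∞) : WithTop ℕ∞) L q)
    (hL' : ContDiffAt ℝ ((⊤ : ℕ∞) : WithTop ℕ∞) L' q)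
    (hf : ContDiffAt ℝ ((⊤ : ℕ∞) : WithTop ℕ∞) f q) :
    ContDiffAt ℝ ((⊤ : ℕ∞) : WithTop ℕ∞)
      (fun q => c q • c' q • M₁.pull (L q) (M₂.pull (L' q) (f q))) q := by
  have h2 : ContDiffAt ℝ ((⊤ : ℕ∞) : WithTop ℕ∞) (fun q => M₂.pull (L' q) (f q)) q :=
    M₂.contDiff_pull.contDiffAt.comp q (hL'.prodMk hf)
  have h1 : ContDiffAt ℝ ((⊤ : ℕ∞) : WithTop ℕ∞)
      (fun q => M₁.pull (L q) (M₂.pull (L' q) (f q))) q :=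
    M₁.contDiff_pull.contDiffAt.comp q (hL.prodMk h2)
  exact hc.smul (hc'.smul h1)

variable {g g' : Q → LMat n} (lam mu : ℂ) {ω : BiForm n k l}

theorem contDiffAt_rep₂_of_pos
    (hg : ∀ i j, ContDiff ℝ ((⊤ : ℕ∞) : WithTop ℕ∞) fun q => (g q)⁻¹ i j)
    (hg' : ∀ i j, ContDiff ℝ ((⊤ : ℕ∞) : WithTop ℕ∞) fun q => (g' q)⁻¹ i j)
    (hF : ∀ q, IsFuture (g q)⁻¹) (hF' : ∀ q, IsFuture (g' q)⁻¹)
    (hω : ContDiff ℝ ((⊤ : ℕ∞) : WithTop ℕ∞) ω) {q : Q} {p : Euc n × Euc n}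
    (h1 : 0 < matDen (g q)⁻¹ p.1) (h2 : 0 < matDen (g' q)⁻¹ p.2) :
    ContDiffAt ℝ ((⊤ : ℕ∞) : WithTop ℕ∞)
      (fun r : Q × (Euc n × Euc n) => rep₂ lam mu (g r.1) (g' r.1) ω r.2) (q, p) := by
  have a1 : ContDiffAt ℝ ((⊤ : ℕ∞) : WithTop ℕ∞)
      (fun r : Q × (Euc n × Euc n) => (r.1, r.2.1)) (q, p) :=
    (contDiff_fst.prodMk (contDiff_fst.comp contDiff_snd)).contDiffAt
  have a2 : ContDiffAt ℝ ((⊤ : ℕ∞) : WithTop ℕ∞)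
      (fun r : Q × (Euc n × Euc n) => (r.1, r.2.2)) (q, p) :=
    (contDiff_fst.prodMk (contDiff_snd.comp contDiff_snd)).contDiffAt
  have h : (fun r : Q × (Euc n × Euc n) => rep₂ lam mu (g r.1) (g' r.1) ω r.2) =ᶠ[nhds (q, p)]
      fun r => (((matDen (g r.1)⁻¹ r.2.1)⁻¹ : ℝ) : ℂ) ^ lam •
        (((matDen (g' r.1)⁻¹ r.2.2)⁻¹ : ℝ) : ℂ) ^ mu •
        (fstModule n k l).pull (fderiv ℝ (act (g r.1)⁻¹) r.2.1)
          ((sndModule n k l).pull (fderiv ℝ (act (g' r.1)⁻¹) r.2.2)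
            (ω (act (g r.1)⁻¹ r.2.1, act (g' r.1)⁻¹ r.2.2))) := by
    have b1 : ∀ᶠ r in nhds (q, p), 0 < matDen (g r.1)⁻¹ r.2.1 :=
      (((contDiff_matDen hg).continuous.continuousAt.comp a1.continuousAt).eventually
        (lt_mem_nhds (a := (0 : ℝ)) h1))
    have b2 : ∀ᶠ r in nhds (q, p), 0 < matDen (g' r.1)⁻¹ r.2.2 :=
      (((contDiff_matDen hg').continuous.continuousAt.comp a2.continuousAt).eventually
        (lt_mem_nhds (a := (0 : ℝ)) h2))
    filter_upwards [b1, b2] with r hr1 hr2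
    exact rep₂_eq lam mu (hF r.1) (hF' r.1) hr1 hr2 ω
  refine ContDiffAt.congr_of_eventuallyEq ?_ h
  refine FormModule.contDiffAt_smul_smul_pull_pull _ _ ?_ ?_ ?_ ?_ ?_
  · exact (contDiffAt_cpow_matDen hg lam h1).comp (q, p) a1
  · exact (contDiffAt_cpow_matDen hg' mu h2).comp (q, p) a2
  · exact (contDiffAt_fderiv_act hg hF h1).comp (q, p) a1
  · exact (contDiffAt_fderiv_act hg' hF' h2).comp (q, p) a2
  · have c1 : ∀ {A : Q × Euc n → Euc n}, ContDiffAt ℝ ((⊤ : ℕ∞) : WithTop ℕ∞) A (q, p.1) →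
        ContDiffAt ℝ ((⊤ : ℕ∞) : WithTop ℕ∞) (fun r : Q × (Euc n × Euc n) => A (r.1, r.2.1))
          (q, p) := fun hA => hA.comp (q, p) a1
    have c2 : ∀ {A : Q × Euc n → Euc n}, ContDiffAt ℝ ((⊤ : ℕ∞) : WithTop ℕ∞) A (q, p.2) →
        ContDiffAt ℝ ((⊤ : ℕ∞) : WithTop ℕ∞) (fun r : Q × (Euc n × Euc n) => A (r.1, r.2.2))
          (q, p) := fun hA => hA.comp (q, p) a2
    have b1 := c1 (contDiffAt_act hg hF h1)
    have b2 := c2 (contDiffAt_act hg' hF' h2)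
    exact hω.contDiffAt.comp (q, p) (b1.prodMk b2)

/-- Close to a point that is mapped to infinity, the action has large values or is not defined. -/
theorem eventually_lt_norm_act (hg : ∀ i j, ContDiff ℝ ((⊤ : ℕ∞) : WithTop ℕ∞) fun q => g q i j)
    (hF : ∀ q, IsFuture (g q)) (R : ℝ) {q : Q} {x : Euc n} (hx : ¬ 0 < matDen (g q) x) :
    ∀ᶠ r in nhds (q, x), 0 < matDen (g r.1) r.2 → R < ‖act (g r.1) r.2‖ := by
  have h0 : matDen (g q) x = 0 := le_antisymm (not_lt.1 hx) ((hF q).matDen_nonneg x)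
  -- Where the action is defined, |act|² = `matHt` / `matDen`. At a point sent to infinity `matDen`
  -- is 0 and `matHt` is positive, so this strict inequality holds there, and it is an open
  -- condition.
  have h1 : matDen (g q) x * R ^ 2 < matHt (g q) x := by
    rw [h0, zero_mul]
    exact (hF q).matHt_pos x h0
  have h2 : ∀ᶠ r in nhds (q, x), matDen (g r.1) r.2 * R ^ 2 < matHt (g r.1) r.2 :=
    ContinuousAt.eventually_lt (((contDiff_matDen hg).mul contDiff_const).continuous.continuousAt)
      (contDiff_matHt hg).continuous.continuousAt h1
  filter_upwards [h2] with r hr hpos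
  rw [(hF r.1).matHt_eq _ hpos, mul_lt_mul_iff_right₀ hpos] at hr
  exact lt_of_pow_lt_pow_left₀ 2 (norm_nonneg _) hr

/-- Close to a point where one of the actions is undefined, its values leave a ball containing the
support of ω; wherever it is undefined the value is 0 by convention. -/
theorem eventually_rep₂_eq_zero
    (hg : ∀ i j, ContDiff ℝ ((⊤ : ℕ∞) : WithTop ℕ∞) fun q => (g q)⁻¹ i j)
    (hg' : ∀ i j, ContDiff ℝ ((⊤ : ℕ∞) : WithTop ℕ∞) fun q => (g' q)⁻¹ i j)
    (hF : ∀ q, IsFuture (g q)⁻¹) (hF' : ∀ q, IsFuture (g' q)⁻¹)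
    (hω : HasCompactSupport ω) {q : Q} {p : Euc n × Euc n}
    (h : ¬(0 < matDen (g q)⁻¹ p.1 ∧ 0 < matDen (g' q)⁻¹ p.2)) :
    ∀ᶠ r : Q × (Euc n × Euc n) in nhds (q, p), rep₂ lam mu (g r.1) (g' r.1) ω r.2 = 0 := by
  obtain ⟨R, hR⟩ := hω.isCompact.isBounded.subset_closedBall 0
  have hR' : ∀ r, R < ‖r‖ → ω r = 0 := fun r hr => by
    by_contra h0
    have := hR (subset_tsupport ω h0)
    rw [mem_closedBall_zero_iff] at this
    exact absurd hr (not_lt.2 this)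
  have key : ∀ᶠ r : Q × (Euc n × Euc n) in nhds (q, p),
      (0 < matDen (g r.1)⁻¹ r.2.1 ∧ 0 < matDen (g' r.1)⁻¹ r.2.2) →
        R < ‖(act (g r.1)⁻¹ r.2.1, act (g' r.1)⁻¹ r.2.2)‖ := by
    rw [not_and_or] at h
    rcases h with h | h
    · have a1 : Filter.Tendsto (fun r : Q × (Euc n × Euc n) => (r.1, r.2.1)) (nhds (q, p))
          (nhds (q, p.1)) :=
        (continuous_fst.prodMk (continuous_fst.comp continuous_snd)).tendsto _
      filter_upwards [a1.eventually (eventually_lt_norm_act hg hF R h)] with r hr hpos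
      exact (hr hpos.1).trans_le (norm_fst_le (act (g r.1)⁻¹ r.2.1, act (g' r.1)⁻¹ r.2.2))
    · have a1 : Filter.Tendsto (fun r : Q × (Euc n × Euc n) => (r.1, r.2.2)) (nhds (q, p))
          (nhds (q, p.2)) :=
        (continuous_fst.prodMk (continuous_snd.comp continuous_snd)).tendsto _
      filter_upwards [a1.eventually (eventually_lt_norm_act hg' hF' R h)] with r hr hpos
      exact (hr hpos.2).trans_le (norm_snd_le (act (g r.1)⁻¹ r.2.1, act (g' r.1)⁻¹ r.2.2))
  filter_upwards [key] with r hr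
  by_cases hpos : 0 < matDen (g r.1)⁻¹ r.2.1 ∧ 0 < matDen (g' r.1)⁻¹ r.2.2
  · rw [rep₂_eq lam mu (hF r.1) (hF' r.1) hpos.1 hpos.2, hR' _ (hr hpos), map_zero, map_zero,
      smul_zero, smul_zero]
  · exact rep₂_eq_zero lam mu (hF r.1) (hF' r.1) ω hpos

theorem contDiff_rep₂
    (hg : ∀ i j, ContDiff ℝ ((⊤ : ℕ∞) : WithTop ℕ∞) fun q => (g q)⁻¹ i j)
    (hg' : ∀ i j, ContDiff ℝ ((⊤ : ℕ∞) : WithTop ℕ∞) fun q => (g' q)⁻¹ i j)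
    (hF : ∀ q, IsFuture (g q)⁻¹) (hF' : ∀ q, IsFuture (g' q)⁻¹)
    (hω : ContDiff ℝ ((⊤ : ℕ∞) : WithTop ℕ∞) ω) (hc : HasCompactSupport ω) :
    ContDiff ℝ ((⊤ : ℕ∞) : WithTop ℕ∞)
      (fun r : Q × (Euc n × Euc n) => rep₂ lam mu (g r.1) (g' r.1) ω r.2) := by
  rw [contDiff_iff_contDiffAt]
  rintro ⟨q, p⟩
  by_cases h : 0 < matDen (g q)⁻¹ p.1 ∧ 0 < matDen (g' q)⁻¹ p.2
  · exact contDiffAt_rep₂_of_pos lam mu hg hg' hF hF' hω h.1 h.2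
  · exact ContDiffAt.congr_of_eventuallyEq contDiffAt_const
      (eventually_rep₂_eq_zero lam mu hg hg' hF hF' hc h)

end Smooth

/-! ### Covariance under the group. -/

variable {n k l : ℕ}

theorem FormModule.wpull_add_one {V : Type} [NormedAddCommGroup V] [NormedSpace ℝ V]
    [NormedSpace ℂ V] [IsScalarTower ℝ ℂ V] (M : FormModule n k V) (lam : ℂ) {c : ℝ} (hc : c ≠ 0)
    (L : Euc n →L[ℝ] Euc n) (η : V) :
    M.wpull (lam + 1) c L η = (c : ℂ) • M.wpull lam c L η := by
  rw [wpull_apply, wpull_apply, Complex.cpow_add _ _ (Complex.ofReal_ne_zero.2 hc),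
    Complex.cpow_one, mul_comm, mul_smul]

/-- The extra factor is exactly the one produced by `twoE_twoPull`. -/
theorem FormModule.twoPull_add_one {V : Type} [NormedAddCommGroup V] [NormedSpace ℝ V]
    [NormedSpace ℂ V] [IsScalarTower ℝ ℂ V] (M₁ : FormModule n k V) (M₂ : FormModule n l V)
    (lam mu : ℂ) (Φ : Euc n → Euc n) {Ω : Euc n → ℝ} (ω : Euc n → Euc n → V) {x y : Euc n}
    (hx : Ω x ≠ 0) (hy : Ω y ≠ 0) :
    M₁.twoPull M₂ (lam + 1) (mu + 1) Φ Ω ω x y =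
      ((Ω x : ℂ) * Ω y) • M₁.twoPull M₂ lam mu Φ Ω ω x y := by
  rw [twoPull, twoPull, wpull_add_one _ _ hx, wpull_add_one _ _ hy, wpull_csmul, smul_smul]

theorem contDiff_rep {lam mu : ℂ} {g : LMat n} (hg : IsFuture g⁻¹) {ω : BiForm n k l}
    (hω : ContDiff ℝ ((⊤ : ℕ∞) : WithTop ℕ∞) ω) (hc : HasCompactSupport ω) :
    ContDiff ℝ ((⊤ : ℕ∞) : WithTop ℕ∞) (rep lam mu g ω) := by
  have key : ∀ {f : ℝ × (Euc n × Euc n) → BiAlt n k l}, ContDiff ℝ ((⊤ : ℕ∞) : WithTop ℕ∞) f →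
      ContDiff ℝ ((⊤ : ℕ∞) : WithTop ℕ∞) fun p => f (0, p) :=
    fun hf => hf.comp (contDiff_prodMk_right 0)
  -- The parameter is a dummy: both families are constant.
  have h := contDiff_rep₂ (Q := ℝ) (g := fun _ => g) (g' := fun _ => g) lam mu
    (fun _ _ => contDiff_const) (fun _ _ => contDiff_const) (fun _ => hg) (fun _ => hg) hω hc
  exact key h

theorem FormModule.twoE_zero {V : Type} [NormedAddCommGroup V] [NormedSpace ℝ V]
    [NormedSpace ℂ V] (M₁ : FormModule n k V) (M₂ : FormModule n l V) (s t : ℂ) (x y : Euc n) :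
    M₁.twoE M₂ s t (fun _ _ => 0) x y = 0 := by
  have h1 : ∀ (m : ℕ) (M : FormModule n m V) (s : ℂ) (v x : Euc n),
      M.nabla s v (fun _ => 0) x = 0 := fun m M s v x => by
    simp [FormModule.nabla, FormModule.nablaSymbol]
  have h2 : ∀ (m : ℕ) (M : FormModule n m V) (s : ℂ) (x : Euc n),
      M.box s (fun _ => 0) x = 0 := fun m M s x => by
    simp [FormModule.box, FormModule.boxSymbol]
  simp [FormModule.twoE, h1, h2]

/-- Where both points have finite images this is `twoE_twoPull`, by locality. Elsewhere the
represented form vanishes near the point, so E of it is zero, as is the right-hand side. -/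
theorem opE_rep {lam mu : ℂ} {g : LMat n} (hg : IsFuture g⁻¹) {ω : BiForm n k l}
    (hω : ContDiff ℝ ((⊤ : ℕ∞) : WithTop ℕ∞) ω) (hc : HasCompactSupport ω) :
    opE (n - 2 * (lam + k)) (n - 2 * (mu + l)) (rep lam mu g ω) =
      rep (lam + 1) (mu + 1) g (opE (n - 2 * (lam + k)) (n - 2 * (mu + l)) ω) := by
  funext p
  rw [opE_eq _ _ (contDiff_rep hg hω hc)]
  by_cases h : 0 < hg.cone.den p.1 ∧ 0 < hg.cone.den p.2
  · obtain ⟨h1, h2⟩ := h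
    rw [rep_eq_twoPull _ _ hg h1 h2, FormModule.twoPull_add_one _ _ _ _ _ _ (inv_ne_zero h1.ne')
      (inv_ne_zero h2.ne'), FormModule.twoPull, opE_eq _ _ hω]
    rw [← FormModule.twoE_twoPull lam mu (commuting_fst_snd n k l) hg.cone.isMobius h1 h2
      (ω := fun x y => ω (x, y)) hω (hg.cone.twoPoint h1.ne' h2.ne')]
    refine FormModule.twoE_congr _ _ _ _ ?_
    filter_upwards [(hg.cone.isOpen_den_pos.prod hg.cone.isOpen_den_pos).mem_nhds
      (show p ∈ _ ×ˢ _ from ⟨h1, h2⟩)] with q hq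
    exact rep_eq_twoPull lam mu hg hq.1 hq.2 ω
  · rw [rep_eq_zero _ _ hg h, ← FormModule.twoE_zero (fstModule n k l) (sndModule n k l)
      (n - 2 * (lam + k)) (n - 2 * (mu + l)) p.1 p.2]
    refine FormModule.twoE_congr _ _ _ _ ?_
    have h1 := eventually_rep₂_eq_zero (Q := ℝ) (q := 0) (p := p) (g := fun _ => g)
      (g' := fun _ => g) lam mu (fun _ _ => contDiff_const) (fun _ _ => contDiff_const)
      (fun _ => hg) (fun _ => hg) hc h
    exact (contDiff_prodMk_right (𝕜 := ℝ) (n := 0) (F := Euc n × Euc n)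
      (0 : ℝ)).continuous.continuousAt.eventually h1

theorem rep₂_neg (lam mu : ℂ) (g g' : LMat n) (ω : BiForm n k l) :
    rep₂ lam mu g g' (-ω) = -rep₂ lam mu g g' ω := by
  funext p
  have h : ∀ (A B : Euc n →L[ℝ] Euc n) (η : BiAlt n k l), pullback A B (-η) = -pullback A B η :=
    fun A B η => map_neg ((onSnd (ContinuousAlternatingMap.compContinuousLinearMapCLM B)).comp
      (pullAlt A)) η
  simp only [rep₂, Pi.neg_apply, h, smul_neg]
  split_ifs <;> simp

theorem sourceOp_rep {lam mu : ℂ} {g : LMat n} (hg : IsFuture g⁻¹) {ω : BiForm n k l}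
    (hω : ContDiff ℝ ((⊤ : ℕ∞) : WithTop ℕ∞) ω) (hc : HasCompactSupport ω) :
    sourceOp (lam + k) (mu + l) (rep lam mu g ω) =
      rep (lam + 1) (mu + 1) g (sourceOp (lam + k) (mu + l) ω) := by
  rw [sourceOp, sourceOp, opE_rep hg hω hc]
  exact (rep₂_neg _ _ _ _ _).symm

/-! ### Differentiation in a real parameter commutes with the operators. -/

section Parameter

variable {E V : Type*} [NormedAddCommGroup E] [NormedSpace ℝ E] [NormedAddCommGroup V]
  [NormedSpace ℝ V]

theorem deriv_slice {f : ℝ → E → V}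
    (hf : ContDiff ℝ ((⊤ : ℕ∞) : WithTop ℕ∞) (Function.uncurry f)) (t : ℝ) (x : E) :
    deriv (fun τ => f τ x) t = fderiv ℝ (Function.uncurry f) (t, x) (1, 0) := by
  rw [fderiv_slice_fst (p := (t, x)) (hf.differentiable (by simp) _)]
  rfl

theorem contDiff_deriv_slice {f : ℝ → E → V}
    (hf : ContDiff ℝ ((⊤ : ℕ∞) : WithTop ℕ∞) (Function.uncurry f)) (t : ℝ) :
    ContDiff ℝ ((⊤ : ℕ∞) : WithTop ℕ∞) fun x => deriv (fun τ => f τ x) t := by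
  simp only [deriv_slice hf]
  exact (contDiff_fderiv_apply_const hf _).comp (contDiff_prodMk_right t)

theorem hasDerivAt_slice {f : ℝ → E → V}
    (hf : ContDiff ℝ ((⊤ : ℕ∞) : WithTop ℕ∞) (Function.uncurry f)) (t : ℝ) (x : E) :
    HasDerivAt (fun τ => f τ x) (deriv (fun τ => f τ x) t) t :=
  ((hf.comp (contDiff_prodMk_left x)).differentiable (by simp) t).hasDerivAt

/-- Symmetry of the mixed second derivatives of the joint function of parameter and point. -/
theorem hasDerivAt_fderiv_slice {f : ℝ → E → V}
    (hf : ContDiff ℝ ((⊤ : ℕ∞) : WithTop ℕ∞) (Function.uncurry f)) (t : ℝ) (x a : E) :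
    HasDerivAt (fun τ => fderiv ℝ (f τ) x a)
      (fderiv ℝ (fun x => deriv (fun τ => f τ x) t) x a) t := by
  have h1 : ∀ τ x, fderiv ℝ (f τ) x a = fderiv ℝ (Function.uncurry f) (τ, x) (0, a) :=
    fun τ x => (fderiv_slice_snd (p := (τ, x)) (hf.differentiable (by simp) _) a).symm
  have h2 : ContDiff ℝ ((⊤ : ℕ∞) : WithTop ℕ∞)
      (Function.uncurry fun τ x => fderiv ℝ (f τ) x a) := by
    have h3 : (Function.uncurry fun τ x => fderiv ℝ (f τ) x a) =
        fun q => fderiv ℝ (Function.uncurry f) q (0, a) := funext fun q => h1 q.1 q.2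
    rw [h3]
    exact contDiff_fderiv_apply_const hf _
  convert hasDerivAt_slice h2 t x using 1
  rw [deriv_slice h2]
  have h3 : (Function.uncurry fun τ x => fderiv ℝ (f τ) x a) =
      fun q => fderiv ℝ (Function.uncurry f) q (0, a) := funext fun q => h1 q.1 q.2
  rw [h3, fderiv_fderiv_comm hf, fderiv_slice_snd (p := (t, x))
    ((contDiff_fderiv_apply_const hf _).differentiable (by simp) _)]
  simp only [deriv_slice hf]

end Parameter

namespace FormModule

variable {n k l : ℕ} {V : Type} [NormedAddCommGroup V] [NormedSpace ℝ V] [NormedSpace ℂ V]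
  [IsScalarTower ℝ ℂ V] (M : FormModule n k V) {f : ℝ → Euc n → V}

theorem hasDerivAt_nabla (hf : ContDiff ℝ ((⊤ : ℕ∞) : WithTop ℕ∞) (Function.uncurry f)) (s : ℂ)
    (v x : Euc n) (t : ℝ) : HasDerivAt (fun τ => M.nabla s v (f τ) x)
      (M.nabla s v (fun x => deriv (fun τ => f τ x) t) x) t := by
  have h := hasDerivAt_fderiv_slice hf t x
  exact ((((h v).const_smul (alpha n k s)).sub ((HasDerivAt.fun_sum fun m _ =>
    (M.N v (e m)).hasFDerivAt.comp_hasDerivAt t (h (e m))).const_smul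
      (2 * (s - n + 2 * k)))).add ((HasDerivAt.fun_sum fun m _ =>
    (M.N (e m) v).hasFDerivAt.comp_hasDerivAt t (h (e m))).const_smul
      (2 * (s + n - 2 * k)))).const_smul (2 - s)

theorem hasDerivAt_box (hf : ContDiff ℝ ((⊤ : ℕ∞) : WithTop ℕ∞) (Function.uncurry f)) (s : ℂ)
    (x : Euc n) (t : ℝ) : HasDerivAt (fun τ => M.box s (f τ) x)
      (M.box s (fun x => deriv (fun τ => f τ x) t) x) t := by
  have h1 : ∀ a x, fderiv ℝ (fun x => deriv (fun τ => f τ x) t) x a =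
      deriv (fun τ => fderiv ℝ (f τ) x a) t := fun a x => (hasDerivAt_fderiv_slice hf t x a).deriv.symm
  have h : ∀ b a, HasDerivAt (fun τ => fderiv ℝ (fun y => fderiv ℝ (f τ) y a) x b)
      (fderiv ℝ (fun y => fderiv ℝ (fun x => deriv (fun τ => f τ x) t) y a) x b) t := by
    intro b a
    simp only [h1]
    exact hasDerivAt_fderiv_slice (f := fun τ y => fderiv ℝ (f τ) y a)
      (contDiff_fderiv_slice hf a) t x b
  exact ((HasDerivAt.fun_sum fun i _ => h (e i) (e i)).const_smul (alpha n k s)).neg.sub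
    ((HasDerivAt.fun_sum fun i _ => HasDerivAt.fun_sum fun j _ =>
      (M.N (e i) (e j)).hasFDerivAt.comp_hasDerivAt t (h (e i) (e j))).const_smul
        (4 * ((n : ℂ) - 2 * k)))

variable (M₁ : FormModule n k V) (M₂ : FormModule n l V)

theorem hasDerivAt_twoE {ω : ℝ → Euc n → Euc n → V} (hω : ContDiff ℝ ((⊤ : ℕ∞) : WithTop ℕ∞)
      fun q : ℝ × Euc n × Euc n => ω q.1 q.2.1 q.2.2) (s t : ℂ) (x y : Euc n) (τ₀ : ℝ) :
    HasDerivAt (fun τ => M₁.twoE M₂ s t (ω τ) x y)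
      (M₁.twoE M₂ s t (fun x y => deriv (fun τ => ω τ x y) τ₀) x y) τ₀ := by
  have s1 : ∀ x, ContDiff ℝ ((⊤ : ℕ∞) : WithTop ℕ∞) (Function.uncurry fun τ => ω τ x) := fun x =>
    hω.comp (contDiff_fst.prodMk (contDiff_const.prodMk contDiff_snd))
  have s2 : ContDiff ℝ ((⊤ : ℕ∞) : WithTop ℕ∞) (Function.uncurry fun τ x => ω τ x y) :=
    hω.comp (contDiff_fst.prodMk (contDiff_snd.prodMk contDiff_const))
  have s3 : ContDiff ℝ ((⊤ : ℕ∞) : WithTop ℕ∞)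
      (Function.uncurry fun (q : ℝ × Euc n) y => ω q.1 q.2 y) :=
    hω.comp ((contDiff_fst.comp contDiff_fst).prodMk
      ((contDiff_snd.comp contDiff_fst).prodMk contDiff_snd))
  have sb : ContDiff ℝ ((⊤ : ℕ∞) : WithTop ℕ∞)
      (Function.uncurry fun τ x => M₂.box t (ω τ x) y) :=
    (M₂.contDiff_box_slice s3 t).comp (contDiff_id.prodMk contDiff_const)
  have sn : ∀ v, ContDiff ℝ ((⊤ : ℕ∞) : WithTop ℕ∞)
      (Function.uncurry fun τ x => M₂.nabla t v (ω τ x) y) := fun v =>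
    (M₂.contDiff_nabla_slice s3 t v).comp (contDiff_id.prodMk contDiff_const)
  have eb : ∀ x, M₂.box t (fun y => deriv (fun τ => ω τ x y) τ₀) y =
      deriv (fun τ => M₂.box t (ω τ x) y) τ₀ := fun x =>
    (M₂.hasDerivAt_box (s1 x) t y τ₀).deriv.symm
  have en : ∀ v x, M₂.nabla t v (fun y => deriv (fun τ => ω τ x y) τ₀) y =
      deriv (fun τ => M₂.nabla t v (ω τ x) y) τ₀ := fun v x =>
    (M₂.hasDerivAt_nabla (s1 x) t v y τ₀).deriv.symm
  have h1 := M₁.hasDerivAt_box sb s x τ₀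
  have h2 := fun v => M₁.hasDerivAt_nabla sb s v x τ₀
  have h3 := fun v => M₁.hasDerivAt_box (sn v) s x τ₀
  have h4 := fun v w => M₁.hasDerivAt_nabla (sn v) s w x τ₀
  have h5 := M₁.hasDerivAt_box s2 s x τ₀
  have h6 := M₂.hasDerivAt_box (s1 x) t y τ₀
  simp only [← eb, ← en] at h1 h2 h3 h4
  exact ((((h1.const_smul (‖x - y‖ ^ 2)).neg.add ((HasDerivAt.fun_sum fun j _ =>
    ((h2 (e j)).sub (h3 (e j))).const_smul (x j - y j)).const_smul (2 : ℂ))).add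
    ((HasDerivAt.fun_sum fun j _ => h4 (e j) (e j)).const_smul (2 : ℂ))).add
    (h5.const_smul (potential n l t))).add (h6.const_smul (potential n k s))

theorem contDiff_twoE {ω : Euc n → Euc n → V}
    (hω : ContDiff ℝ ((⊤ : ℕ∞) : WithTop ℕ∞) (Function.uncurry ω)) (s t : ℂ) :
    ContDiff ℝ ((⊤ : ℕ∞) : WithTop ℕ∞)
      fun p : Euc n × Euc n => M₁.twoE M₂ s t ω p.1 p.2 := by
  have sw : ContDiff ℝ ((⊤ : ℕ∞) : WithTop ℕ∞) (Prod.swap : Euc n × Euc n → Euc n × Euc n) :=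
    contDiff_snd.prodMk contDiff_fst
  have sb : ContDiff ℝ ((⊤ : ℕ∞) : WithTop ℕ∞)
      (Function.uncurry fun y x => M₂.box t (ω x) y) := (M₂.contDiff_box_slice hω t).comp sw
  have sn : ∀ v, ContDiff ℝ ((⊤ : ℕ∞) : WithTop ℕ∞)
      (Function.uncurry fun y x => M₂.nabla t v (ω x) y) := fun v =>
    (M₂.contDiff_nabla_slice hω t v).comp sw
  have s2 : ContDiff ℝ ((⊤ : ℕ∞) : WithTop ℕ∞) (Function.uncurry fun y x => ω x y) := hω.comp sw
  have h1 := (M₁.contDiff_box_slice sb s).comp sw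
  have h2 := fun v => (M₁.contDiff_nabla_slice sb s v).comp sw
  have h3 := fun v => (M₁.contDiff_box_slice (sn v) s).comp sw
  have h4 := fun v w => (M₁.contDiff_nabla_slice (sn v) s w).comp sw
  have h5 := (M₁.contDiff_box_slice s2 s).comp sw
  have h6 := M₂.contDiff_box_slice hω t
  have hn : ContDiff ℝ ((⊤ : ℕ∞) : WithTop ℕ∞) fun p : Euc n × Euc n => ‖p.1 - p.2‖ ^ 2 :=
    (contDiff_norm_sq ℝ).comp (contDiff_fst.sub contDiff_snd)
  have hj : ∀ j, ContDiff ℝ ((⊤ : ℕ∞) : WithTop ℕ∞) fun p : Euc n × Euc n => p.1 j - p.2 j :=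
    fun j => (contDiff_euclidean.1 contDiff_fst j).sub (contDiff_euclidean.1 contDiff_snd j)
  exact ((((hn.smul h1).neg.add ((ContDiff.sum fun j _ =>
    (hj j).smul ((h2 (e j)).sub (h3 (e j)))).const_smul (2 : ℂ))).add
    ((ContDiff.sum fun j _ => h4 (e j) (e j)).const_smul (2 : ℂ))).add
    (h5.const_smul (potential n l t))).add (h6.const_smul (potential n k s))

end FormModule

variable {n k l : ℕ}

/-! ### One-parameter subgroups. -/

section Exponential

/-- The Lie algebra condition says Xᵀ = J(−X)J⁻¹, and exp commutes with transposition and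
conjugation. -/
theorem transpose_exp_mul_mul_exp {m : Type*} [Fintype m] [DecidableEq m] {J X : Matrix m m ℝ}
    (hJ : J * J = 1) (hX : Xᵀ * J + J * X = 0) :
    (NormedSpace.exp X)ᵀ * J * NormedSpace.exp X = J := by
  have hJ' : J⁻¹ = J := Matrix.inv_eq_left_inv hJ
  have hU : IsUnit J := IsUnit.of_mul_eq_one J hJ
  have h1 : Xᵀ = J * (-X) * J⁻¹ := by
    rw [hJ', mul_neg, ← eq_neg_of_add_eq_zero_left hX, mul_assoc, hJ, mul_one]
  have h2 : (NormedSpace.exp X)ᵀ = J * (NormedSpace.exp X)⁻¹ * J⁻¹ := by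
    rw [← Matrix.exp_transpose, h1, Matrix.exp_conj J (-X) hU, Matrix.exp_neg]
  have h3 : (NormedSpace.exp X)⁻¹ * NormedSpace.exp X = 1 :=
    Matrix.nonsing_inv_mul _ ((Matrix.isUnit_iff_isUnit_det _).1 (Matrix.isUnit_exp X))
  rw [h2, hJ', mul_assoc (J * _) J J, hJ, mul_one, mul_assoc, h3, mul_one]

theorem exp_mem_isometries {X : LMat n} (hX : X ∈ conformalAlgebra n) (t : ℝ) :
    NormedSpace.exp (t • X) ∈ isometries n := by
  refine transpose_exp_mul_mul_exp lorentz_mul_self ?_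
  have hX' : Xᵀ * lorentz n + lorentz n * X = 0 := hX
  rw [Matrix.transpose_smul, Matrix.smul_mul, Matrix.mul_smul, ← smul_add, hX', smul_zero]

attribute [local instance] Matrix.linftyOpNormedRing Matrix.linftyOpNormedAlgebra

theorem contDiff_exp_smul_apply {m : Type*} [Fintype m] [DecidableEq m] (X : Matrix m m ℝ)
    (i j : m) :
    ContDiff ℝ ((⊤ : ℕ∞) : WithTop ℕ∞) fun t : ℝ => NormedSpace.exp (t • X) i j := by
  have h : ContDiff ℝ ((⊤ : ℕ∞) : WithTop ℕ∞) fun t : ℝ => NormedSpace.exp (t • X) :=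
    contDiff_iff_contDiffAt.2 fun t =>
      (NormedSpace.exp_analytic (𝕂 := ℝ) (t • X)).contDiffAt.comp t
        (contDiff_id.smul contDiff_const).contDiffAt
  exact (LinearMap.toContinuousLinearMap
    (Matrix.entryLinearMap ℝ ℝ i j : Matrix m m ℝ →ₗ[ℝ] ℝ)).contDiff.comp h

end Exponential

theorem contDiff_exp_smul (X : LMat n) (i j : Unit ⊕ SphIdx n) :
    ContDiff ℝ ((⊤ : ℕ∞) : WithTop ℕ∞) fun t : ℝ => NormedSpace.exp (t • X) i j :=
  contDiff_exp_smul_apply X i j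

theorem continuous_exp_smul (X : LMat n) : Continuous fun t : ℝ => NormedSpace.exp (t • X) :=
  continuous_matrix fun i j => (contDiff_exp_smul X i j).continuous

/-- The one-parameter subgroup is a connected set of isometries through 1. -/
theorem exp_mem_conformalGroup {X : LMat n} (hX : X ∈ conformalAlgebra n) (t : ℝ) :
    NormedSpace.exp (t • X) ∈ conformalGroup n := by
  refine (isPreconnected_range (continuous_exp_smul X)).subset_connectedComponentIn ?_ ?_ ⟨t, rfl⟩
  · exact ⟨0, by simp⟩
  · rintro _ ⟨s, rfl⟩
    exact exp_mem_isometries hX s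

theorem inv_exp_smul (X : LMat n) (t : ℝ) :
    (NormedSpace.exp (t • X))⁻¹ = NormedSpace.exp ((-t) • X) := by
  rw [← Matrix.exp_neg, neg_smul]

theorem contDiff_inv_exp_smul (X : LMat n) (i j : Unit ⊕ SphIdx n) :
    ContDiff ℝ ((⊤ : ℕ∞) : WithTop ℕ∞) fun t : ℝ => (NormedSpace.exp (t • X))⁻¹ i j := by
  simp only [inv_exp_smul]
  exact (contDiff_exp_smul X i j).comp contDiff_neg

theorem isFuture_inv_exp {X : LMat n} (hX : X ∈ conformalAlgebra n) (t : ℝ) :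
    IsFuture (NormedSpace.exp (t • X))⁻¹ :=
  isFuture_inv (exp_mem_conformalGroup hX t)

theorem isFuture_inv_one : IsFuture (1 : LMat n)⁻¹ := by
  rw [inv_one]
  exact isFuture_one

theorem matDen_one (x : Euc n) : matDen (1 : LMat n) x = 1 := by
  rw [matDen, Matrix.one_mulVec]
  simp [emb, conePt]

theorem act_one (x : Euc n) : act (1 : LMat n) x = x := by
  rw [isFuture_one.act_eq_matNum]
  change (matDen 1 x)⁻¹ • matNum 1 x = x
  rw [matDen_one, inv_one, one_smul]
  ext i
  simp [matNum, emb, conePt]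

/-- For `g`, `g'` close to the identity, `rep₂` is local. -/
theorem eventually_rep₂_congr (lam mu : ℂ) {ω ω' : BiForm n k l} {g g' : ℝ → LMat n} {t : ℝ}
    (hg : ∀ i j, ContDiff ℝ ((⊤ : ℕ∞) : WithTop ℕ∞) fun q => (g q)⁻¹ i j)
    (hg' : ∀ i j, ContDiff ℝ ((⊤ : ℕ∞) : WithTop ℕ∞) fun q => (g' q)⁻¹ i j)
    (hF : ∀ q, IsFuture (g q)⁻¹) (hF' : ∀ q, IsFuture (g' q)⁻¹) (h1 : g t = 1) (h1' : g' t = 1)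
    {p : Euc n × Euc n} (h : ω =ᶠ[nhds p] ω') :
    ∀ᶠ τ in nhds t, rep₂ lam mu (g τ) (g' τ) ω p = rep₂ lam mu (g τ) (g' τ) ω' p := by
  have key : ∀ {g : ℝ → LMat n},
      (∀ i j, ContDiff ℝ ((⊤ : ℕ∞) : WithTop ℕ∞) fun q => (g q)⁻¹ i j) →
      (∀ q, IsFuture (g q)⁻¹) → g t = 1 → ∀ x : Euc n,
      Filter.Tendsto (fun τ => act (g τ)⁻¹ x) (nhds t) (nhds x) := by
    intro g hg hF h1 x
    have h2 : 0 < matDen (g t)⁻¹ x := by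
      rw [h1, inv_one, matDen_one]
      exact one_pos
    have h3 := (contDiffAt_act hg hF h2).continuousAt.tendsto
    have h4 : Filter.Tendsto (fun τ => (τ, x)) (nhds t) (nhds (t, x)) :=
      (continuous_id.prodMk continuous_const).tendsto t
    have h5 := h3.comp h4
    rw [h1, inv_one, act_one] at h5
    exact h5
  have h2 := ((key hg hF h1 p.1).prodMk_nhds (key hg' hF' h1' p.2)).eventually h
  filter_upwards [h2] with τ hτ
  rw [rep₂, rep₂, hτ]

theorem infRep_congr (lam mu : ℂ) {X : LMat n} (hX : X ∈ conformalAlgebra n) {ω ω' : BiForm n k l}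
    {p : Euc n × Euc n} (h : ω =ᶠ[nhds p] ω') :
    infRep lam mu X ω =ᶠ[nhds p] infRep lam mu X ω' := by
  filter_upwards [h.eventuallyEq_nhds] with q hq
  have h0 : NormedSpace.exp ((0 : ℝ) • X) = 1 := by simp
  rw [infRep, infRep]
  congr 1
  · exact Filter.EventuallyEq.deriv_eq (eventually_rep₂_congr lam mu (g := fun t => NormedSpace.exp (t • X)) (g' := fun _ => 1)
      (contDiff_inv_exp_smul X) (fun _ _ => contDiff_const) (isFuture_inv_exp hX)
      (fun _ => isFuture_inv_one) h0 rfl hq)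
  · exact Filter.EventuallyEq.deriv_eq (eventually_rep₂_congr lam mu (g := fun _ => 1) (g' := fun t => NormedSpace.exp (t • X))
      (fun _ _ => contDiff_const) (contDiff_inv_exp_smul X) (fun _ => isFuture_inv_one)
      (isFuture_inv_exp hX) rfl h0 hq)

/-- Identifies the sum of the two derivatives that defines `infRep` with the derivative of the
diagonal action. -/
theorem deriv_diag {V : Type*} [NormedAddCommGroup V] [NormedSpace ℝ V] {H : ℝ → ℝ → V}
    (hH : ContDiff ℝ ((⊤ : ℕ∞) : WithTop ℕ∞) (Function.uncurry H)) (t : ℝ) :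
    deriv (fun τ => H τ τ) t = deriv (fun τ => H τ t) t + deriv (fun τ => H t τ) t := by
  have hd := hH.differentiable (by simp) (t, t)
  have h1 : deriv (fun τ => H τ t) t = fderiv ℝ (Function.uncurry H) (t, t) (1, 0) :=
    deriv_slice hH t t
  have h2 : deriv (fun τ => H t τ) t = fderiv ℝ (Function.uncurry H) (t, t) (0, 1) := by
    rw [fderiv_slice_snd hd]
    rfl
  have h3 : HasDerivAt (fun τ => Function.uncurry H (τ, τ)) _ t :=
    HasFDerivAt.comp_hasDerivAt (f := fun τ => (τ, τ)) t hd.hasFDerivAt ((hasDerivAt_id t).prodMk (hasDerivAt_id t))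
  rw [h1, h2, ← map_add, Prod.mk_add_mk, add_zero, zero_add]
  exact h3.deriv

theorem contDiff_rep_exp (lam mu : ℂ) {X : LMat n} (hX : X ∈ conformalAlgebra n)
    {ω : BiForm n k l} (hω : ContDiff ℝ ((⊤ : ℕ∞) : WithTop ℕ∞) ω) (hc : HasCompactSupport ω) :
    ContDiff ℝ ((⊤ : ℕ∞) : WithTop ℕ∞)
      (Function.uncurry fun t : ℝ => rep lam mu (NormedSpace.exp (t • X)) ω) := by
  have h := contDiff_rep₂ (g := fun t : ℝ => NormedSpace.exp (t • X))
    (g' := fun t : ℝ => NormedSpace.exp (t • X)) lam mu (contDiff_inv_exp_smul X) (contDiff_inv_exp_smul X) (isFuture_inv_exp hX)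
    (isFuture_inv_exp hX) hω hc
  exact h

theorem infRep_eq_deriv (lam mu : ℂ) {X : LMat n} (hX : X ∈ conformalAlgebra n)
    {ω : BiForm n k l} (hω : ContDiff ℝ ((⊤ : ℕ∞) : WithTop ℕ∞) ω) (hc : HasCompactSupport ω) :
    infRep lam mu X ω =
      fun p => deriv (fun t : ℝ => rep lam mu (NormedSpace.exp (t • X)) ω p) 0 := by
  funext p
  have hfst : ∀ i j, ContDiff ℝ ((⊤ : ℕ∞) : WithTop ℕ∞)
      fun q : ℝ × ℝ => (NormedSpace.exp (q.1 • X))⁻¹ i j :=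
    fun i j => (contDiff_inv_exp_smul X i j).comp contDiff_fst
  have hsnd : ∀ i j, ContDiff ℝ ((⊤ : ℕ∞) : WithTop ℕ∞)
      fun q : ℝ × ℝ => (NormedSpace.exp (q.2 • X))⁻¹ i j :=
    fun i j => (contDiff_inv_exp_smul X i j).comp contDiff_snd
  have h := (contDiff_rep₂ (g := fun q : ℝ × ℝ => NormedSpace.exp (q.1 • X))
    (g' := fun q : ℝ × ℝ => NormedSpace.exp (q.2 • X)) lam mu hfst hsnd (fun q => isFuture_inv_exp hX q.1)
    (fun q => isFuture_inv_exp hX q.2) hω hc)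
  have key : ∀ {f : (ℝ × ℝ) × (Euc n × Euc n) → BiAlt n k l},
      ContDiff ℝ ((⊤ : ℕ∞) : WithTop ℕ∞) f →
      ContDiff ℝ ((⊤ : ℕ∞) : WithTop ℕ∞) fun q => f (q, p) :=
    fun hf => hf.comp (contDiff_prodMk_left p)
  have h0 : NormedSpace.exp ((0 : ℝ) • X) = 1 := by simp
  have h2 := deriv_diag (H := fun s t => rep₂ lam mu (NormedSpace.exp (s • X))
    (NormedSpace.exp (t • X)) ω p) (key h) 0
  simp only [h0] at h2
  exact h2.symm

theorem opE_congr (s t : ℂ) {ω ω' : BiForm n k l} (hω : ContDiff ℝ ((⊤ : ℕ∞) : WithTop ℕ∞) ω)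
    (hω' : ContDiff ℝ ((⊤ : ℕ∞) : WithTop ℕ∞) ω') {p : Euc n × Euc n} (h : ω =ᶠ[nhds p] ω') :
    opE s t ω p = opE s t ω' p := by
  rw [opE_eq s t hω, opE_eq s t hω']
  exact FormModule.twoE_congr _ _ _ _ h

theorem contDiff_opE (s t : ℂ) {ω : BiForm n k l} (hω : ContDiff ℝ ((⊤ : ℕ∞) : WithTop ℕ∞) ω) :
    ContDiff ℝ ((⊤ : ℕ∞) : WithTop ℕ∞) (opE s t ω) := by
  rw [funext (opE_eq s t hω)]
  exact FormModule.contDiff_twoE _ _ (ω := fun x y => ω (x, y)) hω s t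

/-- A local operator that annihilates 0 does not enlarge supports. -/
theorem hasCompactSupport_opE (s t : ℂ) {ω : BiForm n k l}
    (hω : ContDiff ℝ ((⊤ : ℕ∞) : WithTop ℕ∞) ω) (hc : HasCompactSupport ω) :
    HasCompactSupport (opE s t ω) := by
  refine HasCompactSupport.intro hc.isCompact fun p hp => ?_
  rw [opE_eq s t hω, ← FormModule.twoE_zero (fstModule n k l) (sndModule n k l) s t p.1 p.2]
  exact FormModule.twoE_congr _ _ _ _ (notMem_tsupport_iff_eventuallyEq.1 hp)

/-! ### Infinitesimal covariance: compact support first, then cut-off. -/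

variable {n k l : ℕ}

theorem contDiff_infRep_of_hasCompactSupport (lam mu : ℂ) {X : LMat n}
    (hX : X ∈ conformalAlgebra n) {ω : BiForm n k l} (hω : ContDiff ℝ ((⊤ : ℕ∞) : WithTop ℕ∞) ω)
    (hc : HasCompactSupport ω) :
    ContDiff ℝ ((⊤ : ℕ∞) : WithTop ℕ∞) (infRep lam mu X ω) := by
  rw [infRep_eq_deriv lam mu hX hω hc]
  exact contDiff_deriv_slice (contDiff_rep_exp lam mu hX hω hc) 0

/-- The derivative at t = 0 of `opE_rep` along exp(tX); E passes through the derivative by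
`hasDerivAt_twoE`. -/
theorem opE_infRep_of_hasCompactSupport (lam mu : ℂ) {X : LMat n} (hX : X ∈ conformalAlgebra n)
    {ω : BiForm n k l} (hω : ContDiff ℝ ((⊤ : ℕ∞) : WithTop ℕ∞) ω) (hc : HasCompactSupport ω) :
    opE (n - 2 * (lam + k)) (n - 2 * (mu + l)) (infRep lam mu X ω) =
      infRep (lam + 1) (mu + 1) X (opE (n - 2 * (lam + k)) (n - 2 * (mu + l)) ω) := by
  rw [infRep_eq_deriv (lam + 1) (mu + 1) hX (contDiff_opE _ _ hω) (hasCompactSupport_opE _ _ hω hc)]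
  funext p
  rw [opE_eq _ _ (contDiff_infRep_of_hasCompactSupport lam mu hX hω hc)]
  have h := contDiff_rep_exp lam mu hX hω hc
  have h1 : ∀ t : ℝ, rep (lam + 1) (mu + 1) (NormedSpace.exp (t • X))
      (opE (n - 2 * (lam + k)) (n - 2 * (mu + l)) ω) p =
      (fstModule n k l).twoE (sndModule n k l) (n - 2 * (lam + k)) (n - 2 * (mu + l))
        (fun x y => rep lam mu (NormedSpace.exp (t • X)) ω (x, y)) p.1 p.2 := fun t => by
    rw [← opE_rep (isFuture_inv_exp hX t) hω hc, opE_eq _ _ (contDiff_rep (isFuture_inv_exp hX t) hω hc)]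
  simp only [h1, infRep_eq_deriv lam mu hX hω hc]
  have h2 := FormModule.hasDerivAt_twoE (fstModule n k l) (sndModule n k l)
    (ω := fun t x y => rep lam mu (NormedSpace.exp (t • X)) ω (x, y)) h (n - 2 * (lam + k))
    (n - 2 * (mu + l)) p.1 p.2 0
  exact h2.deriv.symm

theorem exists_hasCompactSupport_eventuallyEq {ω : BiForm n k l}
    (hω : ContDiff ℝ ((⊤ : ℕ∞) : WithTop ℕ∞) ω) (p : Euc n × Euc n) :
    ∃ ω' : BiForm n k l, ContDiff ℝ ((⊤ : ℕ∞) : WithTop ℕ∞) ω' ∧ HasCompactSupport ω' ∧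
      ω =ᶠ[nhds p] ω' := by
  let χ : ContDiffBump p := ⟨1, 2, one_pos, one_lt_two⟩
  refine ⟨fun q => χ q • ω q, χ.contDiff.smul hω, χ.hasCompactSupport.smul_right, ?_⟩
  filter_upwards [χ.eventuallyEq_one] with q hq
  rw [hq, Pi.one_apply, one_smul]

theorem contDiff_infRep (lam mu : ℂ) {X : LMat n} (hX : X ∈ conformalAlgebra n) {ω : BiForm n k l}
    (hω : ContDiff ℝ ((⊤ : ℕ∞) : WithTop ℕ∞) ω) :
    ContDiff ℝ ((⊤ : ℕ∞) : WithTop ℕ∞) (infRep lam mu X ω) := by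
  refine contDiff_iff_contDiffAt.2 fun p => ?_
  obtain ⟨ω', hω', hc, h⟩ := exists_hasCompactSupport_eventuallyEq hω p
  exact (contDiff_infRep_of_hasCompactSupport lam mu hX hω' hc).contDiffAt.congr_of_eventuallyEq
    (infRep_congr lam mu hX h)

/-- At a given point both sides depend only on the germ of ω, so ω may be replaced by a compactly
supported form that agrees with it near the point. -/
theorem opE_infRep (lam mu : ℂ) {X : LMat n} (hX : X ∈ conformalAlgebra n) {ω : BiForm n k l}
    (hω : ContDiff ℝ ((⊤ : ℕ∞) : WithTop ℕ∞) ω) :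
    opE (n - 2 * (lam + k)) (n - 2 * (mu + l)) (infRep lam mu X ω) =
      infRep (lam + 1) (mu + 1) X (opE (n - 2 * (lam + k)) (n - 2 * (mu + l)) ω) := by
  funext p
  obtain ⟨ω', hω', hc, h⟩ := exists_hasCompactSupport_eventuallyEq hω p
  have h1 : opE (n - 2 * (lam + k)) (n - 2 * (mu + l)) ω =ᶠ[nhds p]
      opE (n - 2 * (lam + k)) (n - 2 * (mu + l)) ω' := by
    filter_upwards [h.eventuallyEq_nhds] with q hq using opE_congr _ _ hω hω' hq
  rw [(infRep_congr (lam + 1) (mu + 1) hX h1).eq_of_nhds,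
    ← opE_infRep_of_hasCompactSupport lam mu hX hω' hc]
  exact opE_congr _ _ (contDiff_infRep lam mu hX hω) (contDiff_infRep lam mu hX hω')
    (infRep_congr lam mu hX h)

theorem infRep_neg (lam mu : ℂ) (X : LMat n) (ω : BiForm n k l) :
    infRep lam mu X (-ω) = -infRep lam mu X ω := by
  funext p
  simp only [infRep, rep₂_neg, Pi.neg_apply, deriv.fun_neg, neg_add]

theorem sourceOp_infRep (lam mu : ℂ) {X : LMat n} (hX : X ∈ conformalAlgebra n) {ω : BiForm n k l}
    (hω : ContDiff ℝ ((⊤ : ℕ∞) : WithTop ℕ∞) ω) :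
    sourceOp (lam + k) (mu + l) (infRep lam mu X ω) =
      infRep (lam + 1) (mu + 1) X (sourceOp (lam + k) (mu + l) ω) := by
  rw [sourceOp, sourceOp, opE_infRep lam mu hX hω, infRep_neg]

end ConformalForms

end

theorem mainTheorem1 (n k l : ℕ) (hk : k ≤ n) (hl : l ≤ n) (lam mu : ℂ) :
    (∀ X ∈ ConformalForms.conformalAlgebra n,
      ∀ ω : ConformalForms.BiForm n k l, ContDiff ℝ ((⊤ : ℕ∞) : WithTop ℕ∞) ω →
        ConformalForms.sourceOp (lam + k) (mu + l) (ConformalForms.infRep lam mu X ω) =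
          ConformalForms.infRep (lam + 1) (mu + 1) X
            (ConformalForms.sourceOp (lam + k) (mu + l) ω)) ∧
    (∀ g ∈ ConformalForms.conformalGroup n,
      ∀ ω : ConformalForms.BiForm n k l, ContDiff ℝ ((⊤ : ℕ∞) : WithTop ℕ∞) ω → HasCompactSupport ω →
        ContDiff ℝ ((⊤ : ℕ∞) : WithTop ℕ∞) (ConformalForms.rep lam mu g ω) ∧
        ConformalForms.sourceOp (lam + k) (mu + l) (ConformalForms.rep lam mu g ω) =
          ConformalForms.rep (lam + 1) (mu + 1) g
            (ConformalForms.sourceOp (lam + k) (mu + l) ω)) := by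
  exact ⟨fun X hX ω hω => ConformalForms.sourceOp_infRep lam mu hX hω, fun g hg ω hω hc =>
    ⟨ConformalForms.contDiff_rep (ConformalForms.isFuture_inv hg) hω hc,
      ConformalForms.sourceOp_rep (ConformalForms.isFuture_inv hg) hω hc⟩⟩
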